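/- **Conventions.** All $L_\infty$-algebras $\mathfrak g$ are finite-dimensional and $\mathbb N_+$-graded and are given by their Chevalley–Eilenberg algebra $\mathrm{CE}(\mathfrak g)=(\wedge^\bullet\mathfrak g^*,d)$, a differential graded-commutative algebra (dgca) over $\mathbb R$ that is free on generators of positive degree. The Weil algebra $W(\mathfrak g)$ is free on $\mathfrak g^*\oplus\mathfrak g^*[1]$ with $d a=d_{\mathrm{CE}}a+\sigma a$ and $d\sigma a=-\sigma(d_{\mathrm{CE}}a)$ for $a\in\mathfrak g^*$, where the shift $\sigma:\mathfrak g^*\to\mathfrak g^*[1]$ is extended as a derivation of degree $1$ vanishing on $\mathfrak g^*[1]$. The invariant polynomials $\mathrm{inv}(\mathfrak g)\subset W(\mathfrak g)$ are the elements $P$ with $\iota_XP=0$ and $\iota_XdP=0$ for all $X\in\mathfrak g$, where $\iota_X$ is the contraction with $X$ (which vanishes on $\mathfrak g^*[1]$). $b^{k-1}\mathfrak u(1)$ has $\mathrm{CE}$-algebra free on one generator $h$ of degree $k$, with $dh=0$. If $\mathfrak h\hookrightarrow\mathfrak g$ is a normal sub-$L_\infty$-algebra with dual $t^*:\mathrm{CE}(\mathfrak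 g)\to\mathrm{CE}(\mathfrak h)$, the mapping cone $\mathrm{CE}(\mathfrak h\hookrightarrow\mathfrak g)$ is free on $\mathfrak g^*\oplus\mathfrak h^*[1]$ with $d a=d_{\mathfrak g}a+\sigma t^*a$ and $d\,\sigma t^*a=-\sigma t^*(d_{\mathfrak g}a)$ for $a\in\mathfrak g^*$. Let $\pi:Y\to X$ be a smooth surjective submersion of finite-dimensional manifolds and $\Omega^\bullet_{\mathrm{vert}}(Y)$ the quotient of $\Omega^\bullet(Y)$ by the forms vanishing on vertical vectors. A *$\mathfrak g$-descent object* is a dgca morphism $A_{\mathrm{vert}}:\mathrm{CE}(\mathfrak g)\to\Omega^\bullet_{\mathrm{vert}}(Y)$. A *$\mathfrak g$-connection descent object* is a triple $(A_{\mathrm{vert}},A,K)$ of dgca morphisms, with $A_{\mathrm{vert}}$ as before, $A:W(\mathfrak g)\to\Omega^\bullet(Y)$ and $K:\mathrm{inv}(\mathfrak g)\to\Omega^\bullet(X)$, compatible with the canonical maps $\mathrm{inv}(\mathfrak g)\hookrightarrow W(\mathfrak g)\twoheadrightarrow\mathrm{CE}(\mathfrak g)$ and $\Omega^\bullet(X)\xrightarrow{\pi^*}\Omega^\bullet(Y)\twoheadrightarrow\Omega^\bullet_{\mathrm{vert}}(Y)$.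 The characteristic class of a closed $P\in\mathrm{inv}(\mathfrak g)$ is $[K(P)]\in H_{dR}(X)$; we write $P(F_A)=A(P)$. Two dgca morphisms $A\to B$ are *concordant* if they are the two endpoint restrictions of a dgca morphism $A\to B\otimes\Omega^\bullet([0,1])$. A morphism out of $\mathrm{CE}(\mathfrak g)$ is *trivial* if it is concordant to one that vanishes on all generators. **Theorem.** Let $n\ge 1$, let $\mu\in\mathrm{CE}(\mathfrak g)$ be a cocycle of degree $n+1$ that transgresses to the invariant polynomial $P\in\mathrm{inv}(\mathfrak g)$ through $\mathrm{cs}\in W(\mathfrak g)$, that is, $\mathrm{cs}$ has degree $n+1$, $d\,\mathrm{cs}=P$ and $\mathrm{cs}|_{\mathrm{CE}(\mathfrak g)}=\mu$. Let $\mathfrak g_\mu$ be the String-like extension: $\mathrm{CE}(\mathfrak g_\mu)$ is $\mathrm{CE}(\mathfrak g)$ with a further generator $b$ of degree $n$ and $db=-\mu$. Let $\mathrm{CE}(\mathrm{cs}_P(\mathfrak g))$ be $W(\mathfrak g)$ with further generators $c,b$ of degrees $n+1,n$ and $dc=P$, $db=c-\mathrm{cs}$. Put $C=\mathrm{CE}(b^{n-1}\mathfrak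 u(1)\hookrightarrow\mathfrak g_\mu)$ and $\hat C=\mathrm{CE}(\mathrm{inn}(b^{n-1}\mathfrak u(1))\hookrightarrow\mathrm{cs}_P(\mathfrak g))$, where $\mathrm{CE}(\mathrm{inn}(\mathfrak h))=W(\mathfrak h)$ and the two subalgebras are dual to the generator $b$ and to the generators $b,c$. 1. There are dgca morphisms $f:\mathrm{CE}(\mathfrak g)\to C$ and $f^{-1}:C\to\mathrm{CE}(\mathfrak g)$ which are the identity on $\mathfrak g^*$, with $f^{-1}(b)=0$, $f^{-1}(\sigma b)=\mu$, and $j:\mathrm{CE}(b^n\mathfrak u(1))\to C$, $h\mapsto\sigma b$. There are dgca morphisms $\hat f:W(\mathfrak g)\to\hat C$ and $\hat f^{-1}:\hat C\to W(\mathfrak g)$ which are the identity on $\mathfrak g^*\oplus\mathfrak g^*[1]$, with $\hat f^{-1}(b)=\hat f^{-1}(c)=0$, $\hat f^{-1}(\sigma b)=\mathrm{cs}$, $\hat f^{-1}(\sigma c)=-P$, and $\hat\jmath:W(b^n\mathfrak u(1))\to\hat C$, $h\mapsto\sigma b$, $\sigma h\mapsto-\sigma c$. Moreover $f^{-1}f=\mathrm{id}$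 and $\hat f^{-1}\hat f=\mathrm{id}$, while $f f^{-1}$ and $\hat f\hat f^{-1}$ are concordant and cochain homotopic to the identity, so that $f^{-1}$ and $\hat f^{-1}$ are weak inverses of $f$ and $\hat f$. 2. (Obstruction, descent objects.) For every $\mathfrak g$-descent object $A_{\mathrm{vert}}$ on $X$, the $b^n\mathfrak u(1)$-descent object $A_{\mathrm{vert}}\circ f^{-1}\circ j$, given by $h\mapsto A_{\mathrm{vert}}(\mu)$, is the obstruction to a lift: $A_{\mathrm{vert}}$ extends along $\mathrm{CE}(\mathfrak g)\hookrightarrow\mathrm{CE}(\mathfrak g_\mu)$ to a $\mathfrak g_\mu$-descent object if and only if $A_{\mathrm{vert}}\circ f^{-1}\circ j$ is trivial. 3. (Obstruction, connection descent objects.) For every $\mathfrak g$-connection descent object $(A_{\mathrm{vert}},A,K)$ on $X$, $$A'_{\mathrm{vert}}=A_{\mathrm{vert}}\circ f^{-1}\circ j,\qquad A'=A\circ\hat f^{-1}\circ\hat\jmath,\qquad K'=K\circ(\hat f^{-1}\circ\hat\jmath)|_{\mathrm{inv}(b^n\mathfrak u(1))}$$ is a $b^n\mathfrak u(1)$-connection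 descent object (in particular $\hat f^{-1}\hat\jmath$ maps $\mathrm{inv}(b^n\mathfrak u(1))$ into $\mathrm{inv}(\mathfrak g)$). Its connection form is the Chern–Simons form, $A'(h)=\mathrm{CS}_P(A):=A(\mathrm{cs})$, and its curvature is $A'(\sigma h)=P(F_A)$, which descends to $K'(\sigma h)=K(P)$ on $X$. The algebra $\mathrm{inv}(b^n\mathfrak u(1))$ is generated by $\sigma h$, and the single characteristic class $[K'(\sigma h)]\in H_{dR}(X)$ is the characteristic class $[K(P)]$ of $P$ for the original object. The pair $(A_{\mathrm{vert}},A)$ extends to a pair of dgca morphisms $\mathrm{CE}(\mathfrak g_\mu)\to\Omega^\bullet_{\mathrm{vert}}(Y)$, $W(\mathfrak g_\mu)\to\Omega^\bullet(Y)$ that is compatible with the projections $W(\mathfrak g_\mu)\to\mathrm{CE}(\mathfrak g_\mu)$ and $\Omega^\bullet(Y)\to\Omega^\bullet_{\mathrm{vert}}(Y)$ if and only if $A'_{\mathrm{vert}}$ is trivial. In particular, if $(A_{\mathrm{vert}},A,K)$ lifts to a $\mathfrak g_\mu$-connection descent object, then $A'_{\mathrm{vert}}$ is trivial. -/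

import Mathlib

open scoped ContDiff Manifold TensorProduct

noncomputable section

namespace LiftObstruction

/-! ### Differential graded-commutative algebras -/

universe u v w

/-- A differential graded-commutative algebra over `ℝ`, with its submodules `gr p` of elements of
degree `p`. -/
structure DGCA where
  carrier : Type u
  [ring : Ring carrier]
  [alg : Algebra ℝ carrier]
  gr : ℕ → Submodule ℝ carrier
  d : carrier →ₗ[ℝ] carrier
  one_mem : (1 : carrier) ∈ gr 0
  mul_mem : ∀ {p q : ℕ} {x y : carrier}, x ∈ gr p → y ∈ gr q → x * y ∈ gr (p + q)
  comm : ∀ {p q : ℕ} {x y : carrier}, x ∈ gr p → y ∈ gr q →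
    x * y = (-1 : ℝ) ^ (p * q) • (y * x)
  d_mem : ∀ {p : ℕ} {x : carrier}, x ∈ gr p → d x ∈ gr (p + 1)
  leibniz : ∀ {p : ℕ} {x : carrier}, x ∈ gr p → ∀ y : carrier,
    d (x * y) = d x * y + (-1 : ℝ) ^ p • (x * d y)
  d_d : ∀ x : carrier, d (d x) = 0

attribute [instance] DGCA.ring DGCA.alg

/-- Morphisms of differential graded-commutative algebras. -/
structure DGHom (A : DGCA.{u}) (B : DGCA.{v}) extends A.carrier →ₐ[ℝ] B.carrier where
  map_gr : ∀ (p : ℕ) (x : A.carrier), x ∈ A.gr p → toFun x ∈ B.gr p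
  map_d : ∀ x : A.carrier, toFun (A.d x) = B.d (toFun x)

namespace DGHom

instance (A : DGCA.{u}) (B : DGCA.{v}) : CoeFun (DGHom A B) (fun _ => A.carrier → B.carrier) :=
  ⟨fun f => f.toAlgHom⟩

/-- Composition `g ∘ f`. -/
def comp {A : DGCA.{u}} {B : DGCA.{v}} {C : DGCA.{w}} (g : DGHom B C) (f : DGHom A B) :
    DGHom A C where
  toAlgHom := g.toAlgHom.comp f.toAlgHom
  map_gr p x hx := g.map_gr p _ (f.map_gr p x hx)
  map_d x := (congrArg g (f.map_d x)).trans (g.map_d _)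

/-- The identity morphism. -/
def id (A : DGCA.{u}) : DGHom A A where
  toAlgHom := AlgHom.id ℝ A.carrier
  map_gr _ _ hx := hx
  map_d _ := rfl

end DGHom

namespace DGCA

/-- The closed elements. -/
def cocycles (A : DGCA.{u}) : Submodule ℝ A.carrier := LinearMap.ker A.d

/-- The exact elements among the closed ones. -/
def coboundaries (A : DGCA.{u}) : Submodule ℝ A.cocycles :=
  (LinearMap.range A.d).comap A.cocycles.subtype

/-- The (total) cohomology `H(A) = ker d / im d`. -/
abbrev Cohomology (A : DGCA.{u}) : Type u := A.cocycles ⧸ A.coboundaries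

/-- The cohomology class of a closed element. -/
def cls (A : DGCA.{u}) (x : A.carrier) (hx : A.d x = 0) : A.Cohomology :=
  Submodule.Quotient.mk ⟨x, hx⟩

end DGCA

/-- The map induced on cohomology. -/
def DGHom.mapCohomology {A : DGCA.{u}} {B : DGCA.{v}} (f : DGHom A B) :
    A.Cohomology →ₗ[ℝ] B.Cohomology :=
  Submodule.mapQ _ _
    (f.toAlgHom.toLinearMap.restrict (p := A.cocycles) (q := B.cocycles) (by
      intro x hx
      have hx' : A.d x = 0 := hx
      change B.d (f x) = 0
      have h := f.map_d x
      rw [hx'] at h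
      exact h.symm.trans (map_zero f.toAlgHom)))
    (by
      rintro ⟨x, hx⟩ ⟨y, hy⟩
      exact ⟨f y, (f.map_d y).symm.trans (congrArg f hy)⟩)

/-! ### Free graded-commutative algebras -/

/-- The relations of graded commutativity between generators. -/
inductive FGC.Rel {ι : Type} (deg : ι → ℕ) : FreeAlgebra ℝ ι → FreeAlgebra ℝ ι → Prop
  | comm (i j : ι) : FGC.Rel deg (FreeAlgebra.ι ℝ i * FreeAlgebra.ι ℝ j)
      ((-1 : ℝ) ^ (deg i * deg j) • (FreeAlgebra.ι ℝ j * FreeAlgebra.ι ℝ i))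

/-- The free graded-commutative algebra `∧•(V)` on the graded vector space `V` with homogeneous
basis `ι`, the basis vector `i` being of degree `deg i`. -/
def FGC {ι : Type} (deg : ι → ℕ) : Type := RingQuot (FGC.Rel deg)

namespace FGC

variable {ι : Type} {deg : ι → ℕ}

instance : Ring (FGC deg) := inferInstanceAs (Ring (RingQuot (FGC.Rel deg)))

instance : Algebra ℝ (FGC deg) := inferInstanceAs (Algebra ℝ (RingQuot (FGC.Rel deg)))

/-- The generators. -/
def gen (deg : ι → ℕ) (i : ι) : FGC deg := RingQuot.mkAlgHom ℝ (FGC.Rel deg) (FreeAlgebra.ι ℝ i)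

theorem gen_comm (i j : ι) :
    gen deg i * gen deg j = (-1 : ℝ) ^ (deg i * deg j) • (gen deg j * gen deg i) := by
  have h := RingQuot.mkAlgHom_rel ℝ (FGC.Rel.comm (deg := deg) i j)
  rw [map_mul, map_smul, map_mul] at h
  exact h

/-- The universal property: algebra maps are given on generators. -/
def lift {B : Type*} [Ring B] [Algebra ℝ B] (φ : ι → B)
    (h : ∀ i j, φ i * φ j = (-1 : ℝ) ^ (deg i * deg j) • (φ j * φ i)) : FGC deg →ₐ[ℝ] B :=
  RingQuot.liftAlgHom ℝ ⟨FreeAlgebra.lift ℝ φ, by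
    rintro _ _ ⟨i, j⟩
    simpa using h i j⟩

@[simp]
theorem lift_gen {B : Type*} [Ring B] [Algebra ℝ B] (φ : ι → B)
    (h : ∀ i j, φ i * φ j = (-1 : ℝ) ^ (deg i * deg j) • (φ j * φ i)) (i : ι) :
    lift φ h (gen deg i) = φ i := by
  simp only [lift, gen]
  erw [RingQuot.liftAlgHom_mkAlgHom_apply]
  simp

theorem algHom_ext {B : Type*} [Ring B] [Algebra ℝ B] {f g : FGC deg →ₐ[ℝ] B}
    (h : ∀ i, f (gen deg i) = g (gen deg i)) : f = g := by
  apply RingQuot.ringQuot_ext' ℝ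
  apply FreeAlgebra.hom_ext
  funext i
  exact h i

/-- The product of a list of generators. -/
def mon (deg : ι → ℕ) (l : List ι) : FGC deg := (l.map (gen deg)).prod

@[simp] theorem mon_nil : mon deg [] = 1 := rfl

@[simp] theorem mon_cons (i : ι) (l : List ι) : mon deg (i :: l) = gen deg i * mon deg l := by
  simp [mon]

theorem mon_append (l m : List ι) : mon deg (l ++ m) = mon deg l * mon deg m := by
  simp [mon]

theorem span_mon : Submodule.span ℝ (Set.range (mon deg)) = ⊤ := by
  rw [eq_top_iff]
  let S : Subalgebra ℝ (FGC deg) :=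
    (Submodule.span ℝ (Set.range (mon deg))).toSubalgebra
      (Submodule.subset_span ⟨[], rfl⟩) (by
        intro x y hx hy
        induction hx using Submodule.span_induction with
        | mem x hx =>
          obtain ⟨l, rfl⟩ := hx
          induction hy using Submodule.span_induction with
          | mem y hy =>
            obtain ⟨m, rfl⟩ := hy
            exact Submodule.subset_span ⟨l ++ m, mon_append l m⟩
          | zero => simp
          | add y z _ _ h1 h2 => rw [mul_add]; exact Submodule.add_mem _ h1 h2
          | smul a y _ h => rw [mul_smul_comm]; exact Submodule.smul_mem _ _ h
        | zero => simp
        | add y z _ _ h1 h2 => rw [add_mul]; exact Submodule.add_mem _ h1 h2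
        | smul a y _ h => rw [smul_mul_assoc]; exact Submodule.smul_mem _ _ h)
  let f : FGC deg →ₐ[ℝ] S := lift (fun i => ⟨gen deg i, Submodule.subset_span ⟨[i], by simp⟩⟩)
    (by intro i j; ext; exact gen_comm i j)
  have hf : S.val.comp f = AlgHom.id ℝ _ := algHom_ext (fun i => by simp [f])
  intro x _
  have := (f x).2
  rw [show ((f x : S) : FGC deg) = x from DFunLike.congr_fun hf x] at this
  exact this

theorem induction_mon {p : FGC deg → Prop} (hm : ∀ l, p (mon deg l))
    (ha : ∀ x y, p x → p y → p (x + y)) (hs : ∀ (a : ℝ) x, p x → p (a • x)) (x : FGC deg) :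
    p x := by
  have hx : x ∈ Submodule.span ℝ (Set.range (mon deg)) := by rw [span_mon]; trivial
  induction hx using Submodule.span_induction with
  | mem x hx => obtain ⟨l, rfl⟩ := hx; exact hm l
  | zero => simpa using hs 0 _ (hm [])
  | add x y _ _ h1 h2 => exact ha x y h1 h2
  | smul a x _ h => exact hs a x h

/-- The elements of degree `p`. -/
def gr (deg : ι → ℕ) (p : ℕ) : Submodule ℝ (FGC deg) :=
  Submodule.span ℝ {x | ∃ l : List ι, (l.map deg).sum = p ∧ x = mon deg l}

theorem mon_mem (l : List ι) : mon deg l ∈ gr deg (l.map deg).sum :=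
  Submodule.subset_span ⟨l, rfl, rfl⟩

theorem gen_mem (i : ι) : gen deg i ∈ gr deg (deg i) := by
  simpa using mon_mem (deg := deg) [i]

theorem one_mem : (1 : FGC deg) ∈ gr deg 0 := by simpa using mon_mem (deg := deg) []

theorem mul_mem {p q : ℕ} {x y : FGC deg} (hx : x ∈ gr deg p) (hy : y ∈ gr deg q) :
    x * y ∈ gr deg (p + q) := by
  induction hx using Submodule.span_induction with
  | mem x hx =>
    obtain ⟨l, rfl, rfl⟩ := hx
    induction hy using Submodule.span_induction with
    | mem y hy =>
      obtain ⟨m, rfl, rfl⟩ := hy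
      rw [← mon_append, ← List.sum_append, ← List.map_append]
      exact mon_mem _
    | zero => simp
    | add y z _ _ h1 h2 => rw [mul_add]; exact Submodule.add_mem _ h1 h2
    | smul a y _ h => rw [mul_smul_comm]; exact Submodule.smul_mem _ _ h
  | zero => simp
  | add y z _ _ h1 h2 => rw [add_mul]; exact Submodule.add_mem _ h1 h2
  | smul a y _ h => rw [smul_mul_assoc]; exact Submodule.smul_mem _ _ h

theorem gen_mul_mon (i : ι) (l : List ι) :
    gen deg i * mon deg l = (-1 : ℝ) ^ (deg i * (l.map deg).sum) • (mon deg l * gen deg i) := by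
  induction l with
  | nil => simp
  | cons j l ih =>
    rw [mon_cons, ← mul_assoc, gen_comm, smul_mul_assoc, mul_assoc, ih, mul_smul_comm, smul_smul,
      ← pow_add, mul_assoc]
    simp [mul_add]

theorem mon_mul_mon (l m : List ι) :
    mon deg l * mon deg m =
      (-1 : ℝ) ^ ((l.map deg).sum * (m.map deg).sum) • (mon deg m * mon deg l) := by
  induction l with
  | nil => simp
  | cons j l ih =>
    rw [mon_cons, mul_assoc, ih, mul_smul_comm, ← mul_assoc, gen_mul_mon, smul_mul_assoc,
      smul_smul, ← pow_add, mul_assoc, List.map_cons, List.sum_cons]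
    congr 2
    ring

theorem comm {p q : ℕ} {x y : FGC deg} (hx : x ∈ gr deg p) (hy : y ∈ gr deg q) :
    x * y = (-1 : ℝ) ^ (p * q) • (y * x) := by
  induction hx using Submodule.span_induction with
  | mem x hx =>
    obtain ⟨l, rfl, rfl⟩ := hx
    induction hy using Submodule.span_induction with
    | mem y hy =>
      obtain ⟨m, rfl, rfl⟩ := hy
      exact mon_mul_mon l m
    | zero => simp
    | add y z _ _ h1 h2 => rw [mul_add, add_mul, smul_add, h1, h2]
    | smul a y _ h => rw [mul_smul_comm, smul_mul_assoc, h, smul_comm]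
  | zero => simp
  | add y z _ _ h1 h2 => rw [mul_add, add_mul, smul_add, h1, h2]
  | smul a y _ h => rw [mul_smul_comm, smul_mul_assoc, h, smul_comm]

/-- The algebra map induced by a degree-preserving map of generators. -/
def map {κ : Type} {deg' : κ → ℕ} (e : ι → κ) (he : ∀ i, deg' (e i) = deg i) :
    FGC deg →ₐ[ℝ] FGC deg' :=
  lift (fun i => gen deg' (e i)) (by intro i j; rw [← he i, ← he j]; exact gen_comm _ _)

@[simp]
theorem map_gen {κ : Type} {deg' : κ → ℕ} (e : ι → κ) (he : ∀ i, deg' (e i) = deg i) (i : ι) :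
    map e he (gen deg i) = gen deg' (e i) := lift_gen _ _ _

theorem map_mem {κ : Type} {deg' : κ → ℕ} (e : ι → κ) (he : ∀ i, deg' (e i) = deg i) {p : ℕ}
    {x : FGC deg} (hx : x ∈ gr deg p) : map e he x ∈ gr deg' p := by
  induction hx using Submodule.span_induction with
  | mem x hx =>
    obtain ⟨l, rfl, rfl⟩ := hx
    have h1 : map e he (mon deg l) = mon deg' (l.map e) := by
      induction l with
      | nil => simp
      | cons i l ih => simp [ih]
    have h2 : (l.map deg).sum = ((l.map e).map deg').sum := by simp [Function.comp_def, he]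
    rw [h1, h2]
    exact mon_mem _
  | zero => simp
  | add y z _ _ h1 h2 => rw [map_add]; exact Submodule.add_mem _ h1 h2
  | smul a y _ h => rw [map_smul]; exact Submodule.smul_mem _ _ h

/-- The parity automorphism, `x ↦ (-1)^p x` in degree `p`. -/
def parity (deg : ι → ℕ) : FGC deg →ₐ[ℝ] FGC deg :=
  lift (fun i => (-1 : ℝ) ^ deg i • gen deg i) (by
    intro i j
    simp only [smul_mul_smul_comm]
    rw [gen_comm, smul_comm, mul_comm ((-1 : ℝ) ^ deg i) ((-1 : ℝ) ^ deg j)])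

@[simp] theorem parity_gen (i : ι) : parity deg (gen deg i) = (-1 : ℝ) ^ deg i • gen deg i :=
  lift_gen _ _ _

theorem parity_mem {p : ℕ} {x : FGC deg} (hx : x ∈ gr deg p) :
    parity deg x = (-1 : ℝ) ^ p • x := by
  induction hx using Submodule.span_induction with
  | mem x hx =>
    obtain ⟨l, rfl, rfl⟩ := hx
    induction l with
    | nil => simp
    | cons i l ih => simp [ih, smul_smul, pow_add, mul_comm]
  | zero => simp
  | add y z _ _ h1 h2 => rw [map_add, smul_add, h1, h2]
  | smul a y _ h => rw [map_smul, h, smul_comm]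

theorem parity_pow_gen (k : ℕ) (i : ι) :
    ((parity deg) ^ k) (gen deg i) = (-1 : ℝ) ^ (k * deg i) • gen deg i := by
  induction k with
  | zero => simp
  | succ k ih =>
    rw [pow_succ', AlgHom.mul_apply, ih, map_smul, parity_gen, smul_smul, ← pow_add]
    congr 2
    ring

/-- The condition on the values `v i` on the generators of a derivation of parity `k`. -/
def IsDerivData (deg : ι → ℕ) (k : ℕ) (v : ι → FGC deg) : Prop :=
  ∀ i j, gen deg i * v j = (-1 : ℝ) ^ (deg i * (deg j + k)) • (v j * gen deg i)

theorem isDerivData_of_mem {v : ι → FGC deg} (hv : ∀ i, v i ∈ gr deg (deg i + 1)) :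
    IsDerivData deg 1 v := fun i j => comm (gen_mem i) (hv j)

/-- Auxiliary: `x ↦ (ε^k x, τ x; 0, x)`, multiplicative precisely when `τ` is a derivation. -/
def derivAux (k : ℕ) (v : ι → FGC deg) (hv : IsDerivData deg k v) :
    FGC deg →ₐ[ℝ] Matrix (Fin 2) (Fin 2) (FGC deg) :=
  lift (fun i => !![((parity deg) ^ k) (gen deg i), v i; 0, gen deg i]) (by
    intro i j
    have h2 : (-1 : ℝ) ^ (k * deg i) • (gen deg i * v j) =
        (-1 : ℝ) ^ (deg i * deg j) • (v j * gen deg i) := by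
      rw [hv i j, smul_smul, ← pow_add,
        show k * deg i + deg i * (deg j + k) = deg i * deg j + 2 * (k * deg i) by ring,
        pow_add, pow_mul (-1 : ℝ) 2]
      simp
    have h3 : v i * gen deg j =
        (-1 : ℝ) ^ (deg i * deg j) • ((-1 : ℝ) ^ (k * deg j) • (gen deg j * v i)) := by
      rw [hv j i, smul_smul, smul_smul, ← pow_add, ← pow_add,
        show deg i * deg j + k * deg j + deg j * (deg i + k) =
          2 * (deg i * deg j + k * deg j) by ring, pow_mul]
      simp
    rw [parity_pow_gen, parity_pow_gen]
    ext a b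
    fin_cases a <;> fin_cases b
    · simp only [Matrix.mul_apply, Fin.sum_univ_two, Matrix.smul_apply]
      simp only [Fin.zero_eta, Fin.isValue, Matrix.of_apply, Matrix.cons_val', Matrix.cons_val_zero,
        Matrix.cons_val_fin_one, Matrix.cons_val_one, mul_zero, add_zero, smul_mul_smul_comm]
      rw [gen_comm, smul_comm, mul_comm ((-1 : ℝ) ^ (k * deg i))]
    · simp only [Matrix.mul_apply, Fin.sum_univ_two, Matrix.smul_apply]
      simp [h2, h3, add_comm]
    · simp [Matrix.mul_apply, Fin.sum_univ_two]
    · simp only [Matrix.mul_apply, Fin.sum_univ_two, Matrix.smul_apply]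
      simp [gen_comm i j])

/-- The derivation of parity `k` (so that `τ (x y) = τ x y + ε^k(x) τ y`) with the values `v` on
the generators. -/
def deriv (k : ℕ) (v : ι → FGC deg) (hv : IsDerivData deg k v) : FGC deg →ₗ[ℝ] FGC deg where
  toFun x := derivAux k v hv x 0 1
  map_add' x y := by simp
  map_smul' a x := by simp

theorem derivAux_zero_zero (k : ℕ) (v : ι → FGC deg) (hv : IsDerivData deg k v) (x : FGC deg) :
    derivAux k v hv x 0 0 = ((parity deg) ^ k) x ∧ derivAux k v hv x 1 0 = 0 ∧
      derivAux k v hv x 1 1 = x := by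
  induction x using induction_mon with
  | hm l =>
    induction l with
    | nil => simp
    | cons i l ih =>
      have hg : derivAux k v hv (gen deg i) = !![((parity deg) ^ k) (gen deg i), v i; 0, gen deg i] :=
        lift_gen _ _ _
      simp only [mon_cons, map_mul, Matrix.mul_apply, Fin.sum_univ_two, hg, ih.1, ih.2.1, ih.2.2]
      simp
  | ha x y h1 h2 => simp [h1, h2]
  | hs a x h => simp [h]

@[simp]
theorem deriv_gen (k : ℕ) (v : ι → FGC deg) (hv : IsDerivData deg k v) (i : ι) :
    deriv k v hv (gen deg i) = v i := by
  simp [deriv, derivAux]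

theorem deriv_mul (k : ℕ) (v : ι → FGC deg) (hv : IsDerivData deg k v) (x y : FGC deg) :
    deriv k v hv (x * y) = deriv k v hv x * y + ((parity deg) ^ k) x * deriv k v hv y := by
  have hx := derivAux_zero_zero k v hv x
  have hy := derivAux_zero_zero k v hv y
  change derivAux k v hv (x * y) 0 1 = derivAux k v hv x 0 1 * y + _ * derivAux k v hv y 0 1
  rw [map_mul, Matrix.mul_apply, Fin.sum_univ_two, hx.1, hy.2.2, add_comm]

theorem deriv_one (k : ℕ) (v : ι → FGC deg) (hv : IsDerivData deg k v) :
    deriv k v hv 1 = 0 := by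
  have := deriv_mul k v hv 1 1
  simpa using this

theorem deriv_mem {v : ι → FGC deg} (hv : ∀ i, v i ∈ gr deg (deg i + 1)) {p : ℕ} {x : FGC deg}
    (hx : x ∈ gr deg p) : deriv 1 v (isDerivData_of_mem hv) x ∈ gr deg (p + 1) := by
  induction hx using Submodule.span_induction with
  | mem x hx =>
    obtain ⟨l, rfl, rfl⟩ := hx
    induction l with
    | nil => simp [deriv_one]
    | cons i l ih =>
      rw [mon_cons, deriv_mul, deriv_gen, pow_one, parity_gen, smul_mul_assoc, List.map_cons,
        List.sum_cons]
      refine Submodule.add_mem _ ?_ (Submodule.smul_mem _ _ ?_)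
      · rw [add_right_comm]
        exact mul_mem (hv i) (mon_mem l)
      · rw [add_assoc]
        exact mul_mem (gen_mem i) ih
  | zero => simp
  | add y z _ _ h1 h2 => rw [map_add]; exact Submodule.add_mem _ h1 h2
  | smul a y _ h => rw [map_smul]; exact Submodule.smul_mem _ _ h

theorem deriv_leibniz {v : ι → FGC deg} (hv : IsDerivData deg 1 v) {p : ℕ}
    {x : FGC deg} (hx : x ∈ gr deg p) (y : FGC deg) :
    deriv 1 v hv (x * y) = deriv 1 v hv x * y + (-1 : ℝ) ^ p • (x * deriv 1 v hv y) := by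
  rw [deriv_mul, pow_one, parity_mem hx, smul_mul_assoc]

theorem deriv_deriv {v : ι → FGC deg} (hv : ∀ i, v i ∈ gr deg (deg i + 1))
    (h : ∀ i, deriv 1 v (isDerivData_of_mem hv) (v i) = 0) (x : FGC deg) :
    deriv 1 v (isDerivData_of_mem hv) (deriv 1 v (isDerivData_of_mem hv) x) = 0 := by
  induction x using induction_mon with
  | hm l =>
    induction l with
    | nil => simp [deriv_one]
    | cons i l ih =>
      rw [mon_cons, deriv_leibniz _ (gen_mem i), map_add, map_smul, deriv_gen,
        deriv_leibniz _ (hv i), deriv_leibniz _ (gen_mem i), ih, h i, deriv_gen, pow_succ]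
      simp
  | ha x y h1 h2 => simp [h1, h2]
  | hs a x h => simp [h]

end FGC

/-! ### `L_∞`-algebras -/

/-- A finite-dimensional `L_∞`-algebra `𝔤`, `ℕ₊`-graded, in the dual description by its
Chevalley–Eilenberg algebra: `𝔤*` has the homogeneous basis `ι`, and `∧•(𝔤*)` carries a
differential. -/
structure LInfty where
  ι : Type
  [fin : Fintype ι]
  deg : ι → ℕ
  deg_pos : ∀ i, 0 < deg i
  d : FGC deg →ₗ[ℝ] FGC deg
  d_mem : ∀ {p : ℕ} {x : FGC deg}, x ∈ FGC.gr deg p → d x ∈ FGC.gr deg (p + 1)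
  leibniz : ∀ {p : ℕ} {x : FGC deg}, x ∈ FGC.gr deg p → ∀ y : FGC deg,
    d (x * y) = d x * y + (-1 : ℝ) ^ p • (x * d y)
  d_d : ∀ x : FGC deg, d (d x) = 0

attribute [instance] LInfty.fin

namespace LInfty

/-- The Chevalley–Eilenberg algebra `CE(𝔤)`. -/
def CE (g : LInfty) : DGCA.{0} where
  carrier := FGC g.deg
  gr := FGC.gr g.deg
  d := g.d
  one_mem := FGC.one_mem
  mul_mem := FGC.mul_mem
  comm := FGC.comm
  d_mem := g.d_mem
  leibniz := g.leibniz
  d_d := g.d_d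

/-- The generators of `CE(𝔤)`. -/
def gen (g : LInfty) (i : g.ι) : FGC g.deg := FGC.gen g.deg i

/-- A differential given on generators. -/
def ofGen {ι : Type} [Fintype ι] (deg : ι → ℕ) (hdeg : ∀ i, 0 < deg i) (v : ι → FGC deg)
    (hv : ∀ i, v i ∈ FGC.gr deg (deg i + 1))
    (h : ∀ i, FGC.deriv 1 v (FGC.isDerivData_of_mem hv) (v i) = 0) : LInfty where
  ι := ι
  deg := deg
  deg_pos := hdeg
  d := FGC.deriv 1 v (FGC.isDerivData_of_mem hv)
  d_mem := FGC.deriv_mem hv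
  leibniz := FGC.deriv_leibniz _
  d_d := FGC.deriv_deriv hv h

theorem d_one (g : LInfty) : g.d 1 = 0 := by
  have := g.leibniz FGC.one_mem 1
  simpa using this

theorem d_mul (g : LInfty) (x y : FGC g.deg) :
    g.d (x * y) = g.d x * y + FGC.parity g.deg x * g.d y := by
  induction x using FGC.induction_mon with
  | hm l => rw [g.leibniz (FGC.mon_mem l), FGC.parity_mem (FGC.mon_mem l), smul_mul_assoc]
  | ha x z h1 h2 => rw [add_mul, map_add, map_add, map_add, h1, h2, add_mul, add_mul]; abel
  | hs a x h => simp [h]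

end LInfty

namespace FGC

variable {ι κ : Type} {deg : ι → ℕ} {deg' : κ → ℕ}

theorem algHom_eq_zero {B : Type*} [Ring B] [Algebra ℝ B] (φ : FGC deg →ₐ[ℝ] B)
    (h : ∀ i, φ (gen deg i) = 0) {p : ℕ} (hp : 0 < p) {x : FGC deg} (hx : x ∈ gr deg p) :
    φ x = 0 := by
  induction hx using Submodule.span_induction with
  | mem x hx =>
    obtain ⟨l, rfl, rfl⟩ := hx
    cases l with
    | nil => simp at hp
    | cons i l => simp [h]
  | zero => simp
  | add y z _ _ h1 h2 => rw [map_add, h1, h2, add_zero]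
  | smul a y _ h => rw [map_smul, h, smul_zero]

/-- Two derivations along an algebra map agree if they agree on generators. -/
theorem deriv_ext (φ : FGC deg →ₐ[ℝ] FGC deg') (D E : FGC deg →ₗ[ℝ] FGC deg')
    (hD : ∀ i y, D (gen deg i * y) = D (gen deg i) * φ y + (-1 : ℝ) ^ deg i • (φ (gen deg i) * D y))
    (hE : ∀ i y, E (gen deg i * y) = E (gen deg i) * φ y + (-1 : ℝ) ^ deg i • (φ (gen deg i) * E y))
    (h1 : D 1 = E 1) (h : ∀ i, D (gen deg i) = E (gen deg i)) : D = E := by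
  ext x
  induction x using induction_mon with
  | hm l =>
    induction l with
    | nil => simpa using h1
    | cons i l ih => rw [mon_cons, hD, hE, h, ih]
  | ha x y h1 h2 => simp [h1, h2]
  | hs a x h => simp [h]

end FGC

namespace LInfty

/-- The inclusion of generators into a larger free algebra. -/
def incl (g : LInfty) {κ : Type} (deg' : κ → ℕ) :
    FGC g.deg →ₐ[ℝ] FGC (Sum.elim g.deg deg') := FGC.map Sum.inl (fun _ => rfl)

theorem deriv_incl (g : LInfty) {κ : Type} (deg' : κ → ℕ)
    (v : g.ι ⊕ κ → FGC (Sum.elim g.deg deg'))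
    (hv : FGC.IsDerivData (Sum.elim g.deg deg') 1 v)
    (h : ∀ i, v (Sum.inl i) = g.incl deg' (g.d (g.gen i))) (x : FGC g.deg) :
    FGC.deriv 1 v hv (g.incl deg' x) = g.incl deg' (g.d x) := by
  have := FGC.deriv_ext (g.incl deg') (FGC.deriv 1 v hv ∘ₗ (g.incl deg').toLinearMap)
    ((g.incl deg').toLinearMap ∘ₗ g.d) ?_ ?_ ?_ ?_
  · exact DFunLike.congr_fun this x
  · intro i y
    have hi : g.incl deg' (FGC.gen g.deg i) ∈ FGC.gr (Sum.elim g.deg deg') (g.deg i) :=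
      FGC.map_mem _ _ (FGC.gen_mem i)
    simp [FGC.deriv_leibniz hv hi]
  · intro i y
    simp [g.leibniz (FGC.gen_mem i)]
  · simp [FGC.deriv_one, g.d_one]
  · intro i
    have : FGC.deriv 1 v hv (g.incl deg' (FGC.gen g.deg i)) = v (Sum.inl i) := by
      rw [incl, FGC.map_gen (deg := g.deg) (deg' := Sum.elim g.deg deg') Sum.inl (fun _ => rfl) i,
        FGC.deriv_gen]
    simp only [LinearMap.comp_apply, AlgHom.toLinearMap_apply]
    exact this.trans (h i)

/-- The `L_∞`-algebra whose Chevalley–Eilenberg algebra arises from `CE(𝔤)` by adding one generator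
`b = gen (inr ())` of degree `n` with `d b = z`, for a closed `z` of degree `n + 1`. -/
def addGen (g : LInfty) (n : ℕ) (hn : 0 < n) (z : FGC g.deg) (hz : z ∈ FGC.gr g.deg (n + 1))
    (hdz : g.d z = 0) : LInfty :=
  ofGen (ι := g.ι ⊕ Unit) (Sum.elim g.deg (fun _ => n))
    (by rintro (i | _); exacts [g.deg_pos i, hn])
    (Sum.elim (fun i => g.incl _ (g.d (g.gen i))) (fun _ => g.incl _ z))
    (by
      rintro (i | _)
      · exact FGC.map_mem _ _ (g.d_mem (FGC.gen_mem i))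
      · exact FGC.map_mem _ _ hz)
    (by
      rintro (i | _)
      · simp only [Sum.elim_inl]
        rw [deriv_incl _ _ _ _ (fun _ => rfl), g.d_d, map_zero]
      · simp only [Sum.elim_inr]
        rw [deriv_incl _ _ _ _ (fun _ => rfl), hdz, map_zero])

/-- `b^{k-1}𝔲(1)`: one generator, of degree `k ≥ 1`, and zero differential. -/
def line (k : ℕ) (hk : 0 < k) : LInfty :=
  ofGen (ι := Unit) (fun _ => k) (fun _ => hk) (fun _ => 0) (fun _ => Submodule.zero_mem _)
    (fun _ => map_zero _)

end LInfty

/-! ### Normal sub-`L_∞`-algebras and mapping cones -/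

/-- A normal sub-`L_∞`-algebra `t : 𝔥 ↪ 𝔤`, in a basis of `𝔤*` adapted to the surjection
`𝔤* → 𝔥*`: the basis of `𝔥*` is the part `s` of the basis of `𝔤*`, and the remaining basis
vectors span the kernel. The map `t* = res` has to be a morphism `CE(𝔤) → CE(𝔥)`, and the
differentials of the basis vectors in the kernel have to lie in `∧•(ker t₁*)`. -/
structure NormalSub (h g : LInfty) where
  s : h.ι → g.ι
  inj : Function.Injective s
  deg_s : ∀ x, g.deg (s x) = h.deg x
  res : FGC g.deg →ₐ[ℝ] FGC h.deg
  res_s : ∀ x, res (g.gen (s x)) = h.gen x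
  res_ker : ∀ i, i ∉ Set.range s → res (g.gen i) = 0
  res_d : ∀ i, res (g.d (g.gen i)) = h.d (res (g.gen i))
  normal : ∀ i, i ∉ Set.range s →
    g.d (g.gen i) ∈ Algebra.adjoin ℝ (g.gen '' (Set.range s)ᶜ)

namespace NormalSub

variable {h g : LInfty} (t : NormalSub h g)

/-- The degrees of the generators of `∧•(𝔤* ⊕ 𝔥*[1])`. -/
def coneDeg (_t : NormalSub h g) : g.ι ⊕ h.ι → ℕ := Sum.elim g.deg (fun x => h.deg x + 1)

open Classical in
/-- The values of `σt*` on generators: `t*` followed by the shift on `𝔤*`, zero on `𝔥*[1]`. -/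
def shiftVal : g.ι ⊕ h.ι → FGC t.coneDeg
  | Sum.inl i => if hi : ∃ x, t.s x = i then FGC.gen t.coneDeg (Sum.inr hi.choose) else 0
  | Sum.inr _ => 0

theorem shiftVal_s (x : h.ι) : t.shiftVal (Sum.inl (t.s x)) = FGC.gen t.coneDeg (Sum.inr x) := by
  have hx : ∃ y, t.s y = t.s x := ⟨x, rfl⟩
  simp only [shiftVal, dif_pos hx]
  rw [t.inj hx.choose_spec]

theorem shiftVal_ker {i : g.ι} (hi : i ∉ Set.range t.s) : t.shiftVal (Sum.inl i) = 0 := by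
  simp only [shiftVal]
  exact dif_neg hi

theorem shiftVal_mem (i : g.ι ⊕ h.ι) : t.shiftVal i ∈ FGC.gr t.coneDeg (t.coneDeg i + 1) := by
  rcases i with i | x
  · by_cases hi : i ∈ Set.range t.s
    · obtain ⟨x, rfl⟩ := hi
      rw [shiftVal_s]
      have := FGC.gen_mem (deg := t.coneDeg) (Sum.inr x)
      simpa [coneDeg, t.deg_s] using this
    · rw [t.shiftVal_ker hi]
      exact Submodule.zero_mem _
  · exact Submodule.zero_mem _

/-- The derivation `σt*` of degree `1` of `∧•(𝔤* ⊕ 𝔥*[1])`. -/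
def shift : FGC t.coneDeg →ₗ[ℝ] FGC t.coneDeg :=
  FGC.deriv 1 t.shiftVal (FGC.isDerivData_of_mem t.shiftVal_mem)

/-- The inclusion `∧•(𝔤*) → ∧•(𝔤* ⊕ 𝔥*[1])`. -/
def incl : FGC g.deg →ₐ[ℝ] FGC t.coneDeg := g.incl _

@[simp] theorem incl_gen (i : g.ι) : t.incl (g.gen i) = FGC.gen t.coneDeg (Sum.inl i) :=
  FGC.map_gen _ (fun _ => rfl) _

theorem incl_mem {p : ℕ} {x : FGC g.deg} (hx : x ∈ FGC.gr g.deg p) :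
    t.incl x ∈ FGC.gr t.coneDeg p := FGC.map_mem _ (fun _ => rfl) hx

/-- The differential of the mapping cone on generators:
`d_t a = d a + σt*(a)` for `a ∈ 𝔤*`, and `d_t (σt*(a)) = -σt*(d a)`. -/
def coneVal : g.ι ⊕ h.ι → FGC t.coneDeg
  | Sum.inl i => t.incl (g.d (g.gen i)) + t.shift (t.incl (g.gen i))
  | Sum.inr x => -t.shift (t.incl (g.d (g.gen (t.s x))))

theorem shift_mem {p : ℕ} {x : FGC t.coneDeg} (hx : x ∈ FGC.gr t.coneDeg p) :
    t.shift x ∈ FGC.gr t.coneDeg (p + 1) := FGC.deriv_mem t.shiftVal_mem hx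

theorem coneVal_mem (i : g.ι ⊕ h.ι) : t.coneVal i ∈ FGC.gr t.coneDeg (t.coneDeg i + 1) := by
  rcases i with i | x
  · exact Submodule.add_mem _ (t.incl_mem (g.d_mem (FGC.gen_mem i)))
      (t.shift_mem (t.incl_mem (FGC.gen_mem i)))
  · refine Submodule.neg_mem _ ?_
    have := t.shift_mem (t.incl_mem (g.d_mem (FGC.gen_mem (t.s x))))
    rw [t.deg_s] at this
    exact this

/-- The differential `d_t`. -/
def coneD : FGC t.coneDeg →ₗ[ℝ] FGC t.coneDeg :=
  FGC.deriv 1 t.coneVal (FGC.isDerivData_of_mem t.coneVal_mem)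

theorem coneD_incl (x : FGC g.deg) :
    t.coneD (t.incl x) = t.incl (g.d x) + t.shift (t.incl x) := by
  have := FGC.deriv_ext t.incl (t.coneD ∘ₗ t.incl.toLinearMap)
    (t.incl.toLinearMap ∘ₗ g.d + t.shift ∘ₗ t.incl.toLinearMap) ?_ ?_ ?_ ?_
  · exact DFunLike.congr_fun this x
  · intro i y
    have hi : t.incl (FGC.gen g.deg i) ∈ FGC.gr t.coneDeg (g.deg i) := t.incl_mem (FGC.gen_mem i)
    simp [coneD, FGC.deriv_leibniz _ hi]
  · intro i y
    have hi : t.incl (FGC.gen g.deg i) ∈ FGC.gr t.coneDeg (g.deg i) := t.incl_mem (FGC.gen_mem i)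
    simp only [LinearMap.add_apply, LinearMap.comp_apply, AlgHom.toLinearMap_apply, map_mul,
      g.leibniz (FGC.gen_mem i), map_add, map_smul, shift, FGC.deriv_leibniz _ hi, add_mul, mul_add,
      smul_add]
    abel
  · simp [coneD, shift, FGC.deriv_one, g.d_one]
  · intro i
    change t.coneD (t.incl (g.gen i)) = t.incl (g.d (g.gen i)) + t.shift (t.incl (g.gen i))
    rw [incl_gen]
    simp [coneD, coneVal]

theorem shift_incl_adjoin {x : FGC g.deg}
    (hx : x ∈ Algebra.adjoin ℝ (g.gen '' (Set.range t.s)ᶜ)) : t.shift (t.incl x) = 0 := by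
  induction hx using Algebra.adjoin_induction with
  | mem x hx =>
    obtain ⟨i, hi, rfl⟩ := hx
    rw [incl_gen, shift, FGC.deriv_gen, t.shiftVal_ker hi]
  | algebraMap r =>
    rw [AlgHom.commutes, Algebra.algebraMap_eq_smul_one, map_smul, shift, FGC.deriv_one, smul_zero]
  | add x y _ _ h1 h2 => rw [map_add, map_add, h1, h2, add_zero]
  | mul x y _ _ h1 h2 =>
    rw [shift] at h1 h2 ⊢
    rw [map_mul, FGC.deriv_mul, h1, h2, zero_mul, mul_zero, add_zero]

theorem coneD_coneVal_inl (i : g.ι) : t.coneD (t.coneVal (Sum.inl i)) = 0 := by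
  simp only [coneVal, map_add]
  rw [coneD_incl, g.d_d, map_zero, zero_add, incl_gen]
  by_cases hi : i ∈ Set.range t.s
  · obtain ⟨x, rfl⟩ := hi
    rw [shift, FGC.deriv_gen, shiftVal_s, coneD, FGC.deriv_gen]
    simp [coneVal, shift]
  · rw [t.shift_incl_adjoin (t.normal i hi), shift, FGC.deriv_gen, t.shiftVal_ker hi, map_zero,
      add_zero]

theorem coneD_coneD_incl (x : FGC g.deg) : t.coneD (t.coneD (t.incl x)) = 0 := by
  induction x using FGC.induction_mon with
  | hm l =>
    induction l with
    | nil => simp [coneD, FGC.deriv_one]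
    | cons i l ih =>
      have hi : t.incl (FGC.gen g.deg i) ∈ FGC.gr t.coneDeg (g.deg i) :=
        t.incl_mem (FGC.gen_mem i)
      have h1 : t.coneD (t.incl (FGC.gen g.deg i)) = t.coneVal (Sum.inl i) := by
        change t.coneD (t.incl (g.gen i)) = _
        rw [incl_gen, coneD, FGC.deriv_gen]
      have h2 := t.coneD_coneVal_inl i
      have h3 := t.coneVal_mem (Sum.inl i)
      have h3' : t.coneVal (Sum.inl i) ∈ FGC.gr t.coneDeg (g.deg i + 1) := h3
      rw [coneD] at ih h1 h2 ⊢
      rw [FGC.mon_cons, map_mul, FGC.deriv_leibniz _ hi, map_add, map_smul, h1,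
        FGC.deriv_leibniz _ h3', FGC.deriv_leibniz _ hi, ih, h2, h1, pow_succ]
      simp
  | ha x y h1 h2 => simp [h1, h2]
  | hs a x h => simp [h]

theorem coneD_coneVal (i : g.ι ⊕ h.ι) : t.coneD (t.coneVal i) = 0 := by
  rcases i with i | x
  · exact t.coneD_coneVal_inl i
  · have h1 := t.coneD_incl (g.d (g.gen (t.s x)))
    rw [g.d_d, map_zero, zero_add] at h1
    simp only [coneVal, map_neg, ← h1, coneD_coneD_incl, neg_zero]

/-- The `L_∞`-algebra `(𝔥 ↪ 𝔤)` given by the mapping cone of `t*`. Its generators are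
`inl i` for the basis of `𝔤*`, and `inr x` (written `σ x`) for the basis of `𝔥*[1]`. -/
def cone : LInfty :=
  LInfty.ofGen (ι := g.ι ⊕ h.ι) t.coneDeg
    (by
      rintro (i | x)
      · exact g.deg_pos i
      · exact Nat.succ_pos _)
    t.coneVal t.coneVal_mem t.coneD_coneVal

/-- The identity of `𝔤`. -/
def refl (g : LInfty) : NormalSub g g where
  s := id
  inj := Function.injective_id
  deg_s _ := rfl
  res := AlgHom.id ℝ _
  res_s _ := rfl
  res_ker i hi := absurd ⟨i, rfl⟩ hi
  res_d _ := rfl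
  normal i hi := absurd ⟨i, rfl⟩ hi

end NormalSub

namespace LInfty

/-- `inn(𝔤)`, the mapping cone of the identity. Its Chevalley–Eilenberg algebra is the
Weil algebra of `𝔤`. -/
def inn (g : LInfty) : LInfty := (NormalSub.refl g).cone

/-- The Weil algebra `W(𝔤)`, with generators `inl i` in `𝔤*` and `inr i` (written `σ i`) in the
shifted copy `𝔤*[1]`. -/
abbrev W (g : LInfty) : DGCA.{0} := g.inn.CE

/-- The projection `W(𝔤) → CE(𝔤)`, killing `𝔤*[1]`. -/
def toCE (g : LInfty) : FGC g.inn.deg →ₐ[ℝ] FGC g.deg :=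
  FGC.lift (Sum.elim g.gen (fun _ => 0)) (by
    rintro (i | i) (j | j)
    · exact FGC.gen_comm i j
    · simp
    · simp
    · simp)

open Classical in
/-- The values of the contraction with the basis vector of `𝔤` dual to `i`. -/
def contractionVal (g : LInfty) (i : g.ι) : g.inn.ι → FGC g.inn.deg :=
  Sum.elim (fun j => if j = i then 1 else 0) (fun _ => 0)

theorem isDerivData_contractionVal (g : LInfty) (i : g.ι) :
    FGC.IsDerivData g.inn.deg (g.deg i) (g.contractionVal i) := by
  intro a b
  rcases b with j | j
  · by_cases h : j = i
    · subst h
      have : g.inn.deg (Sum.inl j) = g.deg j := rfl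
      simp [contractionVal, this, ← two_mul, mul_left_comm _ 2, pow_mul]
    · simp [contractionVal, h]
  · simp [contractionVal]

/-- The contraction `ι_X` of `W(𝔤)`, for `X` the basis vector of `𝔤` dual to `i`: the derivation of
degree `-deg i` which sends the generator `i` of `𝔤*` to `1` and all other generators, in
particular all of `𝔤*[1]`, to `0`. -/
def contraction (g : LInfty) (i : g.ι) : FGC g.inn.deg →ₗ[ℝ] FGC g.inn.deg :=
  FGC.deriv (g.deg i) (g.contractionVal i) (g.isDerivData_contractionVal i)

theorem contraction_parity (g : LInfty) (i : g.ι) (x : FGC g.inn.deg) :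
    g.contraction i (FGC.parity g.inn.deg x) =
      (-1 : ℝ) ^ g.deg i • FGC.parity g.inn.deg (g.contraction i x) := by
  have hc : ∀ a : g.inn.ι, g.contractionVal i a = 0 ∨
      (g.contractionVal i a = 1 ∧ g.inn.deg a = g.deg i) := by
    rintro (j | j)
    · by_cases h : j = i
      · subst h; right; exact ⟨by simp [contractionVal], rfl⟩
      · left; simp [contractionVal, h]
    · left; rfl
  induction x using FGC.induction_mon with
  | hm l =>
    induction l with
    | nil => simp [contraction, FGC.deriv_one]
    | cons a l ih =>
      have hcomm : ∀ y, ((FGC.parity g.inn.deg) ^ g.deg i) (FGC.parity g.inn.deg y) =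
          FGC.parity g.inn.deg (((FGC.parity g.inn.deg) ^ g.deg i) y) := by
        intro y
        rw [← AlgHom.mul_apply, ← AlgHom.mul_apply, ← pow_succ, ← pow_succ']
      have h1 : ∀ x y, g.contraction i (x * y) = g.contraction i x * y +
          ((FGC.parity g.inn.deg) ^ g.deg i) x * g.contraction i y := FGC.deriv_mul _ _ _
      have h2 : g.contraction i (FGC.gen g.inn.deg a) = g.contractionVal i a :=
        FGC.deriv_gen _ _ _ _
      rw [FGC.mon_cons, map_mul, h1, h1, map_add, map_mul, map_mul, ih,
        hcomm, smul_add, FGC.parity_gen, map_smul, h2, mul_smul_comm]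
      congr 1
      rcases hc a with h | ⟨h, hd⟩
      · simp [h]
      · simp [h, hd]
  | ha x y h1 h2 => simp [h1, h2]
  | hs a x h => rw [map_smul, map_smul, map_smul, map_smul, h, smul_comm]

/-- The invariant polynomials `inv(𝔤) = W(𝔤)_basic`: the elements annihilated by all contractions
`ι_X` and all `ι_X ∘ d`, equivalently by all `ι_X` and all Lie derivatives `[d, ι_X]`. -/
def invSubalgebra (g : LInfty) : Subalgebra ℝ (FGC g.inn.deg) where
  carrier := {P | ∀ i, g.contraction i P = 0 ∧ g.contraction i (g.inn.d P) = 0}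
  mul_mem' := by
    intro P Q hP hQ i
    have h1 : ∀ x y, g.contraction i (x * y) = g.contraction i x * y +
        ((FGC.parity g.inn.deg) ^ g.deg i) x * g.contraction i y := FGC.deriv_mul _ _ _
    refine ⟨by rw [h1, (hP i).1, (hQ i).1]; simp, ?_⟩
    rw [g.inn.d_mul, map_add, h1, h1, contraction_parity, (hP i).1, (hP i).2, (hQ i).1, (hQ i).2]
    simp
  add_mem' := by
    intro P Q hP hQ i
    simp [(hP i).1, (hP i).2, (hQ i).1, (hQ i).2]
  algebraMap_mem' := by
    intro r i
    have : g.contraction i 1 = 0 := FGC.deriv_one _ _ _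
    rw [Algebra.algebraMap_eq_smul_one]
    simp [this, g.inn.d_one]

/-- `inv(𝔤)` as a differential graded-commutative algebra. -/
def inv (g : LInfty) : DGCA.{0} where
  carrier := g.invSubalgebra
  gr p := (FGC.gr g.inn.deg p).comap g.invSubalgebra.val.toLinearMap
  d := g.inn.d.restrict (p := Subalgebra.toSubmodule g.invSubalgebra)
    (q := Subalgebra.toSubmodule g.invSubalgebra)
    (by intro P hP i; exact ⟨(hP i).2, by rw [g.inn.d_d, map_zero]⟩)
  one_mem := FGC.one_mem
  mul_mem := fun hx hy => FGC.mul_mem hx hy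
  comm := fun hx hy => Subtype.ext (FGC.comm hx hy)
  d_mem := fun hx => g.inn.d_mem hx
  leibniz := fun hx y => Subtype.ext (g.inn.leibniz hx y)
  d_d x := Subtype.ext (g.inn.d_d x)

end LInfty

/-! ### Transgression and String-like extensions -/

/-- A cocycle `μ` of degree `n + 1` on `𝔤` (`n ≥ 1`) and an invariant polynomial `P` on `𝔤`,
together with a transgression element `cs` exhibiting that `μ` transgresses to `P`. -/
structure Transgression (g : LInfty) (n : ℕ) where
  μ : FGC g.deg
  μ_mem : μ ∈ FGC.gr g.deg (n + 1)
  d_μ : g.d μ = 0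
  P : FGC g.inn.deg
  P_inv : P ∈ g.invSubalgebra
  cs : FGC g.inn.deg
  cs_mem : cs ∈ FGC.gr g.inn.deg (n + 1)
  d_cs : g.inn.d cs = P
  toCE_cs : g.toCE cs = μ

namespace Transgression

variable {g : LInfty} {n : ℕ} (T : Transgression g n)

theorem d_P : g.inn.d T.P = 0 := by rw [← T.d_cs, g.inn.d_d]

theorem P_mem : T.P ∈ FGC.gr g.inn.deg (n + 1 + 1) := by
  rw [← T.d_cs]; exact g.inn.d_mem T.cs_mem

/-- The String-like extension `𝔤_μ`: one more generator `b = gen (inr ())`, of degree `n`, with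
`d b = -μ`. -/
def stringExt (hn : 0 < n) : LInfty :=
  g.addGen n hn (-T.μ) (Submodule.neg_mem _ T.μ_mem) (by rw [map_neg, T.d_μ, neg_zero])

/-- The Chern `L_∞`-algebra `ch_P(𝔤)`: to `W(𝔤)` one adds `c = gen (inr ())`, of degree `n + 1`,
with `d c = P`. -/
def ch : LInfty := g.inn.addGen (n + 1) n.succ_pos T.P T.P_mem T.d_P

/-- The inclusion `W(𝔤) → CE(ch_P(𝔤))`. -/
def inclCh : FGC g.inn.deg →ₐ[ℝ] FGC T.ch.deg := g.inn.incl _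

theorem inclCh_mem {p : ℕ} {x : FGC g.inn.deg} (hx : x ∈ FGC.gr g.inn.deg p) :
    T.inclCh x ∈ FGC.gr T.ch.deg p := FGC.map_mem _ (fun _ => rfl) hx

theorem csAlg_mem : T.ch.gen (Sum.inr ()) - T.inclCh T.cs ∈ FGC.gr T.ch.deg (n + 1) :=
  Submodule.sub_mem _ (FGC.gen_mem (deg := T.ch.deg) (Sum.inr ())) (T.inclCh_mem T.cs_mem)

theorem csAlg_closed : T.ch.d (T.ch.gen (Sum.inr ()) - T.inclCh T.cs) = 0 := by
  have h1 : T.ch.d (T.ch.gen (Sum.inr ())) = T.inclCh T.P := by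
    change FGC.deriv 1 _ _ (FGC.gen _ _) = _
    rw [FGC.deriv_gen]; rfl
  have h2 : T.ch.d (T.inclCh T.cs) = T.inclCh (g.inn.d T.cs) :=
    LInfty.deriv_incl _ _ _ _ (fun _ => rfl) _
  rw [map_sub, h1, h2, T.d_cs, sub_self]

/-- The Chern–Simons `L_∞`-algebra `cs_P(𝔤)`: to `CE(ch_P(𝔤))` one adds `b = gen (inr ())`, of
degree `n`, with `d b = c - cs`. -/
def csAlg (hn : 0 < n) : LInfty :=
  T.ch.addGen n hn (T.ch.gen (Sum.inr ()) - T.inclCh T.cs) T.csAlg_mem T.csAlg_closed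

end Transgression

namespace LInfty

theorem ofGen_d_gen {ι : Type} [Fintype ι] (deg : ι → ℕ) (hdeg : ∀ i, 0 < deg i)
    (v : ι → FGC deg) (hv : ∀ i, v i ∈ FGC.gr deg (deg i + 1))
    (h : ∀ i, FGC.deriv 1 v (FGC.isDerivData_of_mem hv) (v i) = 0) (i : ι) :
    (ofGen deg hdeg v hv h).d (FGC.gen deg i) = v i := FGC.deriv_gen _ _ _ _

variable (g : LInfty) (n : ℕ) (hn : 0 < n) (z : FGC g.deg) (hz : z ∈ FGC.gr g.deg (n + 1))
  (hdz : g.d z = 0)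

/-- The inclusion `CE(𝔤) → CE(𝔤')` for `𝔤'` obtained by adding a generator. -/
def addGenIncl : FGC g.deg →ₐ[ℝ] FGC (g.addGen n hn z hz hdz).deg := g.incl _

theorem addGenIncl_gen (i : g.ι) :
    g.addGenIncl n hn z hz hdz (g.gen i) = (g.addGen n hn z hz hdz).gen (Sum.inl i) :=
  FGC.map_gen _ (fun _ => rfl) _

theorem addGenIncl_mem {p : ℕ} {x : FGC g.deg} (hx : x ∈ FGC.gr g.deg p) :
    g.addGenIncl n hn z hz hdz x ∈ FGC.gr (g.addGen n hn z hz hdz).deg p :=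
  FGC.map_mem _ (fun _ => rfl) hx

theorem addGen_d_incl (x : FGC g.deg) :
    (g.addGen n hn z hz hdz).d (g.addGenIncl n hn z hz hdz x) =
      g.addGenIncl n hn z hz hdz (g.d x) :=
  deriv_incl _ _ _ _ (fun _ => rfl) _

theorem addGen_d_gen :
    (g.addGen n hn z hz hdz).d ((g.addGen n hn z hz hdz).gen (Sum.inr ())) =
      g.addGenIncl n hn z hz hdz z :=
  ofGen_d_gen _ _ _ _ _ _

theorem addGenIncl_adjoin (x : FGC g.deg) (S : Set (g.addGen n hn z hz hdz).ι)
    (hS : ∀ i, Sum.inl i ∈ S) :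
    g.addGenIncl n hn z hz hdz x ∈ Algebra.adjoin ℝ ((g.addGen n hn z hz hdz).gen '' S) := by
  induction x using FGC.induction_mon with
  | hm l =>
    induction l with
    | nil => simp
    | cons i l ih =>
      rw [FGC.mon_cons, map_mul]
      refine Subalgebra.mul_mem _ (Algebra.subset_adjoin ⟨Sum.inl i, hS i, ?_⟩) ih
      exact (g.addGenIncl_gen n hn z hz hdz i).symm
  | ha x y h1 h2 => rw [map_add]; exact Subalgebra.add_mem _ h1 h2
  | hs a x h => rw [map_smul]; exact Subalgebra.smul_mem _ h a

/-- The inclusion `CE(𝔤) → CE(𝔤')` as a morphism. -/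
def addGenHom : DGHom g.CE (g.addGen n hn z hz hdz).CE where
  toAlgHom := g.addGenIncl n hn z hz hdz
  map_gr _ _ hx := g.addGenIncl_mem n hn z hz hdz hx
  map_d x := (g.addGen_d_incl n hn z hz hdz x).symm

/-- The restriction `CE(𝔤') → CE(b^{n-1}𝔲(1))` which keeps the added generator and kills the
others. -/
def addGenRes : FGC (g.addGen n hn z hz hdz).deg →ₐ[ℝ] FGC (line n hn).deg :=
  FGC.lift (Sum.elim (fun _ => 0) (fun _ => (line n hn).gen ())) (by
    rintro (i | _) (j | _)
    · simp
    · simp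
    · simp
    · exact FGC.gen_comm () ())

theorem addGenRes_inl (i : g.ι) :
    g.addGenRes n hn z hz hdz ((g.addGen n hn z hz hdz).gen (Sum.inl i)) = 0 :=
  FGC.lift_gen _ _ _

theorem addGenRes_inr :
    g.addGenRes n hn z hz hdz ((g.addGen n hn z hz hdz).gen (Sum.inr ())) = (line n hn).gen () :=
  FGC.lift_gen _ _ _

theorem addGenRes_incl {p : ℕ} (hp : 0 < p) {x : FGC g.deg} (hx : x ∈ FGC.gr g.deg p) :
    g.addGenRes n hn z hz hdz (g.addGenIncl n hn z hz hdz x) = 0 := by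
  refine FGC.algHom_eq_zero ((g.addGenRes n hn z hz hdz).comp (g.addGenIncl n hn z hz hdz)) ?_
    hp hx
  intro i
  exact (congrArg _ (g.addGenIncl_gen n hn z hz hdz i)).trans (g.addGenRes_inl n hn z hz hdz i)

/-- The sub-`L_∞`-algebra `b^{n-1}𝔲(1)` dual to the added generator. -/
def addGenSub : NormalSub (line n hn) (g.addGen n hn z hz hdz) where
  s _ := Sum.inr ()
  inj _ _ _ := rfl
  deg_s _ := rfl
  res := g.addGenRes n hn z hz hdz
  res_s _ := g.addGenRes_inr n hn z hz hdz
  res_ker i hi := by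
    rcases i with i | _
    · exact g.addGenRes_inl n hn z hz hdz i
    · exact absurd ⟨(), rfl⟩ hi
  res_d i := by
    rcases i with i | _
    · have h1 := g.addGen_d_incl n hn z hz hdz (g.gen i)
      rw [addGenIncl_gen] at h1
      have h2 := g.addGenRes_incl n hn z hz hdz (Nat.succ_pos _) (g.d_mem (FGC.gen_mem i))
      refine (congrArg _ h1).trans (h2.trans ?_)
      exact ((congrArg _ (g.addGenRes_inl n hn z hz hdz i)).trans (map_zero _)).symm
    · have h1 := g.addGen_d_gen n hn z hz hdz
      have h2 : (line n hn).d ((line n hn).gen ()) = 0 := ofGen_d_gen _ _ _ _ _ _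
      refine (congrArg _ h1).trans ?_
      rw [addGenRes_incl _ _ _ _ _ _ (Nat.succ_pos _) hz]
      exact ((congrArg _ (g.addGenRes_inr n hn z hz hdz)).trans h2).symm
  normal i hi := by
    rcases i with i | _
    · have h1 := g.addGen_d_incl n hn z hz hdz (g.gen i)
      rw [addGenIncl_gen] at h1
      rw [h1]
      refine g.addGenIncl_adjoin n hn z hz hdz _ _ ?_
      rintro j ⟨_, hj⟩
      exact Sum.inr_ne_inl hj
    · exact absurd ⟨(), rfl⟩ hi

/-- The map `W(𝔤) → W(𝔤')` which is the inclusion on the generators. -/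
def addGenIncl_inn : FGC g.inn.deg →ₐ[ℝ] FGC (g.addGen n hn z hz hdz).inn.deg :=
  FGC.map (Sum.map Sum.inl Sum.inl) (by rintro (i | i) <;> rfl)

end LInfty

namespace LInfty

theorem toCE_inl (g : LInfty) (i : g.ι) : g.toCE (g.inn.gen (Sum.inl i)) = g.gen i :=
  FGC.lift_gen _ _ _

theorem toCE_inr (g : LInfty) (i : g.ι) : g.toCE (g.inn.gen (Sum.inr i)) = 0 :=
  FGC.lift_gen _ _ _

end LInfty

theorem NormalSub.hom_shift {h g : LInfty} (t : NormalSub h g) {B : Type*} [Ring B] [Algebra ℝ B]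
    (φ : FGC t.coneDeg →ₐ[ℝ] B) (hφ : ∀ x, φ (FGC.gen t.coneDeg (Sum.inr x)) = 0)
    (y : FGC t.coneDeg) : φ (t.shift y) = 0 := by
  induction y using FGC.induction_mon with
  | hm l =>
    induction l with
    | nil => simp [NormalSub.shift, FGC.deriv_one]
    | cons i l ih =>
      have h1 : ∀ x y, t.shift (x * y) = t.shift x * y + ((FGC.parity _) ^ 1) x * t.shift y :=
        FGC.deriv_mul _ _ _
      have h2 : φ (t.shift (FGC.gen t.coneDeg i)) = 0 := by
        rw [NormalSub.shift, FGC.deriv_gen]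
        rcases i with i | i
        · by_cases hi : i ∈ Set.range t.s
          · obtain ⟨x, rfl⟩ := hi
            rw [t.shiftVal_s, hφ]
          · rw [t.shiftVal_ker hi, map_zero]
        · exact map_zero _
      rw [FGC.mon_cons, h1, map_add, map_mul, map_mul, ih, h2, zero_mul, mul_zero, add_zero]
  | ha x y h1 h2 => rw [map_add, map_add, h1, h2, add_zero]
  | hs a x h => rw [map_smul, map_smul, h, smul_zero]

namespace LInfty

theorem hom_mem {g h : LInfty} (f : FGC g.deg →ₐ[ℝ] FGC h.deg)
    (hf : ∀ i, f (g.gen i) ∈ FGC.gr h.deg (g.deg i)) {p : ℕ} {x : FGC g.deg}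
    (hx : x ∈ FGC.gr g.deg p) : f x ∈ FGC.gr h.deg p := by
  induction hx using Submodule.span_induction with
  | mem x hx =>
    obtain ⟨l, rfl, rfl⟩ := hx
    induction l with
    | nil => simpa using FGC.one_mem
    | cons i l ih =>
      rw [FGC.mon_cons, map_mul, List.map_cons, List.sum_cons]
      exact FGC.mul_mem (hf i) ih
  | zero => simp
  | add y z _ _ h1 h2 => rw [map_add]; exact Submodule.add_mem _ h1 h2
  | smul a y _ h => rw [map_smul]; exact Submodule.smul_mem _ _ h

theorem hom_d {g h : LInfty} (f : FGC g.deg →ₐ[ℝ] FGC h.deg)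
    (hf : ∀ i, f (g.gen i) ∈ FGC.gr h.deg (g.deg i))
    (hd : ∀ i, f (g.d (g.gen i)) = h.d (f (g.gen i))) (x : FGC g.deg) :
    f (g.d x) = h.d (f x) := by
  have := FGC.deriv_ext f (f.toLinearMap ∘ₗ g.d) (h.d ∘ₗ f.toLinearMap) ?_ ?_ ?_ hd
  · exact DFunLike.congr_fun this x
  · intro i y
    simp [g.leibniz (FGC.gen_mem i)]
  · intro i y
    have := h.leibniz (hf i) (f y)
    simpa [LInfty.gen] using this
  · simp [d_one]

/-- A morphism of Chevalley–Eilenberg algebras is given on generators. -/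
def homOfGen {g h : LInfty} (f : FGC g.deg →ₐ[ℝ] FGC h.deg)
    (hf : ∀ i, f (g.gen i) ∈ FGC.gr h.deg (g.deg i))
    (hd : ∀ i, f (g.d (g.gen i)) = h.d (f (g.gen i))) : DGHom g.CE h.CE where
  toAlgHom := f
  map_gr _ _ hx := hom_mem f hf hx
  map_d x := hom_d f hf hd x

/-- The inclusion of algebras `∧•(𝔤*) → W(𝔤)`. -/
def inclW (g : LInfty) : FGC g.deg →ₐ[ℝ] FGC g.inn.deg := (NormalSub.refl g).incl

/-- The shift derivation `σ` of `W(𝔤)`. -/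
def shiftW (g : LInfty) : FGC g.inn.deg →ₗ[ℝ] FGC g.inn.deg := (NormalSub.refl g).shift

theorem inn_d_inl (g : LInfty) (i : g.ι) : g.inn.d (g.inn.gen (Sum.inl i)) =
    g.inclW (g.d (g.gen i)) + g.inn.gen (Sum.inr i) := by
  refine (ofGen_d_gen (NormalSub.refl g).coneDeg _ _ (NormalSub.refl g).coneVal_mem
    (NormalSub.refl g).coneD_coneVal _).trans ?_
  refine congrArg (fun y : FGC g.inn.deg => g.inclW (g.d (g.gen i)) + y) ?_
  rw [NormalSub.incl_gen, NormalSub.shift, FGC.deriv_gen]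
  exact (NormalSub.refl g).shiftVal_s i

theorem inn_d_inr (g : LInfty) (i : g.ι) : g.inn.d (g.inn.gen (Sum.inr i)) =
    -g.shiftW (g.inclW (g.d (g.gen i))) :=
  ofGen_d_gen (NormalSub.refl g).coneDeg _ _ (NormalSub.refl g).coneVal_mem
    (NormalSub.refl g).coneD_coneVal _

theorem toCE_inclW (g : LInfty) (x : FGC g.deg) : g.toCE (g.inclW x) = x := by
  refine DFunLike.congr_fun (FGC.algHom_ext
    (f := g.toCE.comp g.inclW) (g := AlgHom.id ℝ _) ?_) x
  intro i
  exact (congrArg _ ((NormalSub.refl g).incl_gen i)).trans (g.toCE_inl i)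

theorem toCE_shiftW (g : LInfty) (x : FGC g.inn.deg) : g.toCE (g.shiftW x) = 0 :=
  (NormalSub.refl g).hom_shift g.toCE g.toCE_inr x

/-- The projection `W(𝔤) → CE(𝔤)` as a morphism. -/
def toCEHom (g : LInfty) : DGHom g.W g.CE :=
  homOfGen g.toCE
    (by
      rintro (i | i)
      · have h : g.gen i ∈ FGC.gr g.deg (g.deg i) := FGC.gen_mem i
        rwa [← toCE_inl] at h
      · have h := Submodule.zero_mem (FGC.gr g.deg (g.deg i + 1))
        rwa [← g.toCE_inr i] at h)
    (by
      rintro (i | i)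
      · rw [inn_d_inl, map_add, toCE_inr, add_zero, toCE_inclW, toCE_inl]
      · rw [inn_d_inr, map_neg, toCE_shiftW, toCE_inr, map_zero, neg_zero])

/-- The inclusion `inv(𝔤) → W(𝔤)` as a morphism. -/
def invHom (g : LInfty) : DGHom g.inv g.W where
  toAlgHom := g.invSubalgebra.val
  map_gr _ _ hx := hx
  map_d _ := rfl

end LInfty

namespace Transgression

variable {g : LInfty} {n : ℕ} (T : Transgression g n) (hn : 0 < n)

/-- The inclusion `CE(𝔤) → CE(𝔤_μ)`. -/
def stringIncl : DGHom g.CE (T.stringExt hn).CE := g.addGenHom n hn _ _ _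

/-- The inclusion `W(𝔤) → W(𝔤_μ)`. -/
def stringInclW : FGC g.inn.deg →ₐ[ℝ] FGC (T.stringExt hn).inn.deg := g.addGenIncl_inn n hn _ _ _

/-- `b^{n-1}𝔲(1) ↪ 𝔤_μ`. -/
def stringSub : NormalSub (LInfty.line n hn) (T.stringExt hn) := g.addGenSub n hn _ _ _

/-- The inclusion `W(𝔤) → CE(cs_P(𝔤))`. -/
def csIncl : FGC g.inn.deg →ₐ[ℝ] FGC (T.csAlg hn).deg :=
  (T.ch.addGenIncl n hn _ _ _).comp T.inclCh

theorem csIncl_gen (i : g.inn.ι) :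
    T.csIncl hn (g.inn.gen i) = (T.csAlg hn).gen (Sum.inl (Sum.inl i)) := by
  have h1 : T.inclCh (g.inn.gen i) = T.ch.gen (Sum.inl i) := FGC.map_gen _ (fun _ => rfl) _
  exact (congrArg _ h1).trans (T.ch.addGenIncl_gen _ _ _ _ _ _)

theorem csIncl_mem {p : ℕ} {x : FGC g.inn.deg} (hx : x ∈ FGC.gr g.inn.deg p) :
    T.csIncl hn x ∈ FGC.gr (T.csAlg hn).deg p :=
  T.ch.addGenIncl_mem _ _ _ _ _ (T.inclCh_mem hx)

theorem csIncl_d (x : FGC g.inn.deg) :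
    (T.csAlg hn).d (T.csIncl hn x) = T.csIncl hn (g.inn.d x) := by
  have h1 : T.ch.d (T.inclCh x) = T.inclCh (g.inn.d x) := g.inn.addGen_d_incl _ _ _ _ _ x
  exact (T.ch.addGen_d_incl n hn _ _ _ (T.inclCh x)).trans (congrArg _ h1)

theorem csAlg_d_c : (T.csAlg hn).d ((T.csAlg hn).gen (Sum.inl (Sum.inr ()))) =
    T.csIncl hn T.P := by
  have h1 : T.ch.d (T.ch.gen (Sum.inr ())) = T.inclCh T.P := g.inn.addGen_d_gen _ _ _ _ _
  have h2 := T.ch.addGen_d_incl n hn _ (T.csAlg_mem) T.csAlg_closed (T.ch.gen (Sum.inr ()))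
  have h3 := T.ch.addGenIncl_gen n hn _ (T.csAlg_mem) T.csAlg_closed (Sum.inr ())
  exact (congrArg _ h3.symm).trans (h2.trans (congrArg _ h1))

theorem csAlg_d_b : (T.csAlg hn).d ((T.csAlg hn).gen (Sum.inr ())) =
    (T.csAlg hn).gen (Sum.inl (Sum.inr ())) - T.csIncl hn T.cs := by
  refine (T.ch.addGen_d_gen n hn _ T.csAlg_mem T.csAlg_closed).trans ?_
  have h3 := T.ch.addGenIncl_gen n hn _ (T.csAlg_mem) T.csAlg_closed (Sum.inr ())
  rw [map_sub]
  exact congrArg (fun y => y - T.csIncl hn T.cs) h3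

/-- The restriction `CE(cs_P(𝔤)) → W(b^{n-1}𝔲(1))`, with `b ↦ h`, `c ↦ σ h` and all generators
of `W(𝔤)` mapped to `0`. -/
def csRes : FGC (T.csAlg hn).deg →ₐ[ℝ] FGC (LInfty.line n hn).inn.deg :=
  FGC.lift (Sum.elim (Sum.elim (fun _ => 0) (fun _ => (LInfty.line n hn).inn.gen (Sum.inr ())))
    (fun _ => (LInfty.line n hn).inn.gen (Sum.inl ()))) (by
    have h0 : ∀ (r : ℝ) (x : FGC (LInfty.line n hn).inn.deg), 0 * x = r • (x * 0) := by simp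
    have h0' : ∀ (r : ℝ) (x : FGC (LInfty.line n hn).inn.deg), x * 0 = r • (0 * x) := by simp
    rintro ((i | _) | _) ((j | _) | _)
    · exact h0 _ _
    · exact h0 _ _
    · exact h0 _ _
    · exact h0' _ _
    · exact FGC.gen_comm (deg := (LInfty.line n hn).inn.deg) (Sum.inr ()) (Sum.inr ())
    · exact FGC.gen_comm (deg := (LInfty.line n hn).inn.deg) (Sum.inr ()) (Sum.inl ())
    · exact h0' _ _
    · exact FGC.gen_comm (deg := (LInfty.line n hn).inn.deg) (Sum.inl ()) (Sum.inr ())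
    · exact FGC.gen_comm (deg := (LInfty.line n hn).inn.deg) (Sum.inl ()) (Sum.inl ()))

theorem csRes_W (i : g.inn.ι) : T.csRes hn ((T.csAlg hn).gen (Sum.inl (Sum.inl i))) = 0 :=
  FGC.lift_gen _ _ _

theorem csRes_c : T.csRes hn ((T.csAlg hn).gen (Sum.inl (Sum.inr ()))) =
    (LInfty.line n hn).inn.gen (Sum.inr ()) := FGC.lift_gen _ _ _

theorem csRes_b : T.csRes hn ((T.csAlg hn).gen (Sum.inr ())) =
    (LInfty.line n hn).inn.gen (Sum.inl ()) := FGC.lift_gen _ _ _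

theorem csRes_incl {p : ℕ} (hp : 0 < p) {x : FGC g.inn.deg} (hx : x ∈ FGC.gr g.inn.deg p) :
    T.csRes hn (T.csIncl hn x) = 0 := by
  refine FGC.algHom_eq_zero ((T.csRes hn).comp (T.csIncl hn)) ?_ hp hx
  intro i
  exact (congrArg _ (T.csIncl_gen hn i)).trans (T.csRes_W hn i)

/-- `inn(b^{n-1}𝔲(1)) ↪ cs_P(𝔤)`. -/
def csSub : NormalSub (LInfty.line n hn).inn (T.csAlg hn) where
  s := Sum.elim (fun _ => Sum.inr ()) (fun _ => Sum.inl (Sum.inr ()))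
  inj := by
    rintro (_ | _) (_ | _) h
    · rfl
    · exact absurd h Sum.inr_ne_inl
    · exact absurd h Sum.inl_ne_inr
    · rfl
  deg_s := by rintro (_ | _) <;> rfl
  res := T.csRes hn
  res_s := by
    rintro (_ | _)
    · exact T.csRes_b hn
    · exact T.csRes_c hn
  res_ker := by
    rintro ((i | _) | _) hi
    · exact T.csRes_W hn i
    · exact absurd ⟨Sum.inr (), rfl⟩ hi
    · exact absurd ⟨Sum.inl (), rfl⟩ hi
  res_d := by
    have h0 : (LInfty.line n hn).d ((LInfty.line n hn).gen ()) = 0 :=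
      LInfty.ofGen_d_gen _ _ _ _ _ _
    rintro ((i | _) | _)
    · have h1 := T.csIncl_d hn (g.inn.gen i)
      rw [T.csIncl_gen] at h1
      have h2 := T.csRes_incl hn (Nat.succ_pos _) (g.inn.d_mem (FGC.gen_mem i))
      refine (congrArg _ h1).trans (h2.trans ?_)
      exact ((congrArg _ (T.csRes_W hn i)).trans (map_zero _)).symm
    · refine (congrArg _ (T.csAlg_d_c hn)).trans
        ((T.csRes_incl hn (Nat.succ_pos _) T.P_mem).trans ?_)
      have h3 := (LInfty.line n hn).inn_d_inr ()
      rw [h0, map_zero, map_zero, neg_zero] at h3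
      exact ((congrArg _ (T.csRes_c hn)).trans h3).symm
    · have h4 := T.csAlg_d_b hn
      have h3 := (LInfty.line n hn).inn_d_inl ()
      rw [h0, map_zero, zero_add] at h3
      refine (congrArg _ h4).trans ?_
      rw [map_sub, T.csRes_incl hn (Nat.succ_pos _) T.cs_mem, sub_zero]
      exact (T.csRes_c hn).trans ((congrArg _ (T.csRes_b hn)).trans h3).symm
  normal := by
    have key : ∀ x, T.csIncl hn x ∈ Algebra.adjoin ℝ ((T.csAlg hn).gen ''
        (Set.range (fun i : g.inn.ι => (Sum.inl (Sum.inl i) : (T.csAlg hn).ι)))) := by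
      intro x
      induction x using FGC.induction_mon with
      | hm l =>
        induction l with
        | nil => simp
        | cons i l ih =>
          rw [FGC.mon_cons, map_mul]
          refine Subalgebra.mul_mem _ (Algebra.subset_adjoin ⟨Sum.inl (Sum.inl i), ⟨i, rfl⟩, ?_⟩) ih
          exact (T.csIncl_gen hn i).symm
      | ha x y h1 h2 => rw [map_add]; exact Subalgebra.add_mem _ h1 h2
      | hs a x h => rw [map_smul]; exact Subalgebra.smul_mem _ h a
    rintro ((i | _) | _) hi
    · have h1 := T.csIncl_d hn (g.inn.gen i)
      rw [T.csIncl_gen] at h1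
      rw [h1]
      refine Algebra.adjoin_mono (Set.image_mono ?_) (key _)
      rintro _ ⟨i, rfl⟩ ⟨_ | _, h⟩
      · exact Sum.inr_ne_inl h
      · exact Sum.inr_ne_inl (Sum.inl_injective h)
    · exact absurd ⟨Sum.inr (), rfl⟩ hi
    · exact absurd ⟨Sum.inl (), rfl⟩ hi

end Transgression

/-! ### Differential forms on `ℝ^k` -/

/-- The Cartesian space `ℝ^k`. -/
abbrev R (k : ℕ) : Type := EuclideanSpace ℝ (Fin k)

/-- The algebra `C^∞(ℝ^k)`. -/
def smooth (k : ℕ) : Subalgebra ℝ (R k → ℝ) where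
  carrier := {f | ContDiff ℝ ∞ f}
  mul_mem' := fun {a b} (hf : ContDiff ℝ ∞ a) (hg : ContDiff ℝ ∞ b) => hf.mul hg
  add_mem' := fun {a b} (hf : ContDiff ℝ ∞ a) (hg : ContDiff ℝ ∞ b) => hf.add hg
  algebraMap_mem' r := (contDiff_const : ContDiff ℝ ∞ (fun _ : R k => r))

theorem contDiff_smooth {k : ℕ} (f : smooth k) : ContDiff ℝ ∞ f.1 := f.2

theorem differentiableAt_smooth {k : ℕ} (f : smooth k) (x : R k) : DifferentiableAt ℝ f.1 x :=
  ((contDiff_smooth f).differentiable (by simp)).differentiableAt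

/-- The partial derivative `∂_i`. -/
def pd {k : ℕ} (i : Fin k) : smooth k →ₗ[ℝ] smooth k where
  toFun f := ⟨fun x => fderiv ℝ f.1 x (EuclideanSpace.single i 1),
    ((contDiff_smooth f).fderiv_right (m := ∞) (by simp)).clm_apply contDiff_const⟩
  map_add' f g := by
    ext x
    have hf : DifferentiableAt ℝ f.1 x := differentiableAt_smooth f _
    have hg : DifferentiableAt ℝ g.1 x := differentiableAt_smooth g _
    simp [fderiv_add hf hg]
  map_smul' a f := by
    ext x
    have hf : DifferentiableAt ℝ f.1 x := differentiableAt_smooth f _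
    simp [fderiv_const_smul hf]

theorem pd_mul {k : ℕ} (i : Fin k) (f g : smooth k) : pd i (f * g) = pd i f * g + f * pd i g := by
  ext x
  have hf : DifferentiableAt ℝ f.1 x := differentiableAt_smooth f _
  have hg : DifferentiableAt ℝ g.1 x := differentiableAt_smooth g _
  simp [pd, fderiv_mul hf hg]
  ring

theorem pd_pd {k : ℕ} (i j : Fin k) (f : smooth k) : pd i (pd j f) = pd j (pd i f) := by
  ext x
  have h : IsSymmSndFDerivAt ℝ f.1 x := (contDiff_smooth f).contDiffAt.isSymmSndFDerivAt
    (by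
      have h2 : ((2 : ℕ∞) : WithTop ℕ∞) ≤ ((⊤ : ℕ∞) : WithTop ℕ∞) := WithTop.coe_le_coe.mpr le_top
      simpa using h2)
  have hd : DifferentiableAt ℝ (fderiv ℝ f.1) x :=
    (((contDiff_smooth f).fderiv_right (m := ∞) (by simp)).differentiable (by simp)).differentiableAt
  have key : ∀ i j : Fin k, (pd i (pd j f)).1 x =
      fderiv ℝ (fderiv ℝ f.1) x (EuclideanSpace.single i 1) (EuclideanSpace.single j 1) := by
    intro i j
    simp only [pd, LinearMap.coe_mk, AddHom.coe_mk]
    rw [fderiv_clm_apply hd (differentiableAt_const _)]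
    simp
  exact (key i j).trans ((h _ _).trans (key j i).symm)

/-- The constant forms `∧•(ℝ^k)*`, on the generators `dx^i` of degree `1`. -/
abbrev constForms (k : ℕ) : Type := FGC (fun _ : Fin k => 1)

/-- The algebra `Ω•(ℝ^k) = C^∞(ℝ^k) ⊗ ∧•(ℝ^k)*` of differential forms. -/
abbrev EForms (k : ℕ) : Type := smooth k ⊗[ℝ] constForms k

instance (k : ℕ) : AddCommGroup (smooth k) := inferInstance
instance (k : ℕ) : Module ℝ (smooth k) := inferInstance
instance (k : ℕ) : Ring (EForms k) := Algebra.TensorProduct.instRing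
instance (k : ℕ) : Algebra ℝ (EForms k) := Algebra.TensorProduct.leftAlgebra
instance (k : ℕ) : AddCommGroup (EForms k) := inferInstance
instance (k : ℕ) : Module ℝ (EForms k) := Algebra.toModule
instance (k : ℕ) : IsScalarTower ℝ (EForms k) (EForms k) := IsScalarTower.right
instance (k : ℕ) : SMulCommClass ℝ (EForms k) (EForms k) := Algebra.to_smulCommClass

namespace EForms

variable {k m : ℕ}

/-- The forms of degree `p`. -/
def gr (k p : ℕ) : Submodule ℝ (EForms k) :=
  Submodule.span ℝ {x | ∃ f, ∃ a ∈ FGC.gr (fun _ : Fin k => 1) p, x = f ⊗ₜ[ℝ] a}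

/-- The differential `dx^i ∧ -`. -/
def d (k : ℕ) : EForms k →ₗ[ℝ] EForms k :=
  ∑ i : Fin k, TensorProduct.map (pd i) (LinearMap.mulLeft ℝ (FGC.gen (fun _ : Fin k => 1) i))

theorem d_tmul (f : smooth k) (a : constForms k) :
    d k (f ⊗ₜ a) = ∑ i : Fin k, (pd i f) ⊗ₜ (FGC.gen (fun _ : Fin k => 1) i * a) := by
  simp [d, LinearMap.sum_apply]

theorem one_mem : (1 : EForms k) ∈ gr k 0 :=
  Submodule.subset_span ⟨1, 1, FGC.one_mem, rfl⟩

theorem mul_mem {p q : ℕ} {x y : EForms k} (hx : x ∈ gr k p) (hy : y ∈ gr k q) :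
    x * y ∈ gr k (p + q) := by
  induction hx using Submodule.span_induction with
  | mem x hx =>
    obtain ⟨f, a, ha, rfl⟩ := hx
    induction hy using Submodule.span_induction with
    | mem y hy =>
      obtain ⟨g, b, hb, rfl⟩ := hy
      rw [Algebra.TensorProduct.tmul_mul_tmul]
      exact Submodule.subset_span ⟨_, _, FGC.mul_mem ha hb, rfl⟩
    | zero => simp
    | add y z _ _ h1 h2 => rw [mul_add]; exact Submodule.add_mem _ h1 h2
    | smul a y _ h => rw [mul_smul_comm]; exact Submodule.smul_mem _ _ h
  | zero => simp
  | add y z _ _ h1 h2 => rw [add_mul]; exact Submodule.add_mem _ h1 h2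
  | smul a y _ h => rw [smul_mul_assoc]; exact Submodule.smul_mem _ _ h

theorem comm {p q : ℕ} {x y : EForms k} (hx : x ∈ gr k p) (hy : y ∈ gr k q) :
    x * y = (-1 : ℝ) ^ (p * q) • (y * x) := by
  induction hx using Submodule.span_induction with
  | mem x hx =>
    obtain ⟨f, a, ha, rfl⟩ := hx
    induction hy using Submodule.span_induction with
    | mem y hy =>
      obtain ⟨g, b, hb, rfl⟩ := hy
      rw [Algebra.TensorProduct.tmul_mul_tmul, Algebra.TensorProduct.tmul_mul_tmul,
        FGC.comm ha hb, mul_comm f g, TensorProduct.tmul_smul]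
    | zero => simp
    | add y z _ _ h1 h2 => rw [mul_add, add_mul, smul_add, h1, h2]
    | smul a y _ h => rw [mul_smul_comm, smul_mul_assoc, h, smul_comm]
  | zero => simp
  | add y z _ _ h1 h2 => rw [mul_add, add_mul, smul_add, h1, h2]
  | smul a y _ h => rw [mul_smul_comm, smul_mul_assoc, h, smul_comm]

theorem d_mem {p : ℕ} {x : EForms k} (hx : x ∈ gr k p) : d k x ∈ gr k (p + 1) := by
  induction hx using Submodule.span_induction with
  | mem x hx =>
    obtain ⟨f, a, ha, rfl⟩ := hx
    rw [d_tmul]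
    refine Submodule.sum_mem _ fun i _ => Submodule.subset_span ⟨_, _, ?_, rfl⟩
    rw [add_comm]
    exact FGC.mul_mem (FGC.gen_mem (deg := fun _ : Fin k => 1) i) ha
  | zero => simp
  | add y z _ _ h1 h2 => rw [map_add]; exact Submodule.add_mem _ h1 h2
  | smul a y _ h => rw [map_smul]; exact Submodule.smul_mem _ _ h

theorem leibniz {p : ℕ} {x : EForms k} (hx : x ∈ gr k p) (y : EForms k) :
    d k (x * y) = d k x * y + (-1 : ℝ) ^ p • (x * d k y) := by
  induction hx using Submodule.span_induction with
  | mem x hx =>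
    obtain ⟨f, a, ha, rfl⟩ := hx
    induction y using TensorProduct.induction_on with
    | zero => simp
    | add y z h1 h2 => rw [mul_add, map_add, map_add, mul_add, mul_add, h1, h2, smul_add]; abel
    | tmul g b =>
      rw [Algebra.TensorProduct.tmul_mul_tmul, d_tmul, d_tmul, d_tmul, Finset.sum_mul,
        Finset.mul_sum, Finset.smul_sum, ← Finset.sum_add_distrib]
      refine Finset.sum_congr rfl fun i _ => ?_
      have h : FGC.gen (fun _ : Fin k => 1) i * a = (-1 : ℝ) ^ (1 * p) •
          (a * FGC.gen (fun _ : Fin k => 1) i) := FGC.comm (FGC.gen_mem i) ha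
      rw [Algebra.TensorProduct.tmul_mul_tmul, Algebra.TensorProduct.tmul_mul_tmul, pd_mul,
        TensorProduct.add_tmul, ← mul_assoc, ← mul_assoc, h, smul_mul_assoc, one_mul,
        TensorProduct.tmul_smul, TensorProduct.tmul_smul]
  | zero => simp
  | add x z _ _ h1 h2 => simp only [add_mul, map_add, smul_add, h1, h2]; abel
  | smul a x _ h => simp only [smul_mul_assoc, map_smul, h, smul_add, smul_comm a]

theorem d_d (x : EForms k) : d k (d k x) = 0 := by
  induction x using TensorProduct.induction_on with
  | zero => simp
  | add y z h1 h2 => rw [map_add, map_add, h1, h2, add_zero]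
  | tmul f a =>
    rw [d_tmul, map_sum]
    simp only [d_tmul]
    set S := ∑ i : Fin k, ∑ j : Fin k, (pd j (pd i f)) ⊗ₜ[ℝ]
      (FGC.gen (fun _ : Fin k => 1) j * (FGC.gen (fun _ : Fin k => 1) i * a)) with hS
    have h : S = -S := by
      conv_lhs => rw [hS, Finset.sum_comm]
      rw [hS, ← Finset.sum_neg_distrib]
      refine Finset.sum_congr rfl fun i _ => ?_
      rw [← Finset.sum_neg_distrib]
      refine Finset.sum_congr rfl fun j _ => ?_
      rw [pd_pd, ← mul_assoc, FGC.gen_comm, ← mul_assoc, ← TensorProduct.tmul_neg]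
      simp
    have h2 : (2 : ℝ) • S = 0 := by
      rw [two_smul]
      nth_rewrite 1 [h]
      simp
    exact (smul_eq_zero.mp h2).resolve_left two_ne_zero

/-- A smooth function as a form. -/
def fn (k : ℕ) : smooth k →ₐ[ℝ] EForms k := Algebra.TensorProduct.includeLeft

theorem fn_mem (f : smooth k) : fn k f ∈ gr k 0 :=
  Submodule.subset_span ⟨f, 1, FGC.one_mem, rfl⟩

theorem fn_comm (f : smooth k) (x : EForms k) : fn k f * x = x * fn k f := by
  induction x using TensorProduct.induction_on with
  | zero => simp
  | add y z h1 h2 => rw [mul_add, add_mul, h1, h2]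
  | tmul g a => simp [fn, Algebra.TensorProduct.tmul_mul_tmul, mul_comm]

/-- Smooth maps `ℝ^k → ℝ^m`. -/
def SMap (k m : ℕ) : Type := {φ : R k → R m // ContDiff ℝ ∞ φ}

/-- Composition of functions with a smooth map. -/
def pullFn (φ : SMap k m) : smooth m →ₐ[ℝ] smooth k where
  toFun f := ⟨f.1 ∘ φ.1, (contDiff_smooth f).comp φ.2⟩
  map_one' := rfl
  map_mul' _ _ := rfl
  map_zero' := rfl
  map_add' _ _ := rfl
  commutes' _ := rfl

/-- The components of a smooth map. -/
def coord (φ : SMap k m) (j : Fin m) : smooth k :=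
  ⟨fun x => φ.1 x j, (contDiff_piLp_apply (p := 2)).comp φ.2⟩

/-- The pullback of differential forms: `f ↦ f ∘ φ` on functions and `dx^j ↦ dφ^j`. -/
def pull (φ : SMap k m) : EForms m →ₐ[ℝ] EForms k :=
  Algebra.TensorProduct.lift ((fn k).comp (pullFn φ))
    (FGC.lift (fun j => d k (fn k (coord φ j)))
      (fun i j => comm (d_mem (fn_mem (coord φ i))) (d_mem (fn_mem (coord φ j)))))
    (fun _ _ => show Commute _ _ from fn_comm _ _)

theorem pull_fn (φ : SMap k m) (f : smooth m) : pull φ (fn m f) = fn k (pullFn φ f) := by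
  simp [pull, fn]

theorem pull_dx (φ : SMap k m) (j : Fin m) :
    pull φ (1 ⊗ₜ FGC.gen (fun _ : Fin m => 1) j) = d k (fn k (coord φ j)) := by
  refine (Algebra.TensorProduct.lift_tmul _ _ _ _ _).trans ?_
  rw [map_one, one_mul, FGC.lift_gen]

theorem tmul_eq (f : smooth k) (a : constForms k) : f ⊗ₜ a = fn k f * (1 ⊗ₜ[ℝ] a) := by
  simp [fn, Algebra.TensorProduct.tmul_mul_tmul]

theorem pull_const_mem (φ : SMap k m) {p : ℕ} {a : constForms m}
    (ha : a ∈ FGC.gr (fun _ : Fin m => 1) p) : pull φ (1 ⊗ₜ a) ∈ gr k p := by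
  induction ha using Submodule.span_induction with
  | mem x hx =>
    obtain ⟨l, rfl, rfl⟩ := hx
    induction l with
    | nil =>
      rw [FGC.mon_nil, ← Algebra.TensorProduct.one_def, map_one]
      exact one_mem
    | cons i l ih =>
      have h : (1 : smooth m) ⊗ₜ[ℝ] FGC.mon (fun _ : Fin m => 1) (i :: l) =
          (1 ⊗ₜ FGC.gen (fun _ : Fin m => 1) i) * (1 ⊗ₜ FGC.mon (fun _ : Fin m => 1) l) := by
        simp [Algebra.TensorProduct.tmul_mul_tmul]
      rw [h, map_mul, pull_dx, List.map_cons, List.sum_cons]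
      exact mul_mem (by simpa using d_mem (fn_mem (coord φ i))) ih
  | zero => simp
  | add y z _ _ h1 h2 => rw [TensorProduct.tmul_add, map_add]; exact Submodule.add_mem _ h1 h2
  | smul a y _ h => rw [TensorProduct.tmul_smul, map_smul]; exact Submodule.smul_mem _ _ h

theorem pull_mem (φ : SMap k m) {p : ℕ} {x : EForms m} (hx : x ∈ gr m p) :
    pull φ x ∈ gr k p := by
  induction hx using Submodule.span_induction with
  | mem x hx =>
    obtain ⟨f, a, ha, rfl⟩ := hx
    rw [tmul_eq, map_mul, pull_fn, ← zero_add p]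
    exact mul_mem (fn_mem _) (pull_const_mem φ ha)
  | zero => simp
  | add y z _ _ h1 h2 => rw [map_add]; exact Submodule.add_mem _ h1 h2
  | smul a y _ h => rw [map_smul]; exact Submodule.smul_mem _ _ h

theorem pd_pullFn (φ : SMap k m) (f : smooth m) (i : Fin k) :
    pd i (pullFn φ f) = ∑ j : Fin m, pullFn φ (pd j f) * pd i (coord φ j) := by
  ext x
  have hφ : DifferentiableAt ℝ φ.1 x := (φ.2.differentiable (by simp)).differentiableAt
  have hf : DifferentiableAt ℝ f.1 (φ.1 x) := differentiableAt_smooth f _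
  have h1 : (pd i (pullFn φ f)).1 x =
      fderiv ℝ f.1 (φ.1 x) (fderiv ℝ φ.1 x (EuclideanSpace.single i 1)) := by
    have h0 : fderiv ℝ (f.1 ∘ φ.1) x = (fderiv ℝ f.1 (φ.1 x)).comp (fderiv ℝ φ.1 x) :=
      fderiv_comp x hf hφ
    exact congrArg (fun L => L (EuclideanSpace.single i 1)) h0
  have h2 : ∀ j, (pd i (coord φ j)).1 x = (fderiv ℝ φ.1 x (EuclideanSpace.single i 1)) j := by
    intro j
    have : HasFDerivAt (fun y => φ.1 y j)
        ((EuclideanSpace.proj j : R m →L[ℝ] ℝ).comp (fderiv ℝ φ.1 x)) x :=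
      (EuclideanSpace.proj j : R m →L[ℝ] ℝ).hasFDerivAt.comp x hφ.hasFDerivAt
    simp only [pd, coord, LinearMap.coe_mk, AddHom.coe_mk]
    rw [this.fderiv]
    rfl
  set v := fderiv ℝ φ.1 x (EuclideanSpace.single i 1) with hv
  have h3 : v = ∑ j : Fin m, v j • EuclideanSpace.single j (1 : ℝ) := by
    ext j
    simp [Finset.sum_apply, Pi.single_apply]
  have h4 : (∑ j : Fin m, pullFn φ (pd j f) * pd i (coord φ j)).1 x =
      ∑ j : Fin m, (fderiv ℝ f.1 (φ.1 x) (EuclideanSpace.single j 1)) * v j := by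
    rw [AddSubmonoidClass.coe_finsetSum, Finset.sum_apply]
    refine Finset.sum_congr rfl fun j _ => ?_
    exact congrArg _ (h2 j)
  refine h1.trans (Eq.trans ?_ h4.symm)
  conv_lhs => rw [h3, map_sum]
  refine Finset.sum_congr rfl fun j _ => ?_
  rw [map_smul, smul_eq_mul, mul_comm]

theorem d_fn (f : smooth k) :
    d k (fn k f) = ∑ i : Fin k, (pd i f) ⊗ₜ FGC.gen (fun _ : Fin k => 1) i := by
  simp [fn, d_tmul]

theorem pull_d_fn (φ : SMap k m) (f : smooth m) :
    pull φ (d m (fn m f)) = d k (pull φ (fn m f)) := by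
  rw [pull_fn, d_fn, d_fn, map_sum]
  have h1 : ∀ j : Fin m, pull φ ((pd j f) ⊗ₜ FGC.gen (fun _ : Fin m => 1) j) =
      ∑ i : Fin k, (pullFn φ (pd j f) * pd i (coord φ j)) ⊗ₜ[ℝ] FGC.gen (fun _ : Fin k => 1) i := by
    intro j
    rw [tmul_eq, map_mul, pull_fn, pull_dx, d_fn, Finset.mul_sum]
    refine Finset.sum_congr rfl fun i _ => ?_
    simp [fn, Algebra.TensorProduct.tmul_mul_tmul]
  simp only [h1, pd_pullFn, TensorProduct.sum_tmul]
  exact Finset.sum_comm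

theorem d_const (a : constForms k) : d k (1 ⊗ₜ a) = 0 := by
  rw [d_tmul]
  refine Finset.sum_eq_zero fun i _ => ?_
  have : pd i (1 : smooth k) = 0 := by
    have := pd_mul i (1 : smooth k) 1
    simpa using this
  rw [this, TensorProduct.zero_tmul]

theorem d_pull_const (φ : SMap k m) (a : constForms m) : d k (pull φ (1 ⊗ₜ a)) = 0 := by
  induction a using FGC.induction_mon with
  | hm l =>
    induction l with
    | nil =>
      rw [FGC.mon_nil, ← Algebra.TensorProduct.one_def, map_one]
      exact d_const 1
    | cons i l ih =>
      have h : (1 : smooth m) ⊗ₜ[ℝ] FGC.mon (fun _ : Fin m => 1) (i :: l) =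
          (1 ⊗ₜ FGC.gen (fun _ : Fin m => 1) i) * (1 ⊗ₜ FGC.mon (fun _ : Fin m => 1) l) := by
        simp [Algebra.TensorProduct.tmul_mul_tmul]
      rw [h, map_mul, pull_dx, leibniz (d_mem (fn_mem (coord φ i))), ih, d_d, zero_mul, mul_zero,
        smul_zero, add_zero]
  | ha x y h1 h2 => rw [TensorProduct.tmul_add, map_add, map_add, h1, h2, add_zero]
  | hs a x h => rw [TensorProduct.tmul_smul, map_smul, map_smul, h, smul_zero]

theorem pull_d (φ : SMap k m) (x : EForms m) : pull φ (d m x) = d k (pull φ x) := by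
  induction x using TensorProduct.induction_on with
  | zero => simp
  | add y z h1 h2 => rw [map_add, map_add, h1, h2, map_add, map_add]
  | tmul f a =>
    have h := fn_mem (pullFn φ f)
    rw [tmul_eq, leibniz (fn_mem f), d_const, map_mul, pull_fn, leibniz h, d_pull_const,
      mul_zero, smul_zero, add_zero, mul_zero, smul_zero, add_zero, map_mul, pull_d_fn, pull_fn]

end EForms

/-! ### Subalgebras and images -/

namespace DGCA

/-- A subalgebra closed under the differential, with the induced grading. -/
def sub (A : DGCA.{u}) (B : Subalgebra ℝ A.carrier) (hB : ∀ x ∈ B, A.d x ∈ B) : DGCA.{u} where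
  carrier := B
  gr p := (A.gr p).comap B.val.toLinearMap
  d := A.d.restrict (p := Subalgebra.toSubmodule B) (q := Subalgebra.toSubmodule B) hB
  one_mem := A.one_mem
  mul_mem := fun hx hy => A.mul_mem hx hy
  comm := fun hx hy => Subtype.ext (A.comm hx hy)
  d_mem := fun hx => A.d_mem hx
  leibniz := fun hx y => Subtype.ext (A.leibniz hx y)
  d_d x := Subtype.ext (A.d_d x)

/-- The image of a morphism, the elements of degree `p` being the images of elements of
degree `p`. -/
def image {A : DGCA.{u}} {B : DGCA.{v}} (f : DGHom A B) : DGCA.{v} where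
  carrier := f.toAlgHom.range
  gr p := (A.gr p).map f.toAlgHom.rangeRestrict.toLinearMap
  d := B.d.restrict (p := Subalgebra.toSubmodule f.toAlgHom.range)
    (q := Subalgebra.toSubmodule f.toAlgHom.range)
    (by rintro _ ⟨x, rfl⟩; exact ⟨A.d x, f.map_d x⟩)
  one_mem := ⟨1, A.one_mem, map_one f.toAlgHom.rangeRestrict⟩
  mul_mem := by
    rintro p q _ _ ⟨x, hx, rfl⟩ ⟨y, hy, rfl⟩
    exact ⟨x * y, A.mul_mem hx hy, map_mul f.toAlgHom.rangeRestrict x y⟩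
  comm := by
    rintro p q _ _ ⟨x, hx, rfl⟩ ⟨y, hy, rfl⟩
    exact Subtype.ext (B.comm (f.map_gr p x hx) (f.map_gr q y hy))
  d_mem := by
    rintro p _ ⟨x, hx, rfl⟩
    exact ⟨A.d x, A.d_mem hx, Subtype.ext (f.map_d x)⟩
  leibniz := by
    rintro p _ ⟨x, hx, rfl⟩ y
    exact Subtype.ext (B.leibniz (f.map_gr p x hx) y.1)
  d_d x := Subtype.ext (B.d_d x)

/-- The surjection onto the image. -/
def toImage {A : DGCA.{u}} {B : DGCA.{v}} (f : DGHom A B) : DGHom A (image f) where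
  toAlgHom := f.toAlgHom.rangeRestrict
  map_gr _ x hx := ⟨x, hx, rfl⟩
  map_d x := Subtype.ext (f.map_d x)

/-- Families of differential forms on Cartesian spaces. -/
def families {S : Type u} (κ : S → ℕ) : DGCA.{u} where
  carrier := ∀ s, EForms (κ s)
  gr p := Submodule.pi Set.univ (fun s => EForms.gr (κ s) p)
  d := LinearMap.pi (fun s => EForms.d (κ s) ∘ₗ LinearMap.proj s)
  one_mem := fun _ _ => EForms.one_mem
  mul_mem := fun hx hy s hs => EForms.mul_mem (hx s hs) (hy s hs)
  comm := fun hx hy => funext fun s => EForms.comm (hx s trivial) (hy s trivial)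
  d_mem := fun hx s hs => EForms.d_mem (hx s hs)
  leibniz := fun hx y => funext fun s => EForms.leibniz (hx s trivial) (y s)
  d_d x := funext fun s => EForms.d_d (x s)

end DGCA

/-! ### Differential forms on manifolds -/

section Forms

variable {E : Type*} [NormedAddCommGroup E] [NormedSpace ℝ E] {H : Type*} [TopologicalSpace H]
  (I : ModelWithCorners ℝ E H)
  (Y : Type u) [TopologicalSpace Y] [ChartedSpace H Y]

/-- The plots of `Y`: smooth maps `ℝ^k → Y`, for all `k`. -/
structure Plot where
  dim : ℕ
  map : R dim → Y
  smooth : ContMDiff 𝓘(ℝ, R dim) I ∞ map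

variable {I Y}

/-- Precomposition of a plot with a smooth map of Cartesian spaces. -/
def Plot.comp (s : Plot I Y) {m : ℕ} (ψ : EForms.SMap m s.dim) : Plot I Y where
  dim := m
  map := s.map ∘ ψ.1
  smooth := s.smooth.comp ψ.2.contMDiff

variable (I Y)

/-- The de Rham algebra `Ω•(Y)`: a differential form on `Y` is a family of differential forms, one
on the domain of each plot, which is compatible with pullback along smooth maps of the domains.
For a manifold this is the same as a differential form given in charts. -/
def Omega : DGCA.{u} :=
  (DGCA.families (fun s : Plot I Y => s.dim)).sub
    { carrier := {θ | ∀ (s : Plot I Y) (m : ℕ) (ψ : EForms.SMap m s.dim),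
        θ (s.comp ψ) = EForms.pull ψ (θ s)}
      mul_mem' := fun ha hb s m ψ =>
        (congrArg₂ (fun x y : EForms m => x * y) (ha s m ψ) (hb s m ψ)).trans
          (map_mul (EForms.pull ψ) _ _).symm
      add_mem' := fun ha hb s m ψ =>
        (congrArg₂ (fun x y : EForms m => x + y) (ha s m ψ) (hb s m ψ)).trans
          (map_add (EForms.pull ψ) _ _).symm
      algebraMap_mem' := fun r _ _ ψ => ((EForms.pull ψ).commutes r).symm }
    (fun θ hθ s m ψ => (congrArg (EForms.d m) (hθ s m ψ)).trans (EForms.pull_d ψ (θ s)).symm)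

variable {I Y}

variable {E' : Type*} [NormedAddCommGroup E'] [NormedSpace ℝ E'] {H' : Type*} [TopologicalSpace H']
  {J : ModelWithCorners ℝ E' H'} {X : Type v} [TopologicalSpace X] [ChartedSpace H' X]

/-- Postcomposition of a plot with a smooth map of manifolds. -/
def Plot.push (π : Y → X) (hπ : ContMDiff I J ∞ π) (s : Plot I Y) : Plot J X where
  dim := s.dim
  map := π ∘ s.map
  smooth := hπ.comp s.smooth

/-- The pullback `π* : Ω•(X) → Ω•(Y)`. -/
def pullback (π : Y → X) (hπ : ContMDiff I J ∞ π) : DGHom (Omega J X) (Omega I Y) where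
  toFun θ := ⟨fun s => θ.1 (s.push π hπ), fun s m ψ => θ.2 (s.push π hπ) m ψ⟩
  map_one' := rfl
  map_mul' _ _ := rfl
  map_zero' := rfl
  map_add' _ _ := rfl
  commutes' _ := rfl
  map_gr _ _ hθ := fun s _ => hθ (s.push π hπ) trivial
  map_d _ := rfl

variable (I)

/-- The vertical plots: those with image in a single fibre of `π`. -/
def VPlot (π : Y → X) : Type u := {s : Plot I Y // ∀ x y, π (s.map x) = π (s.map y)}

/-- The restriction of differential forms to vertical plots. -/
def restrictVert (π : Y → X) :
    DGHom (Omega I Y) (DGCA.families (fun s : VPlot I π => s.1.dim)) where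
  toFun θ := fun s => θ.1 s.1
  map_one' := rfl
  map_mul' _ _ := rfl
  map_zero' := rfl
  map_add' _ _ := rfl
  commutes' _ := rfl
  map_gr _ _ hθ := fun s _ => hθ s.1 trivial
  map_d _ := rfl

/-- The vertical forms `Ω•_vert(Y)` of a surjective submersion `π : Y → X`: the quotient of `Ω•(Y)`
by the forms which vanish on vertical vectors. As the vertical vectors are the tangent vectors to
the fibres, this is the image of `Ω•(Y)` under restriction to the plots of the fibres. -/
def OmegaVert (π : Y → X) : DGCA.{u} := DGCA.image (restrictVert I π)

/-- The projection `Ω•(Y) → Ω•_vert(Y)`. -/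
def toVert (π : Y → X) : DGHom (Omega I Y) (OmegaVert I π) := DGCA.toImage (restrictVert I π)

end Forms

/-! ### Forms on the interval, concordance and homotopy -/

/-- The algebra `C^∞([0,1])`. -/
def smoothI : Subalgebra ℝ (Set.Icc (0 : ℝ) 1 → ℝ) where
  carrier := {f | ∃ F : ℝ → ℝ, ContDiff ℝ ∞ F ∧ ∀ t, f t = F t}
  mul_mem' := by
    rintro f g ⟨F, hF, h1⟩ ⟨G, hG, h2⟩
    exact ⟨fun t => F t * G t, hF.mul hG, fun t => congrArg₂ (· * ·) (h1 t) (h2 t)⟩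
  add_mem' := by
    rintro f g ⟨F, hF, h1⟩ ⟨G, hG, h2⟩
    exact ⟨fun t => F t + G t, hF.add hG, fun t => congrArg₂ (· + ·) (h1 t) (h2 t)⟩
  algebraMap_mem' r := ⟨fun _ => r, contDiff_const, fun _ => rfl⟩

theorem derivWithin_smoothI {f : Set.Icc (0 : ℝ) 1 → ℝ} {F : ℝ → ℝ} (hF : ContDiff ℝ ∞ F)
    (h : ∀ t, f t = F t) (t : Set.Icc (0 : ℝ) 1) :
    derivWithin (Set.IccExtend zero_le_one f) (Set.Icc 0 1) t = deriv F t := by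
  have h1 : Set.EqOn (Set.IccExtend zero_le_one f) F (Set.Icc 0 1) := by
    intro s hs
    rw [Set.IccExtend_of_mem _ _ hs, h]
  rw [derivWithin_congr h1 (h1 t.2)]
  exact ((hF.differentiable (by simp)) t).derivWithin ((uniqueDiffOn_Icc zero_lt_one) t t.2)

/-- The derivative of smooth functions on `[0,1]`. -/
def dI : smoothI →ₗ[ℝ] smoothI where
  toFun f := ⟨fun t => derivWithin (Set.IccExtend zero_le_one f.1) (Set.Icc 0 1) t, by
    obtain ⟨f, F, hF, h⟩ := f
    refine ⟨deriv F, ?_, derivWithin_smoothI hF h⟩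
    exact ((contDiff_infty_iff_deriv).mp hF).2⟩
  map_add' := by
    rintro ⟨f, F, hF, h1⟩ ⟨g, G, hG, h2⟩
    ext t
    have h3 := derivWithin_smoothI (f := f + g) (hF.add hG)
      (fun t => congrArg₂ (· + ·) (h1 t) (h2 t)) t
    have h4 := derivWithin_smoothI hF h1 t
    have h5 := derivWithin_smoothI hG h2 t
    have h6 := deriv_add ((hF.differentiable (by simp)) t) ((hG.differentiable (by simp)) t)
    exact h3.trans (h6.trans (congrArg₂ (· + ·) h4.symm h5.symm))
  map_smul' := by
    rintro a ⟨f, F, hF, h1⟩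
    ext t
    have h3 := derivWithin_smoothI (f := a • f) (F := fun t => a * F t) (contDiff_const.mul hF)
      (fun t => congrArg (a * ·) (h1 t)) t
    have h4 := derivWithin_smoothI hF h1 t
    have h6 := deriv_const_mul a ((hF.differentiable (by simp)) t)
    exact h3.trans (h6.trans (congrArg (a * ·) h4.symm))

/-- The evaluation of smooth functions on `[0,1]` at a point. -/
def evI (t : Set.Icc (0 : ℝ) 1) : smoothI →ₐ[ℝ] ℝ := (Pi.evalAlgHom ℝ _ t).comp smoothI.val

/-- The restriction `B ⊗ C^∞([0,1]) → B` to a point of the interval. -/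
def restrictI (B : DGCA.{v}) (t : Set.Icc (0 : ℝ) 1) : B.carrier ⊗[ℝ] smoothI →ₐ[ℝ] B.carrier :=
  Algebra.TensorProduct.lift (AlgHom.id ℝ B.carrier) ((Algebra.ofId ℝ B.carrier).comp (evI t))
    (fun x f => (Algebra.commutes (evI t f) x).symm)

/-- The elements of degree `p` of `B ⊗ C^∞([0,1])`. -/
def grI (B : DGCA.{v}) (p : ℕ) : Submodule ℝ (B.carrier ⊗[ℝ] smoothI) :=
  Submodule.span ℝ {x | ∃ b ∈ B.gr p, ∃ f, x = b ⊗ₜ[ℝ] f}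

/-- A concordance between morphisms `φ, ψ : A → B`: a morphism `η : A → B ⊗ Ω•([0,1])` which
restricts to `φ` at `0` and to `ψ` at `1`. It is written in components as `η = α + dt ∧ ρ` with
values of `α` and `ρ` in `B ⊗ C^∞([0,1])`; the conditions below say that `η` preserves degrees,
products and differentials. -/
structure Concordance {A : DGCA.{u}} {B : DGCA.{v}} (φ ψ : DGHom A B) where
  α : A.carrier →ₐ[ℝ] B.carrier ⊗[ℝ] smoothI
  ρ : A.carrier →ₗ[ℝ] B.carrier ⊗[ℝ] smoothI
  α_mem : ∀ (p : ℕ) (x : A.carrier), x ∈ A.gr p → α x ∈ grI B p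
  ρ_mem : ∀ (p : ℕ) (x : A.carrier), x ∈ A.gr (p + 1) → ρ x ∈ grI B p
  ρ_zero : ∀ x ∈ A.gr 0, ρ x = 0
  ρ_mul : ∀ (p : ℕ) (x y : A.carrier), x ∈ A.gr p →
    ρ (x * y) = ρ x * α y + (-1 : ℝ) ^ p • (α x * ρ y)
  α_d : ∀ x, α (A.d x) = TensorProduct.map B.d LinearMap.id (α x)
  ρ_d : ∀ x, TensorProduct.map LinearMap.id dI (α x) =
    TensorProduct.map B.d LinearMap.id (ρ x) + ρ (A.d x)
  at_zero : ∀ x, restrictI B 0 (α x) = φ x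
  at_one : ∀ x, restrictI B 1 (α x) = ψ x

/-- Two morphisms are concordant. -/
def Concordant {A : DGCA.{u}} {B : DGCA.{v}} (φ ψ : DGHom A B) : Prop :=
  Nonempty (Concordance φ ψ)

/-- Two morphisms are cochain homotopic. -/
def CochainHomotopic {A : DGCA.{u}} {B : DGCA.{v}} (φ ψ : DGHom A B) : Prop :=
  ∃ τ : A.carrier →ₗ[ℝ] B.carrier, (∀ x ∈ A.gr 0, τ x = 0) ∧
    (∀ (p : ℕ) (x : A.carrier), x ∈ A.gr (p + 1) → τ x ∈ B.gr p) ∧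
    ∀ x, ψ x - φ x = B.d (τ x) + τ (A.d x)

/-- `ψ` is a weak inverse of `φ`: both composites are equivalent to the identity, through
concordances which induce cochain homotopies. -/
structure IsWeakInverse {A : DGCA.{u}} {B : DGCA.{v}} (φ : DGHom A B) (ψ : DGHom B A) : Prop where
  left : Concordant (ψ.comp φ) (DGHom.id A)
  right : Concordant (φ.comp ψ) (DGHom.id B)
  left_homotopic : CochainHomotopic (ψ.comp φ) (DGHom.id A)
  right_homotopic : CochainHomotopic (φ.comp ψ) (DGHom.id B)

/-- A morphism out of `CE(𝔤)` is trivial if it is concordant to one vanishing on all generators. -/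
def IsTrivial {g : LInfty} {B : DGCA.{v}} (φ : DGHom g.CE B) : Prop :=
  ∃ φ₀ : DGHom g.CE B, (∀ i, φ₀ (g.gen i) = 0) ∧ Concordant φ₀ φ

/-! ### Descent objects -/

section Descent

variable {E : Type*} [NormedAddCommGroup E] [NormedSpace ℝ E] {H : Type*} [TopologicalSpace H]
  (I : ModelWithCorners ℝ E H) {Y : Type u} [TopologicalSpace Y] [ChartedSpace H Y]
  {E' : Type*} [NormedAddCommGroup E'] [NormedSpace ℝ E'] {H' : Type*} [TopologicalSpace H']
  (J : ModelWithCorners ℝ E' H') {X : Type v} [TopologicalSpace X] [ChartedSpace H' X]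

/-- A `𝔤`-descent object on `X`, relative to `π : Y → X`: a flat vertical `𝔤`-valued form. -/
abbrev Descent (g : LInfty) (π : Y → X) : Type _ := DGHom g.CE (OmegaVert I π)

/-- A `𝔤`-connection descent object on `X`, relative to `π : Y → X`: a commuting diagram with the
horizontal morphisms `Avert`, `A` and `K`
```
  CE(𝔤)   →  Ω_vert(Y)
    ↑           ↑
  W(𝔤)    →   Ω(Y)
    ↑           ↑
  inv(𝔤)  →   Ω(X)
```
-/
structure ConnDescent (g : LInfty) (π : Y → X) (hπ : ContMDiff I J ∞ π) where
  Avert : Descent I g π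
  A : DGHom g.W (Omega I Y)
  K : DGHom g.inv (Omega J X)
  top : ∀ x, toVert I π (A x) = Avert (g.toCEHom x)
  bot : ∀ P, A (g.invHom P) = pullback π hπ (K P)

end Descent


/-! ### The mapping cones and their generators -/

theorem LInfty.line_curv_inv (k : ℕ) (hk : 0 < k) :
    (line k hk).inn.gen (Sum.inr ()) ∈ (line k hk).invSubalgebra := by
  intro i
  refine ⟨FGC.deriv_gen _ _ _ _, ?_⟩
  have h0 : (line k hk).d ((line k hk).gen ()) = 0 := ofGen_d_gen _ _ _ _ _ _
  have h := (line k hk).inn_d_inr ()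
  rw [h0, map_zero, map_zero, neg_zero] at h
  refine (congrArg _ h).trans (map_zero _)

/-- The generator of `inv(b^{k-1}𝔲(1))`: the shifted generator of `W(b^{k-1}𝔲(1))`. -/
def LInfty.lineCurv (k : ℕ) (hk : 0 < k) : (line k hk).inv.carrier :=
  ⟨(line k hk).inn.gen (Sum.inr ()), line_curv_inv k hk⟩

theorem LInfty.d_lineCurv (k : ℕ) (hk : 0 < k) : (line k hk).inv.d (lineCurv k hk) = 0 := by
  have h0 : (line k hk).d ((line k hk).gen ()) = 0 := ofGen_d_gen _ _ _ _ _ _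
  have h := (line k hk).inn_d_inr ()
  rw [h0, map_zero, map_zero, neg_zero] at h
  exact Subtype.ext h

namespace Transgression

variable {g : LInfty} {n : ℕ} (T : Transgression g n) (hn : 0 < n)

/-- The transgressed invariant polynomial, as an element of `inv(𝔤)`. -/
def Pinv : g.inv.carrier := ⟨T.P, T.P_inv⟩

theorem d_Pinv : g.inv.d T.Pinv = 0 := Subtype.ext T.d_P

/-- The mapping cone `(b^{n-1}𝔲(1) ↪ 𝔤_μ)`. -/
def coneCE : LInfty := (T.stringSub hn).cone

/-- The generators of the mapping cone in `𝔤*`. -/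
def coneCE_g (i : g.ι) : FGC (T.coneCE hn).deg := (T.coneCE hn).gen (Sum.inl (Sum.inl i))

/-- The generator `b` of the mapping cone. -/
def coneCE_b : FGC (T.coneCE hn).deg := (T.coneCE hn).gen (Sum.inl (Sum.inr ()))

/-- The generator `σ b` of the mapping cone. -/
def coneCE_σb : FGC (T.coneCE hn).deg := (T.coneCE hn).gen (Sum.inr ())

/-- The mapping cone `(inn(b^{n-1}𝔲(1)) ↪ cs_P(𝔤))`. -/
def coneW : LInfty := (T.csSub hn).cone

/-- The generators of the mapping cone in `𝔤* ⊕ 𝔤*[1]`. -/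
def coneW_g (i : g.inn.ι) : FGC (T.coneW hn).deg :=
  (T.coneW hn).gen (Sum.inl (Sum.inl (Sum.inl i)))

/-- The generator `c` of the mapping cone. -/
def coneW_c : FGC (T.coneW hn).deg := (T.coneW hn).gen (Sum.inl (Sum.inl (Sum.inr ())))

/-- The generator `b` of the mapping cone. -/
def coneW_b : FGC (T.coneW hn).deg := (T.coneW hn).gen (Sum.inl (Sum.inr ()))

/-- The generator `σ b` of the mapping cone. -/
def coneW_σb : FGC (T.coneW hn).deg := (T.coneW hn).gen (Sum.inr (Sum.inl ()))

/-- The generator `σ c` of the mapping cone. -/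
def coneW_σc : FGC (T.coneW hn).deg := (T.coneW hn).gen (Sum.inr (Sum.inr ()))

end Transgression

/-- The characteristic class in `H_dR(X)` of a `𝔤`-connection descent object for a closed
invariant polynomial. -/
def ConnDescent.charClass {E : Type*} [NormedAddCommGroup E] [NormedSpace ℝ E] {H : Type*}
    [TopologicalSpace H] {I : ModelWithCorners ℝ E H} {Y : Type u} [TopologicalSpace Y]
    [ChartedSpace H Y] {E' : Type*} [NormedAddCommGroup E'] [NormedSpace ℝ E'] {H' : Type*}
    [TopologicalSpace H'] {J : ModelWithCorners ℝ E' H'} {X : Type v} [TopologicalSpace X]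
    [ChartedSpace H' X] {g : LInfty} {π : Y → X} {hπ : ContMDiff I J ∞ π}
    (D : ConnDescent I J g π hπ) (P : g.inv.carrier) (hP : g.inv.d P = 0) :
    (Omega J X).Cohomology :=
  D.K.mapCohomology (g.inv.cls P hP)

end LiftObstruction

end

open LiftObstruction

noncomputable section

namespace LiftObstruction

universe u v w

/-!
The mapping cone of `𝔥 ↪ 𝔤` forgets the differential relations on the generators `a ∈ 𝔥*`: there
`σa` is a new name for `da - d_𝔤 a`. A morphism out of the cone may therefore take arbitrary values
on `𝔥*`, and the straight line between two such values shows that any two morphisms which agree on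
the remaining generators are concordant. Hence the inclusions `f` and `f̂` of the remaining
generators are weak equivalences as soon as they have a left inverse. A left inverse exists because
sending `b` and `c` to `0` forces `σb ↦ μ` for `db = -μ`, and `σb ↦ cs`, `σc ↦ -P` for
`db = c - cs` and `dc = P`.

A concordance is a morphism into a path object, and integration over the interval turns it into a
cochain homotopy. In particular a morphism out of `CE(b^n 𝔲(1))` is trivial precisely if the image
of the generator is exact, whereas an extension of `A_vert` along `CE(𝔤) → CE(𝔤_μ)` is a choice of
`-A_vert(b)` with differential `A_vert(μ)`. As a Weil algebra imposes no relations, the connection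
form extends along with `A_vert` as soon as the value of `b` lifts along the surjection
`Ω•(Y) → Ω•_vert(Y)`.
-/

namespace FGC

variable {ι : Type} {deg : ι → ℕ}

theorem subalgebra_eq_top {S : Subalgebra ℝ (FGC deg)} (h : ∀ i, gen deg i ∈ S) : S = ⊤ := by
  refine eq_top_iff.2 fun x _ => ?_
  induction x using induction_mon with
  | hm l =>
    refine S.list_prod_mem fun x hx => ?_
    obtain ⟨i, -, rfl⟩ := List.mem_map.1 hx
    exact h i
  | ha x y hx hy => exact S.add_mem (hx trivial) (hy trivial)
  | hs a x hx => exact S.smul_mem (hx trivial) a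

theorem algHom_mem_gr {B : DGCA.{v}} {φ : FGC deg →ₐ[ℝ] B.carrier}
    (h : ∀ i, φ (gen deg i) ∈ B.gr (deg i)) {p : ℕ} {x : FGC deg} (hx : x ∈ gr deg p) :
    φ x ∈ B.gr p := by
  induction hx using Submodule.span_induction with
  | mem x hx =>
    obtain ⟨l, rfl, rfl⟩ := hx
    induction l with
    | nil => simpa using B.one_mem
    | cons i l ih => simpa using B.mul_mem (h i) ih
  | zero => simp
  | add y z _ _ hy hz => simpa using add_mem hy hz
  | smul a y _ hy => simpa using Submodule.smul_mem _ a hy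

/-- The algebra map out of a free graded-commutative algebra with prescribed homogeneous values on
the generators; graded commutativity of the target makes the relations hold. -/
def liftGr {B : DGCA.{v}} (v : ι → B.carrier) (hv : ∀ i, v i ∈ B.gr (deg i)) :
    FGC deg →ₐ[ℝ] B.carrier :=
  lift v fun i j => B.comm (hv i) (hv j)

@[simp]
theorem liftGr_gen {B : DGCA.{v}} (v : ι → B.carrier) (hv : ∀ i, v i ∈ B.gr (deg i)) (i : ι) :
    liftGr v hv (gen deg i) = v i :=
  lift_gen _ _ _

end FGC

theorem DGCA.d_one (B : DGCA.{v}) : B.d 1 = 0 := by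
  simpa using B.leibniz B.one_mem 1

namespace DGHom

variable {A : DGCA.{u}} {B : DGCA.{v}}

theorem ext_apply {φ ψ : DGHom A B} (h : ∀ x, φ x = ψ x) : φ = ψ := by
  cases φ
  cases ψ
  congr 1
  exact AlgHom.ext h

theorem congr_fun {φ ψ : DGHom A B} (h : φ = ψ) (x : A.carrier) : φ x = ψ x :=
  h ▸ rfl

theorem apply_d (φ : DGHom A B) (x : A.carrier) : φ (A.d x) = B.d (φ x) :=
  φ.map_d x

theorem apply_mem (φ : DGHom A B) {p : ℕ} {x : A.carrier} (hx : x ∈ A.gr p) : φ x ∈ B.gr p :=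
  φ.map_gr p x hx

theorem d_mem_equalizer {φ ψ : DGHom A B} {x : A.carrier}
    (hx : x ∈ AlgHom.equalizer φ.toAlgHom ψ.toAlgHom) :
    A.d x ∈ AlgHom.equalizer φ.toAlgHom ψ.toAlgHom :=
  (φ.map_d x).trans ((congrArg B.d hx).trans (ψ.map_d x).symm)

end DGHom

namespace LInfty

variable {g : LInfty} {B : DGCA.{v}}

theorem gen_mem (i : g.ι) : g.gen i ∈ FGC.gr g.deg (g.deg i) :=
  FGC.gen_mem i

theorem d_gen_mem (i : g.ι) : g.d (g.gen i) ∈ FGC.gr g.deg (g.deg i + 1) :=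
  g.d_mem (gen_mem i)

theorem d_algHom_mul {φ : FGC g.deg →ₐ[ℝ] B.carrier}
    (hφ : ∀ i, φ (g.gen i) ∈ B.gr (g.deg i)) (x : FGC g.deg) (y : B.carrier) :
    B.d (φ x * y) = B.d (φ x) * y + φ (FGC.parity g.deg x) * B.d y := by
  induction x using FGC.induction_mon with
  | hm l =>
    rw [B.leibniz (FGC.algHom_mem_gr hφ (FGC.mon_mem l)), FGC.parity_mem (FGC.mon_mem l), map_smul,
      smul_mul_assoc]
  | ha x z hx hz => simp only [map_add, add_mul, hx, hz]; abel
  | hs a x hx => simp only [map_smul, smul_mul_assoc, hx, smul_add]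

/-- The elements of `CE(𝔤)` on which a degree-preserving algebra map commutes with the
differentials. They form a subalgebra, so that a morphism can be tested on generators. -/
def chainSubalgebra (φ : FGC g.deg →ₐ[ℝ] B.carrier) (hφ : ∀ i, φ (g.gen i) ∈ B.gr (g.deg i)) :
    Subalgebra ℝ (FGC g.deg) where
  carrier := {x | φ (g.d x) = B.d (φ x)}
  mul_mem' {x y} hx hy := by
    simp only [Set.mem_ofPred_eq] at hx hy ⊢
    rw [g.d_mul, map_add, map_mul, map_mul, map_mul, d_algHom_mul hφ, hx, hy]
  add_mem' {x y} hx hy := by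
    simp only [Set.mem_ofPred_eq] at hx hy ⊢
    rw [map_add, map_add, map_add, map_add, hx, hy]
  algebraMap_mem' r := by
    simp only [Set.mem_ofPred_eq, Algebra.algebraMap_eq_smul_one, map_smul, map_one, g.d_one,
      B.d_one, map_zero]

theorem d_mem_chainSubalgebra {φ : FGC g.deg →ₐ[ℝ] B.carrier}
    {hφ : ∀ i, φ (g.gen i) ∈ B.gr (g.deg i)} {x : FGC g.deg} (hx : x ∈ chainSubalgebra φ hφ) :
    g.d x ∈ chainSubalgebra φ hφ := by
  change φ (g.d (g.d x)) = B.d (φ (g.d x))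
  rw [show φ (g.d x) = B.d (φ x) from hx, g.d_d, B.d_d, map_zero]

/-- A degree-preserving algebra map that commutes with the differentials, as a morphism. -/
def homOfChain (φ : FGC g.deg →ₐ[ℝ] B.carrier) (hφ : ∀ i, φ (g.gen i) ∈ B.gr (g.deg i))
    (h : chainSubalgebra φ hφ = ⊤) : DGHom g.CE B where
  toAlgHom := φ
  map_gr _ _ hx := FGC.algHom_mem_gr hφ hx
  map_d _ := h.ge trivial

/-- A degree-preserving algebra map that commutes with the differentials on generators, as a
morphism. -/
def homOfGens (φ : FGC g.deg →ₐ[ℝ] B.carrier) (hφ : ∀ i, φ (g.gen i) ∈ B.gr (g.deg i))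
    (hd : ∀ i, φ (g.d (g.gen i)) = B.d (φ (g.gen i))) : DGHom g.CE B :=
  homOfChain φ hφ (FGC.subalgebra_eq_top hd)

theorem hom_ext {φ ψ : DGHom g.CE B} (h : ∀ i, φ (g.gen i) = ψ (g.gen i)) : φ = ψ :=
  DGHom.ext_apply fun x => DFunLike.congr_fun (FGC.algHom_ext (f := φ.toAlgHom) h) x

end LInfty

namespace NormalSub

variable {h g k : LInfty} (t : NormalSub h g) {B : DGCA.{v}}

/-- The inclusion `∧•(𝔤*) → CE(𝔥 ↪ 𝔤)`. It is not a chain map: its failure to be one is the shift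
`σt*`. -/
def coneIncl : FGC g.deg →ₐ[ℝ] FGC t.cone.deg := t.incl

@[simp]
theorem coneIncl_gen (i : g.ι) : t.coneIncl (g.gen i) = t.cone.gen (Sum.inl i) :=
  t.incl_gen i

theorem coneIncl_mem {p : ℕ} {x : FGC g.deg} (hx : x ∈ FGC.gr g.deg p) :
    t.coneIncl x ∈ FGC.gr t.cone.deg p :=
  t.incl_mem hx

theorem cone_d_inl (x : h.ι) : t.cone.d (t.cone.gen (Sum.inl (t.s x))) =
    t.coneIncl (g.d (g.gen (t.s x))) + t.cone.gen (Sum.inr x) := by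
  have hshift : t.shift (t.incl (g.gen (t.s x))) = FGC.gen t.coneDeg (Sum.inr x) := by
    rw [t.incl_gen, shift, FGC.deriv_gen, t.shiftVal_s]
  rw [← coneIncl_gen]
  exact (t.coneD_incl _).trans (congrArg (_ + ·) hshift)

theorem cone_gen_inr (x : h.ι) : t.cone.gen (Sum.inr x) =
    t.cone.d (t.cone.gen (Sum.inl (t.s x))) - t.coneIncl (g.d (g.gen (t.s x))) :=
  eq_sub_of_add_eq' (t.cone_d_inl x).symm

theorem cone_d_inr (x : h.ι) : t.cone.d (t.cone.gen (Sum.inr x)) =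
    -t.cone.d (t.coneIncl (g.d (g.gen (t.s x)))) := by
  rw [cone_gen_inr, map_sub, t.cone.d_d, zero_sub]

theorem cone_d_incl_of_mem_adjoin {x : FGC g.deg}
    (hx : x ∈ Algebra.adjoin ℝ (g.gen '' (Set.range t.s)ᶜ)) :
    t.cone.d (t.coneIncl x) = t.coneIncl (g.d x) := by
  refine (t.coneD_incl x).trans ?_
  rw [t.shift_incl_adjoin hx, add_zero]
  rfl

theorem coneIncl_mem_subalgebra {S : Subalgebra ℝ (FGC t.cone.deg)}
    (hg : ∀ i, t.cone.gen (Sum.inl i) ∈ S) (x : FGC g.deg) : t.coneIncl x ∈ S := by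
  have htop : S.comap t.coneIncl = ⊤ :=
    FGC.subalgebra_eq_top fun i => by simpa using (t.coneIncl_gen i).symm ▸ hg i
  exact htop.ge trivial

/-- The generators `σx` are differentials up to elements of `∧•(𝔤*)`, so as a differential
algebra the mapping cone is generated by `𝔤*`. -/
theorem cone_subalgebra_eq_top {S : Subalgebra ℝ (FGC t.cone.deg)}
    (hd : ∀ x ∈ S, t.cone.d x ∈ S) (hg : ∀ i, t.cone.gen (Sum.inl i) ∈ S) : S = ⊤ := by
  refine FGC.subalgebra_eq_top ?_
  rintro (i | x)
  · exact hg i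
  · have hx : t.cone.gen (Sum.inr x) ∈ S := by
      rw [cone_gen_inr]
      exact sub_mem (hd _ (hg _)) (t.coneIncl_mem_subalgebra hg _)
    exact hx

theorem cone_hom_ext {φ ψ : DGHom t.cone.CE B}
    (h : ∀ i, φ (t.cone.gen (Sum.inl i)) = ψ (t.cone.gen (Sum.inl i))) : φ = ψ := by
  have htop := t.cone_subalgebra_eq_top
    (S := AlgHom.equalizer φ.toAlgHom ψ.toAlgHom) (fun _ => DGHom.d_mem_equalizer) h
  exact DGHom.ext_apply fun _ => htop.ge trivial

section coneLift

variable (φ : FGC g.deg →ₐ[ℝ] B.carrier) (hφ : ∀ i, φ (g.gen i) ∈ B.gr (g.deg i))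

/-- The values of `coneLift` on the generators: on `σx` it is forced by `cone_gen_inr`. -/
def coneLiftVal : t.cone.ι → B.carrier :=
  Sum.elim (fun i => φ (g.gen i))
    (fun x => B.d (φ (g.gen (t.s x))) - φ (g.d (g.gen (t.s x))))

include hφ in
theorem coneLiftVal_mem (i : t.cone.ι) : t.coneLiftVal φ i ∈ B.gr (t.cone.deg i) := by
  rcases i with i | x
  · exact hφ i
  · change B.d _ - φ _ ∈ B.gr (h.deg x + 1)
    rw [← t.deg_s x]
    exact sub_mem (B.d_mem (hφ _)) (FGC.algHom_mem_gr hφ (LInfty.d_gen_mem _))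

/-- The algebra map underlying `coneLift`. -/
def coneLiftAlgHom : FGC t.cone.deg →ₐ[ℝ] B.carrier :=
  FGC.liftGr (t.coneLiftVal φ) (t.coneLiftVal_mem φ hφ)

theorem coneLiftAlgHom_inl (i : g.ι) :
    t.coneLiftAlgHom φ hφ (t.cone.gen (Sum.inl i)) = φ (g.gen i) :=
  FGC.liftGr_gen _ _ _

theorem coneLiftAlgHom_inr (x : h.ι) : t.coneLiftAlgHom φ hφ (t.cone.gen (Sum.inr x)) =
    B.d (φ (g.gen (t.s x))) - φ (g.d (g.gen (t.s x))) :=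
  FGC.liftGr_gen _ _ _

theorem coneLiftAlgHom_incl (x : FGC g.deg) : t.coneLiftAlgHom φ hφ (t.coneIncl x) = φ x := by
  refine DFunLike.congr_fun (FGC.algHom_ext (f := (t.coneLiftAlgHom φ hφ).comp t.coneIncl)
    fun i => ?_) x
  change t.coneLiftAlgHom φ hφ (t.coneIncl (g.gen i)) = φ (g.gen i)
  rw [coneIncl_gen, coneLiftAlgHom_inl]

theorem coneLiftAlgHom_mem (i : t.cone.ι) :
    t.coneLiftAlgHom φ hφ (t.cone.gen i) ∈ B.gr (t.cone.deg i) := by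
  rw [show t.coneLiftAlgHom φ hφ (t.cone.gen i) = t.coneLiftVal φ i from FGC.liftGr_gen _ _ _]
  exact t.coneLiftVal_mem φ hφ i

theorem chainSubalgebra_coneLiftAlgHom
    (hd : ∀ i ∉ Set.range t.s, φ (g.d (g.gen i)) = B.d (φ (g.gen i))) :
    LInfty.chainSubalgebra (t.coneLiftAlgHom φ hφ) (t.coneLiftAlgHom_mem φ hφ) = ⊤ := by
  refine t.cone_subalgebra_eq_top (fun _ => LInfty.d_mem_chainSubalgebra) fun i => ?_
  change t.coneLiftAlgHom φ hφ (t.cone.d (t.cone.gen (Sum.inl i))) = B.d _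
  by_cases hi : i ∈ Set.range t.s
  · obtain ⟨x, rfl⟩ := hi
    rw [cone_d_inl, map_add, coneLiftAlgHom_incl, coneLiftAlgHom_inr, coneLiftAlgHom_inl]
    exact add_sub_cancel _ _
  · rw [← coneIncl_gen, t.cone_d_incl_of_mem_adjoin (Algebra.subset_adjoin ⟨i, hi, rfl⟩),
      coneLiftAlgHom_incl, coneLiftAlgHom_incl, hd i hi]

/-- The universal property of the mapping cone: passing from `CE(𝔤)` to the cone forgets the
differential on the generators in `𝔥*`, so that a morphism out of the cone is a degree-preserving
algebra map on `∧•(𝔤*)` that commutes with the differentials on the remaining generators. -/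
def coneLift (hd : ∀ i ∉ Set.range t.s, φ (g.d (g.gen i)) = B.d (φ (g.gen i))) :
    DGHom t.cone.CE B :=
  LInfty.homOfChain _ _ (t.chainSubalgebra_coneLiftAlgHom φ hφ hd)

variable (hd : ∀ i ∉ Set.range t.s, φ (g.d (g.gen i)) = B.d (φ (g.gen i)))

theorem coneLift_incl (x : FGC g.deg) : t.coneLift φ hφ hd (t.coneIncl x) = φ x :=
  t.coneLiftAlgHom_incl φ hφ x

theorem coneLift_inl (i : g.ι) : t.coneLift φ hφ hd (t.cone.gen (Sum.inl i)) = φ (g.gen i) :=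
  t.coneLiftAlgHom_inl φ hφ i

theorem coneLift_inr (x : h.ι) : t.coneLift φ hφ hd (t.cone.gen (Sum.inr x)) =
    B.d (φ (g.gen (t.s x))) - φ (g.d (g.gen (t.s x))) :=
  t.coneLiftAlgHom_inr φ hφ x

end coneLift

/-- A morphism `CE(𝔨) → CE(𝔤)` whose values on generators avoid `𝔥*` is also a morphism into the
mapping cone, since the shift vanishes on these values. -/
def inclCone (φ : DGHom k.CE g.CE)
    (hφ : ∀ i, φ (k.gen i) ∈ Algebra.adjoin ℝ (g.gen '' (Set.range t.s)ᶜ)) :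
    DGHom k.CE t.cone.CE :=
  LInfty.homOfGens (t.coneIncl.comp φ.toAlgHom)
    (fun _ => t.coneIncl_mem (φ.apply_mem (FGC.gen_mem _)))
    fun i => (congrArg t.coneIncl (φ.apply_d _)).trans (t.cone_d_incl_of_mem_adjoin (hφ i)).symm

theorem inclCone_apply (φ : DGHom k.CE g.CE)
    (hφ : ∀ i, φ (k.gen i) ∈ Algebra.adjoin ℝ (g.gen '' (Set.range t.s)ᶜ)) (x : FGC k.deg) :
    t.inclCone φ hφ x = t.coneIncl (φ x) :=
  rfl

end NormalSub

namespace DGCA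

/-- The shifted grading: `F.grPred (p + 1) = F.gr p`, and there is nothing in degree `0`. It is the
degree of the factor `ρ` in `dt ∧ ρ`. -/
def grPred (F : DGCA.{v}) : ℕ → Submodule ℝ F.carrier
  | 0 => ⊥
  | p + 1 => F.gr p

section grPred

variable {F : DGCA.{v}} {p q : ℕ} {x r : F.carrier}

theorem mul_mem_grPred (hx : x ∈ F.gr p) (hr : r ∈ F.grPred q) : x * r ∈ F.grPred (p + q) := by
  cases q with
  | zero => simp [show r = 0 from hr]
  | succ q => exact F.mul_mem hx hr

theorem grPred_mul_mem (hr : r ∈ F.grPred p) (hx : x ∈ F.gr q) : r * x ∈ F.grPred (p + q) := by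
  cases p with
  | zero => simp [show r = 0 from hr]
  | succ p =>
    rw [Nat.succ_add]
    exact F.mul_mem hr hx

theorem d_mem_grPred (hr : r ∈ F.grPred p) : F.d r ∈ F.gr p := by
  cases p with
  | zero => simp [show r = 0 from hr]
  | succ p => exact F.d_mem hr

theorem comm_grPred (hx : x ∈ F.gr p) (hr : r ∈ F.grPred q) :
    (-1 : ℝ) ^ p • (x * r) = (-1 : ℝ) ^ (p * q) • (r * x) := by
  cases q with
  | zero => simp [show r = 0 from hr]
  | succ q =>
    rw [F.comm hx hr, smul_smul, ← pow_add]
    congr 2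
    ring

theorem leibniz_grPred (hr : r ∈ F.grPred p) (y : F.carrier) :
    F.d (r * y) = F.d r * y - (-1 : ℝ) ^ p • (r * F.d y) := by
  cases p with
  | zero => simp [show r = 0 from hr]
  | succ p => rw [F.leibniz hr, pow_succ, mul_neg_one, neg_smul, sub_neg_eq_add]

end grPred

/-- A derivation of degree `0` commuting with the differential: the derivative `∂/∂t` in the
direction of a parameter `t` on which the elements of the algebra depend. -/
structure ParamDeriv (F : DGCA.{v}) where
  D : F.carrier →ₗ[ℝ] F.carrier
  mem : ∀ {p : ℕ} {x : F.carrier}, x ∈ F.gr p → D x ∈ F.gr p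
  mul : ∀ x y : F.carrier, D (x * y) = D x * y + x * D y
  comm_d : ∀ x : F.carrier, D (F.d x) = F.d (D x)

variable (F : DGCA.{v}) (δ : ParamDeriv F)

/-- The matrices `!![(-1)^p • α, ρ; 0, α]` representing the elements `α + dt ∧ ρ` of degree `p`.
The product of matrices produces the sign with which `dt` moves past `α`. -/
def matrixGr (p : ℕ) : Submodule ℝ (Matrix (Fin 2) (Fin 2) F.carrier) where
  carrier := {M | M 1 0 = 0 ∧ M 1 1 ∈ F.gr p ∧ M 0 0 = (-1 : ℝ) ^ p • M 1 1 ∧ M 0 1 ∈ F.grPred p}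
  add_mem' := by
    rintro M N ⟨hM, hM', hM'', hM'''⟩ ⟨hN, hN', hN'', hN'''⟩
    exact ⟨by simp [hM, hN], add_mem hM' hN', by simp [hM'', hN''], add_mem hM''' hN'''⟩
  zero_mem' := by simp
  smul_mem' a M := by
    rintro ⟨hM, hM', hM'', hM'''⟩
    exact ⟨by simp [hM], Submodule.smul_mem _ a hM', by simp [hM'', smul_comm a],
      Submodule.smul_mem _ a hM'''⟩

/-- The differential `d (α + dt ∧ ρ) = d α + dt ∧ (∂α - d ρ)` on matrices. -/
def matrixD : Matrix (Fin 2) (Fin 2) F.carrier →ₗ[ℝ] Matrix (Fin 2) (Fin 2) F.carrier where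
  toFun M := !![δ.D (M 1 0) - F.d (M 0 0), δ.D (M 1 1) - F.d (M 0 1); F.d (M 1 0), F.d (M 1 1)]
  map_add' M N := by
    ext i j
    fin_cases i <;> fin_cases j <;> simp [add_sub_add_comm]
  map_smul' a M := by
    ext i j
    fin_cases i <;> fin_cases j <;> simp [smul_sub]

variable {F}

theorem matrixGr_mul {p q : ℕ} {M N : Matrix (Fin 2) (Fin 2) F.carrier} (hM : M ∈ F.matrixGr p)
    (hN : N ∈ F.matrixGr q) : M * N ∈ F.matrixGr (p + q) := by
  obtain ⟨hM, hM', hM'', hM'''⟩ := hM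
  obtain ⟨hN, hN', hN'', hN'''⟩ := hN
  refine ⟨?_, ?_, ?_, ?_⟩ <;>
    simp only [Matrix.mul_apply, Fin.sum_univ_two, hM, hN, hM'', hN'', zero_mul, mul_zero,
      zero_add, add_zero, smul_mul_assoc, mul_smul_comm, smul_zero]
  · exact F.mul_mem hM' hN'
  · rw [smul_smul, ← pow_add, add_comm q p]
  · exact add_mem (Submodule.smul_mem _ _ (mul_mem_grPred hM' hN''')) (grPred_mul_mem hM''' hN')

theorem matrixGr_comm {p q : ℕ} {M N : Matrix (Fin 2) (Fin 2) F.carrier} (hM : M ∈ F.matrixGr p)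
    (hN : N ∈ F.matrixGr q) : M * N = (-1 : ℝ) ^ (p * q) • (N * M) := by
  obtain ⟨hM, hM', hM'', hM'''⟩ := hM
  obtain ⟨hN, hN', hN'', hN'''⟩ := hN
  have hsq : (-1 : ℝ) ^ (p * q) * (-1 : ℝ) ^ (p * q) = 1 := by
    rw [← mul_pow, neg_one_mul, neg_neg, one_pow]
  have hpq := comm_grPred hM' hN'''
  have hqp := comm_grPred hN' hM'''
  rw [mul_comm q p] at hqp
  ext i j
  fin_cases i <;> fin_cases j <;>
    simp only [Fin.zero_eta, Fin.mk_one, Matrix.mul_apply, Matrix.smul_apply, Fin.sum_univ_two, hM,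
      hN, hM'', hN'', zero_mul, mul_zero, zero_add, add_zero, smul_zero, smul_mul_assoc,
      mul_smul_comm, smul_add]
  · rw [F.comm hM' hN']
    simp only [smul_smul]
    congr 1
    ring
  · rw [hpq, hqp, smul_smul, hsq, one_smul, add_comm]
  · rw [F.comm hM' hN']

theorem matrixD_mem {p : ℕ} {M : Matrix (Fin 2) (Fin 2) F.carrier} (hM : M ∈ F.matrixGr p) :
    matrixD F δ M ∈ F.matrixGr (p + 1) := by
  obtain ⟨hM, hM', hM'', hM'''⟩ := hM
  refine ⟨?_, F.d_mem hM', ?_, sub_mem (δ.mem hM') (d_mem_grPred hM''')⟩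
  · simp [matrixD, hM]
  · simp [matrixD, hM, hM'', pow_succ]

theorem matrixD_leibniz {p : ℕ} {M : Matrix (Fin 2) (Fin 2) F.carrier} (hM : M ∈ F.matrixGr p)
    (N : Matrix (Fin 2) (Fin 2) F.carrier) :
    matrixD F δ (M * N) = matrixD F δ M * N + (-1 : ℝ) ^ p • (M * matrixD F δ N) := by
  obtain ⟨hM, hM', hM'', hM'''⟩ := hM
  have hsq : (-1 : ℝ) ^ p * (-1 : ℝ) ^ p = 1 := by
    rw [← mul_pow, neg_one_mul, neg_neg, one_pow]
  ext i j
  rw [Matrix.add_apply, Matrix.smul_apply, Matrix.mul_apply, Matrix.mul_apply]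
  fin_cases i <;> fin_cases j <;>
    simp [matrixD, Matrix.mul_apply, hM, hM'', δ.mul, F.leibniz hM', leibniz_grPred hM''',
      smul_smul, hsq, mul_sub, sub_mul, smul_sub] <;>
    abel

theorem matrixD_matrixD (M : Matrix (Fin 2) (Fin 2) F.carrier) :
    matrixD F δ (matrixD F δ M) = 0 := by
  ext i j
  fin_cases i <;> fin_cases j <;> simp [matrixD, F.d_d, δ.comm_d]

variable (F)

/-- The algebra of all matrices that contains `F.adjoinDt δ`. -/
def matrixDGCA : DGCA.{v} where
  carrier := Matrix (Fin 2) (Fin 2) F.carrier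
  gr := F.matrixGr
  d := F.matrixD δ
  one_mem := ⟨by simp, by simpa using F.one_mem, by simp, by simp [grPred]⟩
  mul_mem := matrixGr_mul
  comm := matrixGr_comm
  d_mem := matrixD_mem δ
  leibniz := matrixD_leibniz δ
  d_d := matrixD_matrixD δ

/-- The upper triangular matrices. -/
def upperTriangular : Subalgebra ℝ (Matrix (Fin 2) (Fin 2) F.carrier) where
  carrier := {M | M 1 0 = 0}
  mul_mem' {M N} hM hN := by
    simp_all [Matrix.mul_apply]
  add_mem' {M N} hM hN := by simp_all
  algebraMap_mem' r := by simp [Matrix.algebraMap_matrix_apply]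

/-- The algebra of the elements `α + dt ∧ ρ` over an algebra `F` of elements depending on a
parameter `t`, with `d (α + dt ∧ ρ) = d α + dt ∧ (∂α - d ρ)`. -/
def adjoinDt : DGCA.{v} :=
  (F.matrixDGCA δ).sub F.upperTriangular fun M (hM : M 1 0 = 0) => by
    change F.d (M 1 0) = 0
    rw [hM, map_zero]

/-- The matrix representing an element of `F.adjoinDt δ`. -/
def dtMatrix : (F.adjoinDt δ).carrier →ₐ[ℝ] Matrix (Fin 2) (Fin 2) F.carrier :=
  F.upperTriangular.val

variable {F δ}

theorem dtMatrix_injective : Function.Injective (F.dtMatrix δ) :=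
  Subtype.val_injective

theorem dtMatrix_one_zero (M : (F.adjoinDt δ).carrier) : F.dtMatrix δ M 1 0 = 0 :=
  M.2

theorem dtMatrix_mem {p : ℕ} {M : (F.adjoinDt δ).carrier} (hM : M ∈ (F.adjoinDt δ).gr p) :
    F.dtMatrix δ M ∈ F.matrixGr p :=
  hM

theorem dtMatrix_d (M : (F.adjoinDt δ).carrier) :
    F.dtMatrix δ ((F.adjoinDt δ).d M) = F.matrixD δ (F.dtMatrix δ M) :=
  rfl

variable (F δ)

/-- The projection `α + dt ∧ ρ ↦ α`. -/
def killDt : DGHom (F.adjoinDt δ) F where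
  toFun M := F.dtMatrix δ M 1 1
  map_one' := by simp
  map_mul' M N := by simp [Matrix.mul_apply, dtMatrix_one_zero]
  map_zero' := by simp
  map_add' M N := by simp
  commutes' r := by simp [Matrix.algebraMap_matrix_apply]
  map_gr _ _ hM := (dtMatrix_mem hM).2.1
  map_d _ := rfl

/-- The projection `α + dt ∧ ρ ↦ ρ`. -/
def dtPart : (F.adjoinDt δ).carrier →ₗ[ℝ] F.carrier where
  toFun M := F.dtMatrix δ M 0 1
  map_add' M N := by simp
  map_smul' a M := by simp

variable {F δ}

theorem dtPart_mem {p : ℕ} {M : (F.adjoinDt δ).carrier} (hM : M ∈ (F.adjoinDt δ).gr p) :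
    F.dtPart δ M ∈ F.grPred p :=
  (dtMatrix_mem hM).2.2.2

theorem dtPart_mul {p : ℕ} {M : (F.adjoinDt δ).carrier} (hM : M ∈ (F.adjoinDt δ).gr p)
    (N : (F.adjoinDt δ).carrier) : F.dtPart δ (M * N) =
      F.dtPart δ M * F.killDt δ N + (-1 : ℝ) ^ p • (F.killDt δ M * F.dtPart δ N) := by
  change F.dtMatrix δ (M * N) 0 1 = F.dtMatrix δ M 0 1 * F.dtMatrix δ N 1 1 +
    (-1 : ℝ) ^ p • (F.dtMatrix δ M 1 1 * F.dtMatrix δ N 0 1)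
  rw [map_mul, Matrix.mul_apply, Fin.sum_univ_two, (dtMatrix_mem hM).2.2.1, smul_mul_assoc,
    add_comm]

variable (F δ) in
/-- The element `α` of degree `p` of `F`, as an element of `F.adjoinDt δ` without `dt`. -/
def withoutDt (p : ℕ) (x : F.carrier) : (F.adjoinDt δ).carrier :=
  ⟨!![(-1 : ℝ) ^ p • x, 0; 0, x], rfl⟩

theorem withoutDt_mem {p : ℕ} {x : F.carrier} (hx : x ∈ F.gr p) :
    F.withoutDt δ p x ∈ (F.adjoinDt δ).gr p :=
  ⟨rfl, hx, rfl, zero_mem _⟩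

theorem dtMatrix_withoutDt (p : ℕ) (x : F.carrier) :
    F.dtMatrix δ (F.withoutDt δ p x) = !![(-1 : ℝ) ^ p • x, 0; 0, x] :=
  rfl

theorem withoutDt_zero (p : ℕ) : F.withoutDt δ p 0 = 0 :=
  dtMatrix_injective <| by
    rw [dtMatrix_withoutDt, map_zero]
    ext i j
    fin_cases i <;> fin_cases j <;> simp

theorem withoutDt_add (p : ℕ) (x y : F.carrier) :
    F.withoutDt δ p (x + y) = F.withoutDt δ p x + F.withoutDt δ p y :=
  dtMatrix_injective <| by simp [dtMatrix_withoutDt]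

theorem withoutDt_smul (p : ℕ) (a : ℝ) (x : F.carrier) :
    F.withoutDt δ p (a • x) = a • F.withoutDt δ p x :=
  dtMatrix_injective <| by simp [dtMatrix_withoutDt, smul_comm a]

theorem withoutDt_mul (p q : ℕ) (x y : F.carrier) :
    F.withoutDt δ (p + q) (x * y) = F.withoutDt δ p x * F.withoutDt δ q y :=
  dtMatrix_injective <| by
    simp [dtMatrix_withoutDt, pow_add, smul_smul]

theorem withoutDt_one : F.withoutDt δ 0 1 = 1 :=
  dtMatrix_injective <| by simp [dtMatrix_withoutDt, Matrix.one_fin_two]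

theorem d_withoutDt (p : ℕ) {x : F.carrier} (hx : δ.D x = 0) :
    (F.adjoinDt δ).d (F.withoutDt δ p x) = F.withoutDt δ (p + 1) (F.d x) :=
  dtMatrix_injective <| by simp [dtMatrix_d, dtMatrix_withoutDt, matrixD, hx, pow_succ]

end DGCA

section Interval

theorem dI_apply {f : smoothI} {F : ℝ → ℝ} (hF : ContDiff ℝ ∞ F) (h : ∀ t, f.1 t = F t)
    (t : Set.Icc (0 : ℝ) 1) : (dI f).1 t = deriv F t :=
  derivWithin_smoothI hF h t

theorem dI_mul (f g : smoothI) : dI (f * g) = dI f * g + f * dI g := by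
  obtain ⟨F, hF, hfF⟩ := f.2
  obtain ⟨G, hG, hgG⟩ := g.2
  ext t
  have hFG : (dI (f * g)).1 t = deriv (F * G) t :=
    dI_apply (hF.mul hG) (fun t => congrArg₂ (· * ·) (hfF t) (hgG t)) t
  change (dI (f * g)).1 t = (dI f).1 t * g.1 t + f.1 t * (dI g).1 t
  rw [hFG, dI_apply hF hfF, dI_apply hG hgG, hfF, hgG]
  exact deriv_mul (hF.differentiable (by simp) t) (hG.differentiable (by simp) t)

theorem dI_one : dI 1 = 0 := by
  simpa using dI_mul 1 1

/-- The coordinate function on the interval. -/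
def coordI : smoothI :=
  ⟨fun t => t, fun t => t, contDiff_id, fun _ => rfl⟩

theorem evI_coordI (t : Set.Icc (0 : ℝ) 1) : evI t coordI = t :=
  rfl

/-- The integral over the interval. -/
def integralI : smoothI →ₗ[ℝ] ℝ where
  toFun f := ∫ t in (0 : ℝ)..1, Set.IccExtend zero_le_one f.1 t
  map_add' := by
    rintro ⟨f, F, hF, hfF⟩ ⟨g, G, hG, hgG⟩
    have hf : Continuous f :=
      (hF.continuous.comp continuous_subtype_val).congr fun t => (hfF t).symm
    have hg : Continuous g :=
      (hG.continuous.comp continuous_subtype_val).congr fun t => (hgG t).symm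
    exact intervalIntegral.integral_add (hf.Icc_extend'.intervalIntegrable _ _)
      (hg.Icc_extend'.intervalIntegrable _ _)
  map_smul' a _ := intervalIntegral.integral_smul a _

theorem integralI_dI (f : smoothI) : integralI (dI f) = evI 1 f - evI 0 f := by
  obtain ⟨F, hF, hfF⟩ := f.2
  calc integralI (dI f) = ∫ t in (0 : ℝ)..1, deriv F t := by
        refine intervalIntegral.integral_congr fun t ht => ?_
        rw [Set.uIcc_of_le zero_le_one] at ht
        exact (Set.IccExtend_of_mem _ _ ht).trans (dI_apply hF hfF ⟨t, ht⟩)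
    _ = F 1 - F 0 :=
        intervalIntegral.integral_deriv_eq_sub (fun t _ => hF.differentiable (by simp) t)
          ((hF.continuous_deriv (by simp)).intervalIntegrable _ _)
    _ = evI 1 f - evI 0 f := (congrArg₂ (· - ·) (hfF 1) (hfF 0)).symm

end Interval

namespace DGCA

section functionsI

variable {B : DGCA.{v}} {p q : ℕ} {x y : B.carrier ⊗[ℝ] smoothI}

theorem tmul_mem_grI {b : B.carrier} (hb : b ∈ B.gr p) (f : smoothI) : b ⊗ₜ[ℝ] f ∈ grI B p :=
  Submodule.subset_span ⟨b, hb, f, rfl⟩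

theorem grI_le {S : Submodule ℝ (B.carrier ⊗[ℝ] smoothI)}
    (h : ∀ b ∈ B.gr p, ∀ f : smoothI, b ⊗ₜ[ℝ] f ∈ S) : grI B p ≤ S := by
  refine Submodule.span_le.2 ?_
  rintro _ ⟨b, hb, f, rfl⟩
  exact h b hb f

theorem mul_mem_grI (hx : x ∈ grI B p) (hy : y ∈ grI B q) : x * y ∈ grI B (p + q) := by
  have hle : grI B p * grI B q ≤ grI B (p + q) := by
    rw [grI, grI, Submodule.span_mul_span, Submodule.span_le]
    rintro _ ⟨_, ⟨b, hb, f, rfl⟩, _, ⟨c, hc, g, rfl⟩, rfl⟩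
    change b ⊗ₜ[ℝ] f * c ⊗ₜ[ℝ] g ∈ grI B (p + q)
    rw [Algebra.TensorProduct.tmul_mul_tmul]
    exact tmul_mem_grI (B.mul_mem hb hc) (f * g)
  exact hle (Submodule.mul_mem_mul hx hy)

theorem comm_grI (hx : x ∈ grI B p) (hy : y ∈ grI B q) :
    x * y = (-1 : ℝ) ^ (p * q) • (y * x) := by
  induction hx, hy using Submodule.span_induction₂ with
  | mem_mem x y hx hy =>
    obtain ⟨b, hb, f, rfl⟩ := hx
    obtain ⟨c, hc, g, rfl⟩ := hy
    rw [Algebra.TensorProduct.tmul_mul_tmul, Algebra.TensorProduct.tmul_mul_tmul,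
      B.comm hb hc, mul_comm f g, TensorProduct.smul_tmul']
  | zero_left => simp
  | zero_right => simp
  | add_left x z y _ _ _ hx hz => rw [add_mul, mul_add, smul_add, hx, hz]
  | add_right x y z _ _ _ hy hz => rw [mul_add, add_mul, smul_add, hy, hz]
  | smul_left a x y _ _ h => rw [smul_mul_assoc, mul_smul_comm, h, smul_comm]
  | smul_right a x y _ _ h => rw [smul_mul_assoc, mul_smul_comm, h, smul_comm]

theorem map_d_leibniz (hx : x ∈ grI B p) (y : B.carrier ⊗[ℝ] smoothI) :
    TensorProduct.map B.d LinearMap.id (x * y) = TensorProduct.map B.d LinearMap.id x * y +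
      (-1 : ℝ) ^ p • (x * TensorProduct.map B.d LinearMap.id y) := by
  induction hx using Submodule.span_induction with
  | mem x hx =>
    obtain ⟨b, hb, f, rfl⟩ := hx
    induction y with
    | zero => simp
    | add y z hy hz => simp only [mul_add, map_add, hy, hz, smul_add]; abel
    | tmul c g =>
      simp only [Algebra.TensorProduct.tmul_mul_tmul, TensorProduct.map_tmul, B.leibniz hb,
        LinearMap.id_apply, TensorProduct.add_tmul, TensorProduct.smul_tmul']
  | zero => simp
  | add x z _ _ hx hz => simp only [add_mul, map_add, smul_add, hx, hz]; abel
  | smul a x _ h => simp only [smul_mul_assoc, map_smul, h, smul_add, smul_comm a]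

theorem map_dI_mul (x y : B.carrier ⊗[ℝ] smoothI) :
    TensorProduct.map LinearMap.id dI (x * y) =
      TensorProduct.map LinearMap.id dI x * y + x * TensorProduct.map LinearMap.id dI y := by
  induction x with
  | zero => simp
  | add x z hx hz => simp only [add_mul, map_add, hx, hz]; abel
  | tmul b f =>
    induction y with
    | zero => simp
    | add y z hy hz => simp only [mul_add, map_add, hy, hz]; abel
    | tmul c g =>
      simp only [Algebra.TensorProduct.tmul_mul_tmul, TensorProduct.map_tmul, dI_mul,
        LinearMap.id_apply, TensorProduct.tmul_add]

theorem map_dI_map_d (x : B.carrier ⊗[ℝ] smoothI) :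
    TensorProduct.map LinearMap.id dI (TensorProduct.map B.d LinearMap.id x) =
      TensorProduct.map B.d LinearMap.id (TensorProduct.map LinearMap.id dI x) := by
  rw [TensorProduct.map_map, TensorProduct.map_map]
  rfl

theorem restrictI_tmul (t : Set.Icc (0 : ℝ) 1) (b : B.carrier) (f : smoothI) :
    restrictI B t (b ⊗ₜ f) = evI t f • b := by
  refine (Algebra.TensorProduct.lift_tmul _ _ _ _ _).trans ?_
  rw [Algebra.smul_def, Algebra.commutes]
  rfl

theorem restrictI_mem (t : Set.Icc (0 : ℝ) 1) (hx : x ∈ grI B p) : restrictI B t x ∈ B.gr p := by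
  refine grI_le (S := (B.gr p).comap (restrictI B t).toLinearMap) (fun b hb f => ?_) hx
  change restrictI B t (b ⊗ₜ f) ∈ B.gr p
  rw [restrictI_tmul]
  exact Submodule.smul_mem _ _ hb

theorem restrictI_map_d (t : Set.Icc (0 : ℝ) 1) (x : B.carrier ⊗[ℝ] smoothI) :
    restrictI B t (TensorProduct.map B.d LinearMap.id x) = B.d (restrictI B t x) := by
  induction x with
  | zero => simp
  | add x y hx hy => simp only [map_add, hx, hy]
  | tmul b f => simp [restrictI_tmul]

end functionsI

variable (B : DGCA.{v})

/-- The algebra `B ⊗ C^∞([0,1])`, with the differential of `B`. -/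
def functionsI : DGCA.{v} where
  carrier := B.carrier ⊗[ℝ] smoothI
  gr := grI B
  d := TensorProduct.map B.d LinearMap.id
  one_mem := tmul_mem_grI B.one_mem 1
  mul_mem := mul_mem_grI
  comm := comm_grI
  d_mem hx := grI_le (S := (grI B _).comap (TensorProduct.map B.d LinearMap.id))
    (fun _ hb f => tmul_mem_grI (B.d_mem hb) f) hx
  leibniz := map_d_leibniz
  d_d x := by
    induction x with
    | zero => simp
    | add x y hx hy => simp only [map_add, hx, hy, add_zero]
    | tmul b f => simp [B.d_d]

/-- The derivative along the interval. -/
def derivI : ParamDeriv B.functionsI where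
  D := TensorProduct.map LinearMap.id dI
  mem hx := grI_le (S := (grI B _).comap (TensorProduct.map LinearMap.id dI))
    (fun _ hb f => tmul_mem_grI hb (dI f)) hx
  mul := map_dI_mul
  comm_d := map_dI_map_d

/-- The path object `B ⊗ Ω•([0,1])`. -/
def path : DGCA.{v} :=
  B.functionsI.adjoinDt B.derivI

/-- The restriction `B ⊗ Ω•([0,1]) → B` to a point of the interval. -/
def evPath (t : Set.Icc (0 : ℝ) 1) : DGHom B.path B :=
  DGHom.comp (A := B.path) (B := B.functionsI)
    { toAlgHom := restrictI B t
      map_gr := fun _ _ => restrictI_mem t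
      map_d := restrictI_map_d t }
    (B.functionsI.killDt B.derivI)

variable {B}

theorem concordant_evPath {A : DGCA.{u}} (F : DGHom A B.path) :
    Concordant ((B.evPath 0).comp F) ((B.evPath 1).comp F) :=
  ⟨{  α := ((B.functionsI.killDt B.derivI).comp F).toAlgHom
      ρ := B.functionsI.dtPart B.derivI ∘ₗ F.toAlgHom.toLinearMap
      α_mem := fun _ _ => ((B.functionsI.killDt B.derivI).comp F).apply_mem
      ρ_mem := fun _ _ hx => dtPart_mem (F.apply_mem hx)
      ρ_zero := fun _ hx => dtPart_mem (F.apply_mem hx)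
      ρ_mul := fun _ x y hx => by
        change B.functionsI.dtPart B.derivI (F.toAlgHom (x * y)) = _
        rw [map_mul]
        exact dtPart_mul (F.apply_mem hx) _
      α_d := ((B.functionsI.killDt B.derivI).comp F).apply_d
      ρ_d := fun x => by
        change _ = _ + B.functionsI.dtPart B.derivI (F (A.d x))
        rw [F.apply_d]
        exact (add_sub_cancel _ _).symm
      at_zero := fun _ => rfl
      at_one := fun _ => rfl }⟩

end DGCA

section fiberIntegral

variable {B : DGCA.{v}}

variable (B) in
/-- The integration `B ⊗ C^∞([0,1]) → B` over the interval. -/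
def fiberIntegral : B.carrier ⊗[ℝ] smoothI →ₗ[ℝ] B.carrier :=
  (TensorProduct.rid ℝ B.carrier).toLinearMap ∘ₗ TensorProduct.map LinearMap.id integralI

theorem fiberIntegral_tmul (b : B.carrier) (f : smoothI) :
    fiberIntegral B (b ⊗ₜ f) = integralI f • b := by
  simp [fiberIntegral]

theorem fiberIntegral_mem {p : ℕ} {x : B.carrier ⊗[ℝ] smoothI} (hx : x ∈ grI B p) :
    fiberIntegral B x ∈ B.gr p := by
  refine DGCA.grI_le (S := (B.gr p).comap (fiberIntegral B)) (fun b hb f => ?_) hx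
  change fiberIntegral B (b ⊗ₜ f) ∈ B.gr p
  rw [fiberIntegral_tmul]
  exact Submodule.smul_mem _ _ hb

theorem fiberIntegral_map_d (x : B.carrier ⊗[ℝ] smoothI) :
    fiberIntegral B (TensorProduct.map B.d LinearMap.id x) = B.d (fiberIntegral B x) := by
  induction x with
  | zero => simp
  | add x y hx hy => simp only [map_add, hx, hy]
  | tmul b f => simp [fiberIntegral_tmul]

theorem fiberIntegral_map_dI (x : B.carrier ⊗[ℝ] smoothI) :
    fiberIntegral B (TensorProduct.map LinearMap.id dI x) =
      restrictI B 1 x - restrictI B 0 x := by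
  induction x with
  | zero => simp
  | add x y hx hy => simp only [map_add, hx, hy]; abel
  | tmul b f =>
    rw [TensorProduct.map_tmul, fiberIntegral_tmul, DGCA.restrictI_tmul, DGCA.restrictI_tmul,
      integralI_dI, sub_smul]
    rfl

end fiberIntegral

section Concordant

variable {A : DGCA.{u}} {B : DGCA.{v}} {φ ψ : DGHom A B}

theorem Concordant.cochainHomotopic (h : Concordant φ ψ) : CochainHomotopic φ ψ := by
  obtain ⟨η⟩ := h
  refine ⟨fiberIntegral B ∘ₗ η.ρ, fun x hx => ?_, fun p x hx => fiberIntegral_mem (η.ρ_mem p x hx),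
    fun x => ?_⟩
  · rw [LinearMap.comp_apply, η.ρ_zero x hx, map_zero]
  · rw [LinearMap.comp_apply, LinearMap.comp_apply, ← fiberIntegral_map_d, ← map_add, ← η.ρ_d,
      fiberIntegral_map_dI, η.at_zero, η.at_one]

theorem Concordant.refl (φ : DGHom A B) : Concordant φ φ :=
  ⟨{  α := (Algebra.TensorProduct.includeLeft (R := ℝ) (S := ℝ) (B := smoothI)).comp φ.toAlgHom
      ρ := 0
      α_mem := fun _ _ hx => DGCA.tmul_mem_grI (φ.apply_mem hx) 1
      ρ_mem := fun _ _ _ => zero_mem _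
      ρ_zero := fun _ _ => rfl
      ρ_mul := by simp
      α_d := fun x => congrArg (· ⊗ₜ[ℝ] (1 : smoothI)) (φ.apply_d x)
      ρ_d := fun x => by
        change φ x ⊗ₜ[ℝ] dI 1 = _
        simp [dI_one]
      at_zero := fun x => (DGCA.restrictI_tmul 0 (φ x) 1).trans (by rw [map_one, one_smul])
      at_one := fun x => (DGCA.restrictI_tmul 1 (φ x) 1).trans (by rw [map_one, one_smul]) }⟩

theorem IsWeakInverse.of_comp_eq_id {ψ : DGHom B A} (h : ψ.comp φ = DGHom.id A)
    (h' : Concordant (φ.comp ψ) (DGHom.id B)) : IsWeakInverse φ ψ :=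
  have h'' : Concordant (ψ.comp φ) (DGHom.id A) := h ▸ Concordant.refl _
  ⟨h'', h', h''.cochainHomotopic, h'.cochainHomotopic⟩

end Concordant

namespace DGCA

section withoutDtLift

variable {F : DGCA.{v}} {δ : ParamDeriv F} {ι : Type} {deg : ι → ℕ}
  (α : FGC deg →ₐ[ℝ] F.carrier) (hα : ∀ i, α (FGC.gen deg i) ∈ F.gr (deg i))

variable (δ) in
/-- A degree-preserving algebra map `α` out of a free algebra, as a map into the elements
without `dt` of `F.adjoinDt δ`. -/
def withoutDtLift : FGC deg →ₐ[ℝ] (F.adjoinDt δ).carrier :=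
  FGC.liftGr (fun i => F.withoutDt δ (deg i) (α (FGC.gen deg i))) fun i => withoutDt_mem (hα i)

theorem withoutDtLift_gen (i : ι) : withoutDtLift δ α hα (FGC.gen deg i) =
    F.withoutDt δ (deg i) (α (FGC.gen deg i)) :=
  FGC.liftGr_gen _ _ _

theorem withoutDtLift_gen_mem (i : ι) :
    withoutDtLift δ α hα (FGC.gen deg i) ∈ (F.adjoinDt δ).gr (deg i) := by
  rw [withoutDtLift_gen]
  exact withoutDt_mem (hα i)

theorem withoutDtLift_apply {p : ℕ} {x : FGC deg} (hx : x ∈ FGC.gr deg p) :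
    withoutDtLift δ α hα x = F.withoutDt δ p (α x) := by
  induction hx using Submodule.span_induction with
  | mem x hx =>
    obtain ⟨l, rfl, rfl⟩ := hx
    induction l with
    | nil => simp [withoutDt_one]
    | cons i l ih =>
      rw [FGC.mon_cons, map_mul, map_mul, ih, withoutDtLift_gen, List.map_cons, List.sum_cons,
        withoutDt_mul]
  | zero => simp [withoutDt_zero]
  | add y z _ _ hy hz => rw [map_add, map_add, withoutDt_add, hy, hz]
  | smul a y _ hy => rw [map_smul, map_smul, withoutDt_smul, hy]

end withoutDtLift

variable {B : DGCA.{v}}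

/-- The straight line from `x` to `y`. -/
def segment (x y : B.carrier) : B.carrier ⊗[ℝ] smoothI :=
  x ⊗ₜ 1 + (y - x) ⊗ₜ coordI

theorem segment_self (x : B.carrier) : segment x x = x ⊗ₜ 1 := by
  simp [segment]

theorem segment_mem {p : ℕ} {x y : B.carrier} (hx : x ∈ B.gr p) (hy : y ∈ B.gr p) :
    segment x y ∈ grI B p :=
  add_mem (tmul_mem_grI hx 1) (tmul_mem_grI (sub_mem hy hx) coordI)

theorem restrictI_zero_segment (x y : B.carrier) : restrictI B 0 (segment x y) = x := by
  simp [segment, restrictI_tmul, evI_coordI]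

theorem restrictI_one_segment (x y : B.carrier) : restrictI B 1 (segment x y) = y := by
  simp [segment, restrictI_tmul, evI_coordI]

end DGCA

namespace NormalSub

variable {h g : LInfty} (t : NormalSub h g) {B : DGCA.{v}} (φ ψ : DGHom t.cone.CE B)

theorem hom_inl_mem (i : g.ι) : φ (t.cone.gen (Sum.inl i)) ∈ B.gr (g.deg i) :=
  φ.apply_mem (FGC.gen_mem (deg := t.cone.deg) (Sum.inl i))

/-- The straight line from `φ` to `ψ` on the generators `𝔤*`. -/
def segmentAlgHom : FGC g.deg →ₐ[ℝ] B.functionsI.carrier :=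
  FGC.liftGr
    (fun i => DGCA.segment (φ (t.cone.gen (Sum.inl i))) (ψ (t.cone.gen (Sum.inl i))))
    fun i => DGCA.segment_mem (t.hom_inl_mem φ i) (t.hom_inl_mem ψ i)

theorem segmentAlgHom_gen (i : g.ι) : t.segmentAlgHom φ ψ (g.gen i) =
    DGCA.segment (φ (t.cone.gen (Sum.inl i))) (ψ (t.cone.gen (Sum.inl i))) :=
  FGC.liftGr_gen _ _ _

theorem segmentAlgHom_gen_mem (i : g.ι) :
    t.segmentAlgHom φ ψ (g.gen i) ∈ B.functionsI.gr (g.deg i) := by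
  rw [segmentAlgHom_gen]
  exact DGCA.segment_mem (t.hom_inl_mem φ i) (t.hom_inl_mem ψ i)

variable {φ ψ}

theorem segmentAlgHom_of_mem_adjoin
    (hφψ : ∀ i ∉ Set.range t.s, φ (t.cone.gen (Sum.inl i)) = ψ (t.cone.gen (Sum.inl i)))
    {x : FGC g.deg} (hx : x ∈ Algebra.adjoin ℝ (g.gen '' (Set.range t.s)ᶜ)) :
    t.segmentAlgHom φ ψ x = φ (t.coneIncl x) ⊗ₜ 1 := by
  refine AlgHom.eqOn_adjoin_iff (φ := t.segmentAlgHom φ ψ)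
    (ψ := Algebra.TensorProduct.includeLeft.comp (φ.toAlgHom.comp t.coneIncl)) |>.2 ?_ hx
  rintro _ ⟨i, hi, rfl⟩
  refine (t.segmentAlgHom_gen φ ψ i).trans ?_
  rw [← hφψ i hi, DGCA.segment_self, ← coneIncl_gen]
  rfl

variable (φ ψ) in
/-- The straight line from `φ` to `ψ`, in the path object. -/
def segmentPath : FGC g.deg →ₐ[ℝ] B.path.carrier :=
  DGCA.withoutDtLift B.derivI (t.segmentAlgHom φ ψ) (t.segmentAlgHom_gen_mem φ ψ)

theorem segmentPath_gen_mem (i : g.ι) : t.segmentPath φ ψ (g.gen i) ∈ B.path.gr (g.deg i) :=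
  DGCA.withoutDtLift_gen_mem _ _ i

theorem segmentPath_apply {p : ℕ} {x : FGC g.deg} (hx : x ∈ FGC.gr g.deg p) :
    t.segmentPath φ ψ x = B.functionsI.withoutDt B.derivI p (t.segmentAlgHom φ ψ x) :=
  DGCA.withoutDtLift_apply _ _ hx

/-- The line is constant on the generators outside `𝔥*`, and on their differentials because `𝔥`
is normal. -/
theorem segmentPath_d_gen
    (hφψ : ∀ i ∉ Set.range t.s, φ (t.cone.gen (Sum.inl i)) = ψ (t.cone.gen (Sum.inl i)))
    (i : g.ι) (hi : i ∉ Set.range t.s) :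
    t.segmentPath φ ψ (g.d (g.gen i)) = B.path.d (t.segmentPath φ ψ (g.gen i)) := by
  have hmem : g.gen i ∈ Algebra.adjoin ℝ (g.gen '' (Set.range t.s)ᶜ) :=
    Algebra.subset_adjoin ⟨i, hi, rfl⟩
  have hconst : B.derivI.D (t.segmentAlgHom φ ψ (g.gen i)) = 0 := by
    rw [t.segmentAlgHom_of_mem_adjoin hφψ hmem]
    change φ (t.coneIncl (g.gen i)) ⊗ₜ[ℝ] dI 1 = 0
    rw [dI_one, TensorProduct.tmul_zero]
  have hchain : t.segmentAlgHom φ ψ (g.d (g.gen i)) =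
      B.functionsI.d (t.segmentAlgHom φ ψ (g.gen i)) := by
    rw [t.segmentAlgHom_of_mem_adjoin hφψ (t.normal i hi),
      t.segmentAlgHom_of_mem_adjoin hφψ hmem, ← t.cone_d_incl_of_mem_adjoin hmem]
    exact congrArg (· ⊗ₜ[ℝ] (1 : smoothI)) (φ.apply_d _)
  rw [t.segmentPath_apply (LInfty.d_gen_mem i), t.segmentPath_apply (LInfty.gen_mem i), hchain]
  exact (DGCA.d_withoutDt _ hconst).symm

/-- The line as a morphism: out of the mapping cone only the differentials of the generators
outside `𝔥*` have to be respected. -/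
def segmentHom
    (hφψ : ∀ i ∉ Set.range t.s, φ (t.cone.gen (Sum.inl i)) = ψ (t.cone.gen (Sum.inl i))) :
    DGHom t.cone.CE B.path :=
  t.coneLift (t.segmentPath φ ψ) t.segmentPath_gen_mem (t.segmentPath_d_gen hφψ)

theorem evPath_segmentHom
    (hφψ : ∀ i ∉ Set.range t.s, φ (t.cone.gen (Sum.inl i)) = ψ (t.cone.gen (Sum.inl i)))
    (s : Set.Icc (0 : ℝ) 1) (i : g.ι) :
    B.evPath s (t.segmentHom hφψ (t.cone.gen (Sum.inl i))) = restrictI B s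
      (DGCA.segment (φ (t.cone.gen (Sum.inl i))) (ψ (t.cone.gen (Sum.inl i)))) := by
  rw [segmentHom, coneLift_inl, t.segmentPath_apply (LInfty.gen_mem i), segmentAlgHom_gen]
  rfl

theorem cone_concordant
    (hφψ : ∀ i ∉ Set.range t.s, φ (t.cone.gen (Sum.inl i)) = ψ (t.cone.gen (Sum.inl i))) :
    Concordant φ ψ := by
  have hzero : (B.evPath 0).comp (t.segmentHom hφψ) = φ := t.cone_hom_ext fun i =>
    (t.evPath_segmentHom hφψ 0 i).trans (DGCA.restrictI_zero_segment _ _)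
  have hone : (B.evPath 1).comp (t.segmentHom hφψ) = ψ := t.cone_hom_ext fun i =>
    (t.evPath_segmentHom hφψ 1 i).trans (DGCA.restrictI_one_segment _ _)
  simpa only [hzero, hone] using DGCA.concordant_evPath (t.segmentHom hφψ)

end NormalSub

namespace LInfty

variable {B : DGCA.{v}} {k : ℕ} {hk : 0 < k}

theorem line_d_gen : (line k hk).d ((line k hk).gen ()) = 0 :=
  ofGen_d_gen _ _ _ _ _ _

theorem d_hom_line (φ : DGHom (line k hk).CE B) : B.d (φ ((line k hk).gen ())) = 0 :=
  (φ.apply_d _).symm.trans ((congrArg φ line_d_gen).trans (map_zero φ.toAlgHom))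

variable (hk) in
/-- The morphism out of `CE(b^{k-1}𝔲(1))` given by a closed element. -/
def lineHom (b : B.carrier) (hb : b ∈ B.gr k) (hd : B.d b = 0) : DGHom (line k hk).CE B :=
  homOfGens (FGC.liftGr (deg := (line k hk).deg) (fun _ => b) fun _ => hb)
    (fun i => (FGC.liftGr_gen (deg := (line k hk).deg) _ (fun _ => hb) i).symm ▸ hb)
    fun i => by
      rw [show (line k hk).d ((line k hk).gen i) = 0 from line_d_gen, map_zero]
      exact ((congrArg B.d (FGC.liftGr_gen _ _ i)).trans hd).symm

theorem lineHom_gen {b : B.carrier} (hb : b ∈ B.gr k) (hd : B.d b = 0) :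
    lineHom hk b hb hd ((line k hk).gen ()) = b :=
  FGC.liftGr_gen (deg := (line k hk).deg) _ (fun _ => hb) ()

theorem hom_line_mem (φ : DGHom (line k hk).CE B) : φ ((line k hk).gen ()) ∈ B.gr k :=
  φ.apply_mem (FGC.gen_mem (deg := (line k hk).deg) ())

end LInfty

namespace DGCA

variable {B : DGCA.{v}}

/-- An element of degree `p` of `B`, as a constant element of the path object. -/
def constPath (p : ℕ) (x : B.carrier) : B.path.carrier :=
  B.functionsI.withoutDt B.derivI p (x ⊗ₜ 1)

theorem constPath_mem {p : ℕ} {x : B.carrier} (hx : x ∈ B.gr p) : constPath p x ∈ B.path.gr p :=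
  withoutDt_mem (tmul_mem_grI hx 1)

theorem d_constPath (p : ℕ) (x : B.carrier) :
    B.path.d (constPath p x) = constPath (p + 1) (B.d x) := by
  refine d_withoutDt p ?_
  change x ⊗ₜ[ℝ] dI 1 = 0
  rw [dI_one, TensorProduct.tmul_zero]

theorem constPath_zero (p : ℕ) : constPath p (0 : B.carrier) = 0 :=
  (congrArg (B.functionsI.withoutDt B.derivI p) (TensorProduct.zero_tmul _ _)).trans
    (withoutDt_zero p)

theorem evPath_constPath (t : Set.Icc (0 : ℝ) 1) (p : ℕ) (x : B.carrier) :
    B.evPath t (constPath p x) = x := by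
  change restrictI B t (x ⊗ₜ 1) = x
  rw [restrictI_tmul, map_one, one_smul]

end DGCA

namespace LInfty

variable {B : DGCA.{v}} {n : ℕ} {hn : 0 < n + 1} {φ ψ : DGHom (line (n + 1) hn).CE B}

/-- The interpolating closed element of the path object is `φ(h) + d(tβ)`. -/
theorem concordant_line_of_d_eq {β : B.carrier} (hβ : β ∈ B.gr n)
    (hd : B.d β = ψ ((line (n + 1) hn).gen ()) - φ ((line (n + 1) hn).gen ())) :
    Concordant φ ψ := by
  let base := DGCA.constPath (n + 1) (φ ((line (n + 1) hn).gen ()))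
  let ramp : B.path.carrier := B.functionsI.withoutDt B.derivI n (DGCA.segment 0 β)
  have hramp : ramp ∈ B.path.gr n := DGCA.withoutDt_mem (DGCA.segment_mem (zero_mem _) hβ)
  have hclosed : B.path.d (base + B.path.d ramp) = 0 := by
    rw [map_add, DGCA.d_constPath, d_hom_line, DGCA.constPath_zero, B.path.d_d, add_zero]
  let path := lineHom hn (base + B.path.d ramp)
    (add_mem (DGCA.constPath_mem (hom_line_mem φ)) (B.path.d_mem hramp)) hclosed
  have hev (t : Set.Icc (0 : ℝ) 1) : (B.evPath t).comp path ((line (n + 1) hn).gen ()) =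
      φ ((line (n + 1) hn).gen ()) + B.d (restrictI B t (DGCA.segment 0 β)) := by
    refine (congrArg (B.evPath t) (lineHom_gen _ hclosed)).trans ?_
    refine (map_add (B.evPath t).toAlgHom _ _).trans ?_
    exact congrArg₂ (· + ·) (DGCA.evPath_constPath t _ _) ((B.evPath t).apply_d ramp)
  have hzero : (B.evPath 0).comp path = φ := hom_ext fun _ => (hev 0).trans <| by
    rw [DGCA.restrictI_zero_segment, map_zero, add_zero]; rfl
  have hone : (B.evPath 1).comp path = ψ := hom_ext fun _ => (hev 1).trans <| by
    rw [DGCA.restrictI_one_segment, hd, add_sub_cancel]; rfl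
  simpa only [hzero, hone] using DGCA.concordant_evPath path

theorem concordant_line_iff : Concordant φ ψ ↔
    ∃ β ∈ B.gr n, B.d β = ψ ((line (n + 1) hn).gen ()) - φ ((line (n + 1) hn).gen ()) := by
  refine ⟨fun h => ?_, fun ⟨β, hβ, hd⟩ => concordant_line_of_d_eq hβ hd⟩
  obtain ⟨τ, -, hτ, hτ_d⟩ := h.cochainHomotopic
  refine ⟨τ ((line (n + 1) hn).gen ()), hτ n _ (gen_mem (g := line (n + 1) hn) ()), ?_⟩
  refine Eq.symm ((hτ_d _).trans ?_)
  rw [show (line (n + 1) hn).CE.d ((line (n + 1) hn).gen ()) = 0 from line_d_gen, map_zero,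
    add_zero]

theorem isTrivial_line_iff :
    IsTrivial φ ↔ ∃ β ∈ B.gr n, B.d β = φ ((line (n + 1) hn).gen ()) := by
  constructor
  · rintro ⟨φ₀, hφ₀, h⟩
    simpa only [show φ₀ ((line (n + 1) hn).gen ()) = 0 from hφ₀ (), sub_zero] using
      concordant_line_iff.1 h
  · rintro ⟨β, hβ, hd⟩
    have hzero := lineHom_gen (hk := hn) (zero_mem (B.gr (n + 1))) (map_zero B.d)
    refine ⟨lineHom hn 0 (zero_mem _) (map_zero _), fun _ => hzero,
      concordant_line_of_d_eq hβ ?_⟩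
    rw [hd, hzero, sub_zero]

end LInfty

namespace LInfty

section addGenExtend

variable {g : LInfty} {n : ℕ} {hn : 0 < n} {z : FGC g.deg} {hz : z ∈ FGC.gr g.deg (n + 1)}
  {hdz : g.d z = 0} {B : DGCA.{v}}

theorem addGenHom_gen (i : g.ι) :
    g.addGenHom n hn z hz hdz (g.gen i) = (g.addGen n hn z hz hdz).gen (Sum.inl i) :=
  g.addGenIncl_gen n hn z hz hdz i

variable (hn z hz hdz) (φ : FGC g.deg →ₐ[ℝ] B.carrier)
  (hφ : ∀ i, φ (g.gen i) ∈ B.gr (g.deg i)) {β : B.carrier} (hβ : β ∈ B.gr n)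

/-- The extension of a degree-preserving algebra map by the value `β` on the added generator. -/
def addGenExtend : FGC (g.addGen n hn z hz hdz).deg →ₐ[ℝ] B.carrier :=
  FGC.liftGr (Sum.elim (fun i => φ (g.gen i)) fun _ => β) (Sum.rec hφ fun _ => hβ)

theorem addGenExtend_inl (i : g.ι) :
    addGenExtend hn z hz hdz φ hφ hβ ((g.addGen n hn z hz hdz).gen (Sum.inl i)) = φ (g.gen i) :=
  FGC.liftGr_gen _ _ _

theorem addGenExtend_inr :
    addGenExtend hn z hz hdz φ hφ hβ ((g.addGen n hn z hz hdz).gen (Sum.inr ())) = β :=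
  FGC.liftGr_gen _ _ _

theorem addGenExtend_incl (x : FGC g.deg) :
    addGenExtend hn z hz hdz φ hφ hβ (g.addGenIncl n hn z hz hdz x) = φ x := by
  refine DFunLike.congr_fun (FGC.algHom_ext
    (f := (addGenExtend hn z hz hdz φ hφ hβ).comp (g.addGenIncl n hn z hz hdz)) fun i => ?_) x
  exact (congrArg _ (g.addGenIncl_gen n hn z hz hdz i)).trans
    (addGenExtend_inl hn z hz hdz φ hφ hβ i)

theorem addGenExtend_gen_mem (i : (g.addGen n hn z hz hdz).ι) :
    addGenExtend hn z hz hdz φ hφ hβ ((g.addGen n hn z hz hdz).gen i) ∈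
      B.gr ((g.addGen n hn z hz hdz).deg i) := by
  rcases i with i | _
  · exact (addGenExtend_inl hn z hz hdz φ hφ hβ i).symm ▸ hφ i
  · exact (addGenExtend_inr hn z hz hdz φ hφ hβ).symm ▸ hβ

theorem addGenExtend_d_gen (hd : ∀ x, φ (g.d x) = B.d (φ x)) (hβz : B.d β = φ z)
    (i : (g.addGen n hn z hz hdz).ι) :
    addGenExtend hn z hz hdz φ hφ hβ
        ((g.addGen n hn z hz hdz).d ((g.addGen n hn z hz hdz).gen i)) =
      B.d (addGenExtend hn z hz hdz φ hφ hβ ((g.addGen n hn z hz hdz).gen i)) := by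
  rcases i with i | _
  · rw [addGenExtend_inl, ← addGenIncl_gen, addGen_d_incl, addGenExtend_incl, hd]
  · rw [addGenExtend_inr, addGen_d_gen, addGenExtend_incl, hβz]

variable (g) in
/-- The retraction of `CE(𝔤)` with an added generator onto `CE(𝔤)` which kills the added
generator. It is not a chain map. -/
def addGenRetract : FGC (g.addGen n hn z hz hdz).deg →ₐ[ℝ] FGC g.deg :=
  addGenExtend (B := g.CE) hn z hz hdz (AlgHom.id ℝ (FGC g.deg)) gen_mem (zero_mem (g.CE.gr n))

theorem addGenRetract_inl (i : g.ι) :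
    g.addGenRetract hn z hz hdz ((g.addGen n hn z hz hdz).gen (Sum.inl i)) = g.gen i :=
  addGenExtend_inl (B := g.CE) ..

theorem addGenRetract_inr :
    g.addGenRetract hn z hz hdz ((g.addGen n hn z hz hdz).gen (Sum.inr ())) = 0 :=
  addGenExtend_inr (B := g.CE) ..

theorem addGenRetract_incl (x : FGC g.deg) :
    g.addGenRetract hn z hz hdz (g.addGenIncl n hn z hz hdz x) = x :=
  addGenExtend_incl (B := g.CE) ..

theorem addGenRetract_gen_mem (i : (g.addGen n hn z hz hdz).ι) :
    g.addGenRetract hn z hz hdz ((g.addGen n hn z hz hdz).gen i) ∈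
      FGC.gr g.deg ((g.addGen n hn z hz hdz).deg i) :=
  addGenExtend_gen_mem (B := g.CE) _ _ _ _ _ gen_mem (zero_mem _) i

end addGenExtend

end LInfty

namespace NormalSub

/-- A presentation of the quotient `𝔨 = 𝔤/𝔥` inside `𝔤`: the sub-dgca `CE(𝔨)` generated by the
generators outside `𝔥*`, and the retraction onto it, as a graded algebra, which kills `𝔥*`. -/
structure Quotient {h g : LInfty} (t : NormalSub h g) (k : LInfty) where
  incl : DGHom k.CE g.CE
  retract : FGC g.deg →ₐ[ℝ] FGC k.deg
  incl_mem : ∀ i, incl (k.gen i) ∈ Algebra.adjoin ℝ (g.gen '' (Set.range t.s)ᶜ)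
  retract_mem : ∀ i, retract (g.gen i) ∈ FGC.gr k.deg (g.deg i)
  retract_incl : ∀ x, retract (incl x) = x
  incl_retract : ∀ i ∉ Set.range t.s, incl (retract (g.gen i)) = g.gen i
  retract_s : ∀ x, retract (g.gen (t.s x)) = 0

namespace Quotient

variable {h g k : LInfty} {t : NormalSub h g} (q : t.Quotient k)

theorem incl_mem_adjoin (x : FGC k.deg) :
    q.incl x ∈ Algebra.adjoin ℝ (g.gen '' (Set.range t.s)ᶜ) :=
  (FGC.subalgebra_eq_top (S := (Algebra.adjoin ℝ _).comap q.incl.toAlgHom) q.incl_mem).ge trivial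

/-- The morphism `CE(𝔤/𝔥) → CE(𝔥 ↪ 𝔤)`. -/
def toCone : DGHom k.CE t.cone.CE :=
  t.inclCone q.incl q.incl_mem

theorem toCone_gen {i : k.ι} {j : g.ι} (hij : q.incl (k.gen i) = g.gen j) :
    q.toCone (k.gen i) = t.cone.gen (Sum.inl j) :=
  (congrArg t.coneIncl hij).trans (t.coneIncl_gen j)

theorem retract_d_gen (i : g.ι) (hi : i ∉ Set.range t.s) :
    q.retract (g.d (g.gen i)) = k.d (q.retract (g.gen i)) := by
  conv_lhs => rw [← q.incl_retract i hi]
  exact (congrArg q.retract (q.incl.apply_d _).symm).trans (q.retract_incl _)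

/-- The morphism `CE(𝔥 ↪ 𝔤) → CE(𝔤/𝔥)` which kills `𝔥*`. -/
def ofCone : DGHom t.cone.CE k.CE :=
  t.coneLift (B := k.CE) q.retract q.retract_mem q.retract_d_gen

theorem ofCone_inl (i : g.ι) : q.ofCone (t.cone.gen (Sum.inl i)) = q.retract (g.gen i) :=
  t.coneLift_inl (B := k.CE) _ _ _ i

theorem ofCone_inr (x : h.ι) :
    q.ofCone (t.cone.gen (Sum.inr x)) = -q.retract (g.d (g.gen (t.s x))) := by
  refine (t.coneLift_inr (B := k.CE) _ _ _ x).trans ?_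
  change k.d (q.retract _) - q.retract _ = _
  rw [q.retract_s, map_zero, zero_sub]

theorem ofCone_comp_toCone : q.ofCone.comp q.toCone = DGHom.id k.CE :=
  DGHom.ext_apply fun x => (t.coneLift_incl (B := k.CE) _ _ _ _).trans (q.retract_incl x)

/-- The two endomorphisms of the cone agree on the generators outside `𝔥*`, so they are
concordant. -/
theorem isWeakInverse : IsWeakInverse q.toCone q.ofCone := by
  refine .of_comp_eq_id q.ofCone_comp_toCone (t.cone_concordant fun i hi => ?_)
  refine (congrArg q.toCone (q.ofCone_inl i)).trans ?_
  exact (congrArg t.coneIncl (q.incl_retract i hi)).trans (t.coneIncl_gen i)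

end Quotient

variable {h g : LInfty} (t : NormalSub h g)

theorem cone_d_inr_of_d_eq {x y : h.ι} {z : FGC g.deg}
    (hz : z ∈ Algebra.adjoin ℝ (g.gen '' (Set.range t.s)ᶜ))
    (hx : g.d (g.gen (t.s x)) = g.gen (t.s y) - z) :
    t.cone.d (t.cone.gen (Sum.inr x)) = -t.cone.gen (Sum.inr y) := by
  have hd : g.d z = g.d (g.gen (t.s y)) :=
    (sub_eq_zero.1 ((map_sub g.d _ _).symm.trans (hx ▸ g.d_d _))).symm
  rw [cone_d_inr, hx, map_sub, map_sub, coneIncl_gen, cone_d_inl,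
    t.cone_d_incl_of_mem_adjoin hz, hd, add_sub_cancel_left]

end NormalSub

namespace LInfty

theorem W_hom_ext {g : LInfty} {B : DGCA.{v}} {φ ψ : DGHom g.W B}
    (h : ∀ i, φ (g.inn.gen (Sum.inl i)) = ψ (g.inn.gen (Sum.inl i))) : φ = ψ :=
  (NormalSub.refl g).cone_hom_ext h

section weilLift

variable {g : LInfty} {B : DGCA.{v}} (φ : FGC g.deg →ₐ[ℝ] B.carrier)
  (hφ : ∀ i, φ (g.gen i) ∈ B.gr (g.deg i))

/-- The universal property of the Weil algebra: a morphism out of it is a degree-preserving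
algebra map on `∧•(𝔤*)`. -/
def weilLift : DGHom g.W B :=
  (NormalSub.refl g).coneLift φ hφ fun i hi => absurd ⟨i, rfl⟩ hi

theorem weilLift_inl (i : g.ι) : weilLift φ hφ (g.inn.gen (Sum.inl i)) = φ (g.gen i) :=
  (NormalSub.refl g).coneLift_inl φ hφ _ i

end weilLift

section line

variable {k : ℕ} (hk : 0 < k) {B : DGCA.{v}} (b : B.carrier) (hb : b ∈ B.gr k)

theorem line_inn_d_inl : (line k hk).inn.d ((line k hk).inn.gen (Sum.inl ())) =
    (line k hk).inn.gen (Sum.inr ()) := by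
  refine ((line k hk).inn_d_inl ()).trans ?_
  rw [line_d_gen, map_zero]
  exact zero_add _

/-- The morphism out of `W(b^{k-1}𝔲(1))` given by an element. -/
def lineWeilHom : DGHom (line k hk).W B :=
  weilLift (FGC.liftGr (deg := (line k hk).deg) (fun _ => b) fun _ => hb) fun i =>
    (FGC.liftGr_gen (deg := (line k hk).deg) _ (fun _ => hb) i).symm ▸ hb

theorem lineWeilHom_inl : lineWeilHom hk b hb ((line k hk).inn.gen (Sum.inl ())) = b :=
  (weilLift_inl _ _ _).trans (FGC.liftGr_gen (deg := (line k hk).deg) _ (fun _ => hb) ())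

theorem lineWeilHom_inr : lineWeilHom hk b hb ((line k hk).inn.gen (Sum.inr ())) = B.d b := by
  rw [← line_inn_d_inl]
  exact ((lineWeilHom hk b hb).apply_d _).trans (congrArg B.d (lineWeilHom_inl hk b hb))

end line

end LInfty

namespace Transgression

variable {g : LInfty} {n : ℕ} (T : Transgression g n) (hn : 0 < n)

section CE

theorem stringIncl_gen (i : g.ι) :
    T.stringIncl hn (g.gen i) = (T.stringExt hn).gen (Sum.inl i) :=
  LInfty.addGenHom_gen i

theorem stringExt_d_b : (T.stringExt hn).d ((T.stringExt hn).gen (Sum.inr ())) =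
    T.stringIncl hn (-T.μ) :=
  g.addGen_d_gen n hn _ _ _

/-- The quotient of `𝔤_μ` by `b^{n-1}𝔲(1)` is `𝔤`. -/
def stringQuotient : (T.stringSub hn).Quotient g where
  incl := T.stringIncl hn
  retract := g.addGenRetract hn _ _ _
  incl_mem _ := g.addGenIncl_adjoin n hn _ _ _ _ _ fun _ ⟨_, h⟩ => Sum.inr_ne_inl h
  retract_mem := LInfty.addGenRetract_gen_mem hn _ _ _
  retract_incl := LInfty.addGenRetract_incl hn _ _ _
  incl_retract
    | Sum.inl i, _ => (congrArg _ (LInfty.addGenRetract_inl hn _ _ _ i)).trans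
        (T.stringIncl_gen hn i)
    | Sum.inr (), hi => absurd ⟨(), rfl⟩ hi
  retract_s _ := LInfty.addGenRetract_inr hn _ _ _

theorem toCone_stringQuotient_gen (i : g.ι) :
    (T.stringQuotient hn).toCone (g.gen i) = T.coneCE_g hn i :=
  (T.stringQuotient hn).toCone_gen (T.stringIncl_gen hn i)

theorem ofCone_stringQuotient_g (i : g.ι) :
    (T.stringQuotient hn).ofCone (T.coneCE_g hn i) = g.gen i :=
  ((T.stringQuotient hn).ofCone_inl _).trans (LInfty.addGenRetract_inl hn _ _ _ i)

theorem ofCone_stringQuotient_b : (T.stringQuotient hn).ofCone (T.coneCE_b hn) = 0 :=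
  ((T.stringQuotient hn).ofCone_inl _).trans (LInfty.addGenRetract_inr hn _ _ _)

theorem ofCone_stringQuotient_σb : (T.stringQuotient hn).ofCone (T.coneCE_σb hn) = T.μ := by
  refine ((T.stringQuotient hn).ofCone_inr ()).trans ?_
  refine (congrArg (fun y => -(T.stringQuotient hn).retract y) (T.stringExt_d_b hn)).trans ?_
  exact (congrArg Neg.neg ((T.stringQuotient hn).retract_incl _)).trans (neg_neg _)

theorem coneCE_d_σb : (T.coneCE hn).d (T.coneCE_σb hn) = 0 := by
  have hb : (T.coneCE hn).d ((T.stringQuotient hn).toCone (-T.μ)) = 0 := by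
    refine ((T.stringQuotient hn).toCone.apply_d _).symm.trans ?_
    refine (congrArg (T.stringQuotient hn).toCone ?_).trans (map_zero _)
    exact (map_neg g.d T.μ).trans ((congrArg Neg.neg T.d_μ).trans neg_zero)
  refine ((T.stringSub hn).cone_d_inr ()).trans ?_
  refine (congrArg (fun y => -(T.coneCE hn).d ((T.stringSub hn).coneIncl y))
    (T.stringExt_d_b hn)).trans ?_
  exact (congrArg Neg.neg hb).trans neg_zero

/-- The morphism `j : CE(b^n𝔲(1)) → CE(b^{n-1}𝔲(1) ↪ 𝔤_μ)`. -/
def lineToConeCE : DGHom (LInfty.line (n + 1) n.succ_pos).CE (T.coneCE hn).CE :=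
  LInfty.lineHom n.succ_pos (T.coneCE_σb hn)
    (LInfty.gen_mem (g := T.coneCE hn) (Sum.inr ())) (T.coneCE_d_σb hn)

theorem lineToConeCE_gen :
    T.lineToConeCE hn ((LInfty.line (n + 1) n.succ_pos).gen ()) = T.coneCE_σb hn :=
  LInfty.lineHom_gen (B := (T.coneCE hn).CE) _ _

end CE

section W

/-- The inclusion `W(𝔤) → CE(cs_P(𝔤))` as a morphism. -/
def csInclHom : DGHom g.W (T.csAlg hn).CE :=
  (T.ch.addGenHom n hn _ T.csAlg_mem T.csAlg_closed).comp
    (g.inn.addGenHom (n + 1) n.succ_pos T.P T.P_mem T.d_P)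

theorem csInclHom_gen (i : g.inn.ι) :
    T.csInclHom hn (g.inn.gen i) = (T.csAlg hn).gen (Sum.inl (Sum.inl i)) :=
  T.csIncl_gen hn i

/-- The retraction of `CE(cs_P(𝔤))` onto `W(𝔤)`, as graded algebras, which kills `b` and `c`. -/
def csRetract : FGC (T.csAlg hn).deg →ₐ[ℝ] FGC g.inn.deg :=
  (g.inn.addGenRetract n.succ_pos T.P T.P_mem T.d_P).comp
    (T.ch.addGenRetract hn _ T.csAlg_mem T.csAlg_closed)

theorem csRetract_g (i : g.inn.ι) :
    T.csRetract hn ((T.csAlg hn).gen (Sum.inl (Sum.inl i))) = g.inn.gen i :=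
  (congrArg _ (LInfty.addGenRetract_inl hn _ T.csAlg_mem T.csAlg_closed (Sum.inl i))).trans
    (LInfty.addGenRetract_inl n.succ_pos T.P T.P_mem T.d_P i)

theorem csRetract_c : T.csRetract hn ((T.csAlg hn).gen (Sum.inl (Sum.inr ()))) = 0 :=
  (congrArg _ (LInfty.addGenRetract_inl hn _ T.csAlg_mem T.csAlg_closed (Sum.inr ()))).trans
    (LInfty.addGenRetract_inr n.succ_pos T.P T.P_mem T.d_P)

theorem csRetract_b : T.csRetract hn ((T.csAlg hn).gen (Sum.inr ())) = 0 :=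
  (congrArg _ (LInfty.addGenRetract_inr hn _ T.csAlg_mem T.csAlg_closed)).trans
    (map_zero (g.inn.addGenRetract n.succ_pos T.P T.P_mem T.d_P))

theorem csRetract_incl (x : FGC g.inn.deg) : T.csRetract hn (T.csIncl hn x) = x :=
  (congrArg _ (LInfty.addGenRetract_incl hn _ T.csAlg_mem T.csAlg_closed _)).trans
    (LInfty.addGenRetract_incl n.succ_pos T.P T.P_mem T.d_P x)

theorem csRetract_gen_mem (i : (T.csAlg hn).ι) :
    T.csRetract hn ((T.csAlg hn).gen i) ∈ FGC.gr g.inn.deg ((T.csAlg hn).deg i) :=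
  FGC.algHom_mem_gr (B := g.W) (LInfty.addGenRetract_gen_mem n.succ_pos T.P T.P_mem T.d_P)
    (LInfty.addGenRetract_gen_mem hn _ T.csAlg_mem T.csAlg_closed i)

theorem inl_inl_notMem_range_csSub (i : g.inn.ι) :
    (Sum.inl (Sum.inl i) : (T.csAlg hn).ι) ∉ Set.range (T.csSub hn).s := by
  rintro ⟨_ | _, h⟩
  · exact Sum.inr_ne_inl h
  · exact Sum.inr_ne_inl (Sum.inl_injective h)

/-- The quotient of `cs_P(𝔤)` by `inn(b^{n-1}𝔲(1))` is `inn(𝔤)`. -/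
def csQuotient : (T.csSub hn).Quotient g.inn where
  incl := T.csInclHom hn
  retract := T.csRetract hn
  incl_mem i := Algebra.subset_adjoin
    ⟨_, T.inl_inl_notMem_range_csSub hn i, (T.csInclHom_gen hn i).symm⟩
  retract_mem := T.csRetract_gen_mem hn
  retract_incl := T.csRetract_incl hn
  incl_retract
    | Sum.inl (Sum.inl i), _ => (congrArg _ (T.csRetract_g hn i)).trans (T.csInclHom_gen hn i)
    | Sum.inl (Sum.inr ()), hi => absurd ⟨Sum.inr (), rfl⟩ hi
    | Sum.inr (), hi => absurd ⟨Sum.inl (), rfl⟩ hi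
  retract_s
    | Sum.inl () => T.csRetract_b hn
    | Sum.inr () => T.csRetract_c hn

theorem toCone_csQuotient_gen (i : g.inn.ι) :
    (T.csQuotient hn).toCone (g.inn.gen i) = T.coneW_g hn i :=
  (T.csQuotient hn).toCone_gen (T.csInclHom_gen hn i)

theorem ofCone_csQuotient_g (i : g.inn.ι) :
    (T.csQuotient hn).ofCone (T.coneW_g hn i) = g.inn.gen i :=
  ((T.csQuotient hn).ofCone_inl _).trans (T.csRetract_g hn i)

theorem ofCone_csQuotient_c : (T.csQuotient hn).ofCone (T.coneW_c hn) = 0 :=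
  ((T.csQuotient hn).ofCone_inl _).trans (T.csRetract_c hn)

theorem ofCone_csQuotient_b : (T.csQuotient hn).ofCone (T.coneW_b hn) = 0 :=
  ((T.csQuotient hn).ofCone_inl _).trans (T.csRetract_b hn)

theorem ofCone_csQuotient_σb : (T.csQuotient hn).ofCone (T.coneW_σb hn) = T.cs := by
  have hb : T.csRetract hn ((T.csAlg hn).d ((T.csAlg hn).gen (Sum.inr ()))) = -T.cs := by
    rw [csAlg_d_b, map_sub, csRetract_c, csRetract_incl, zero_sub]
  exact ((T.csQuotient hn).ofCone_inr (Sum.inl ())).trans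
    ((congrArg Neg.neg hb).trans (neg_neg _))

theorem ofCone_csQuotient_σc : (T.csQuotient hn).ofCone (T.coneW_σc hn) = -T.P := by
  have hc : T.csRetract hn ((T.csAlg hn).d ((T.csAlg hn).gen (Sum.inl (Sum.inr ())))) = T.P := by
    rw [csAlg_d_c, csRetract_incl]
  exact ((T.csQuotient hn).ofCone_inr (Sum.inr ())).trans (congrArg Neg.neg hc)

theorem coneW_d_σb : (T.coneW hn).d (T.coneW_σb hn) = -T.coneW_σc hn := by
  have hcs : T.csIncl hn T.cs ∈
      Algebra.adjoin ℝ ((T.csAlg hn).gen '' (Set.range (T.csSub hn).s)ᶜ) :=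
    (T.csQuotient hn).incl_mem_adjoin T.cs
  exact (T.csSub hn).cone_d_inr_of_d_eq (x := Sum.inl ()) (y := Sum.inr ()) hcs (T.csAlg_d_b hn)

/-- The morphism `ĵ : W(b^n𝔲(1)) → CE(inn(b^{n-1}𝔲(1)) ↪ cs_P(𝔤))`. -/
def lineToConeW : DGHom (LInfty.line (n + 1) n.succ_pos).W (T.coneW hn).CE :=
  LInfty.lineWeilHom n.succ_pos (T.coneW_σb hn)
    (LInfty.gen_mem (g := T.coneW hn) (Sum.inr (Sum.inl ())))

theorem lineToConeW_inl : T.lineToConeW hn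
    ((LInfty.line (n + 1) n.succ_pos).inn.gen (Sum.inl ())) = T.coneW_σb hn :=
  LInfty.lineWeilHom_inl (B := (T.coneW hn).CE) _ _ _

theorem lineToConeW_inr : T.lineToConeW hn
    ((LInfty.line (n + 1) n.succ_pos).inn.gen (Sum.inr ())) = -T.coneW_σc hn :=
  (LInfty.lineWeilHom_inr (B := (T.coneW hn).CE) _ _ _).trans (T.coneW_d_σb hn)

end W

end Transgression

namespace LInfty

variable {g : LInfty} {n : ℕ} {hn : 0 < n} {z : FGC g.deg} {hz : z ∈ FGC.gr g.deg (n + 1)}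
  {hdz : g.d z = 0} {B : DGCA.{v}}

theorem inclW_gen (g : LInfty) (i : g.ι) : g.inclW (g.gen i) = g.inn.gen (Sum.inl i) :=
  (NormalSub.refl g).incl_gen i

theorem inclW_gen_mem (i : g.ι) : g.inclW (g.gen i) ∈ FGC.gr g.inn.deg (g.deg i) :=
  (g.inclW_gen i).symm ▸ gen_mem (g := g.inn) (Sum.inl i)

section addGenLift

variable (hn z hz hdz) (φ : DGHom g.CE B) {β : B.carrier} (hβ : β ∈ B.gr n) (hd : B.d β = φ z)

/-- The extension of a morphism by the value `β` on an added generator. -/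
def addGenLift : DGHom (g.addGen n hn z hz hdz).CE B :=
  homOfGens (addGenExtend hn z hz hdz φ.toAlgHom (fun _ => φ.apply_mem (gen_mem _)) hβ)
    (addGenExtend_gen_mem hn z hz hdz _ _ hβ)
    (addGenExtend_d_gen hn z hz hdz _ _ hβ φ.apply_d hd)

theorem addGenLift_incl (x : FGC g.deg) :
    addGenLift hn z hz hdz φ hβ hd (g.addGenIncl n hn z hz hdz x) = φ x :=
  addGenExtend_incl hn z hz hdz φ.toAlgHom (fun _ => φ.apply_mem (gen_mem _)) hβ x

theorem exists_addGen_lift_iff : (∃ ψ : DGHom (g.addGen n hn z hz hdz).CE B,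
      ∀ x, ψ (g.addGenIncl n hn z hz hdz x) = φ x) ↔
    ∃ β ∈ B.gr n, B.d β = φ z := by
  refine ⟨fun ⟨ψ, hψ⟩ => ?_, fun ⟨β, hβ, hd⟩ => ⟨_, addGenLift_incl hn z hz hdz φ hβ hd⟩⟩
  let b := (g.addGen n hn z hz hdz).gen (Sum.inr ())
  refine ⟨ψ b, ψ.apply_mem (gen_mem (g := g.addGen n hn z hz hdz) (Sum.inr ())), ?_⟩
  refine (ψ.apply_d b).symm.trans ?_
  exact (congrArg ψ (g.addGen_d_gen n hn z hz hdz)).trans (hψ z)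

end addGenLift

section addGenInclW

theorem addGenIncl_inn_inl (i : g.ι) :
    g.addGenIncl_inn n hn z hz hdz (g.inn.gen (Sum.inl i)) =
      (g.addGen n hn z hz hdz).inn.gen (Sum.inl (Sum.inl i)) :=
  FGC.map_gen _ _ _

theorem addGenIncl_inn_inr (i : g.ι) :
    g.addGenIncl_inn n hn z hz hdz (g.inn.gen (Sum.inr i)) =
      (g.addGen n hn z hz hdz).inn.gen (Sum.inr (Sum.inl i)) :=
  FGC.map_gen _ _ _

theorem addGenIncl_inn_inclW (x : FGC g.deg) :
    g.addGenIncl_inn n hn z hz hdz (g.inclW x) =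
      (g.addGen n hn z hz hdz).inclW (g.addGenIncl n hn z hz hdz x) := by
  refine DFunLike.congr_fun (FGC.algHom_ext (f := (g.addGenIncl_inn n hn z hz hdz).comp g.inclW)
    (g := (g.addGen n hn z hz hdz).inclW.comp (g.addGenIncl n hn z hz hdz)) fun i => ?_) x
  refine (congrArg _ (g.inclW_gen i)).trans ((addGenIncl_inn_inl i).trans ?_)
  exact ((congrArg _ (g.addGenIncl_gen n hn z hz hdz i)).trans
    ((g.addGen n hn z hz hdz).inclW_gen (Sum.inl i))).symm

theorem addGenIncl_inn_gen_mem (i : g.inn.ι) :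
    g.addGenIncl_inn n hn z hz hdz (g.inn.gen i) ∈
      (g.addGen n hn z hz hdz).W.gr (g.inn.deg i) := by
  rcases i with i | i
  · exact (addGenIncl_inn_inl i).symm ▸
      gen_mem (g := (g.addGen n hn z hz hdz).inn) (Sum.inl (Sum.inl i))
  · exact (addGenIncl_inn_inr i).symm ▸
      gen_mem (g := (g.addGen n hn z hz hdz).inn) (Sum.inr (Sum.inl i))

theorem addGenIncl_inn_d_inl (i : g.ι) :
    g.addGenIncl_inn n hn z hz hdz (g.inn.d (g.inn.gen (Sum.inl i))) =
      (g.addGen n hn z hz hdz).inn.d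
        ((g.addGen n hn z hz hdz).inn.gen (Sum.inl (Sum.inl i))) := by
  rw [inn_d_inl, map_add, addGenIncl_inn_inclW, addGenIncl_inn_inr, ← addGen_d_incl,
    addGenIncl_gen]
  exact ((g.addGen n hn z hz hdz).inn_d_inl (Sum.inl i)).symm

variable (g hn z hz hdz) in
/-- The inclusion of Weil algebras induced by adding a generator, as a morphism. -/
def addGenInclW : DGHom g.W (g.addGen n hn z hz hdz).W :=
  homOfChain (g.addGenIncl_inn n hn z hz hdz) addGenIncl_inn_gen_mem <|
    (NormalSub.refl g).cone_subalgebra_eq_top (fun _ => d_mem_chainSubalgebra) fun i =>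
      (addGenIncl_inn_d_inl i).trans
        (congrArg (g.addGen n hn z hz hdz).inn.d (addGenIncl_inn_inl i).symm)

end addGenInclW

section addGenLiftW

variable (hn z hz hdz) (A : DGHom g.W B) {β : B.carrier} (hβ : β ∈ B.gr n)

/-- The extension of a morphism out of the Weil algebra by the value `β` on an added generator
and its differential on the shifted one. No closedness condition is needed. -/
def addGenLiftW : DGHom (g.addGen n hn z hz hdz).W B :=
  weilLift (addGenExtend hn z hz hdz (A.toAlgHom.comp g.inclW)
      (fun i => A.apply_mem (inclW_gen_mem i)) hβ)
    (addGenExtend_gen_mem hn z hz hdz _ _ hβ)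

theorem addGenLiftW_inl (i : g.ι) : addGenLiftW hn z hz hdz A hβ
    ((g.addGen n hn z hz hdz).inn.gen (Sum.inl (Sum.inl i))) = A (g.inn.gen (Sum.inl i)) := by
  refine (weilLift_inl (g := g.addGen n hn z hz hdz) _ _ (Sum.inl i)).trans ?_
  exact (addGenExtend_inl hn z hz hdz _ _ hβ i).trans (congrArg A (g.inclW_gen i))

theorem addGenLiftW_inr : addGenLiftW hn z hz hdz A hβ
    ((g.addGen n hn z hz hdz).inn.gen (Sum.inl (Sum.inr ()))) = β := by
  refine (weilLift_inl (g := g.addGen n hn z hz hdz) _ _ (Sum.inr ())).trans ?_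
  exact addGenExtend_inr hn z hz hdz _ _ hβ

theorem addGenLiftW_comp_addGenInclW :
    (addGenLiftW hn z hz hdz A hβ).comp (g.addGenInclW hn z hz hdz) = A :=
  W_hom_ext fun i => (congrArg _ (addGenIncl_inn_inl i)).trans
    (addGenLiftW_inl hn z hz hdz A hβ i)

/-- Only the value of `b` has to be lifted along `r`, since `W` imposes no relation on it. -/
theorem exists_W_lift_of_surjective {C : DGCA.{u}} (r : DGHom C B)
    (hr : ∀ b ∈ B.gr n, ∃ c ∈ C.gr n, r c = b) {φ : DGHom g.CE B} {A : DGHom g.W C}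
    (hA : ∀ x, r (A x) = φ (g.toCEHom x)) {ψ : DGHom (g.addGen n hn z hz hdz).CE B}
    (hψ : ∀ x, ψ (g.addGenIncl n hn z hz hdz x) = φ x) :
    ∃ F : DGHom (g.addGen n hn z hz hdz).W C,
      (∀ x, F (g.addGenIncl_inn n hn z hz hdz x) = A x) ∧
      ∀ x, r (F x) = ψ ((g.addGen n hn z hz hdz).toCEHom x) := by
  obtain ⟨c, hc, hrc⟩ := hr _ <| ψ.apply_mem
    (gen_mem (g := g.addGen n hn z hz hdz) (Sum.inr ()))
  refine ⟨addGenLiftW hn z hz hdz A hc,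
    DGHom.congr_fun (addGenLiftW_comp_addGenInclW hn z hz hdz A hc),
    DGHom.congr_fun (φ := r.comp _) (ψ := ψ.comp _) (W_hom_ext ?_)⟩
  rintro (i | _)
  · refine (congrArg r (addGenLiftW_inl hn z hz hdz A hc i)).trans ((hA _).trans ?_)
    refine (congrArg φ (g.toCE_inl i)).trans ((hψ _).symm.trans ?_)
    exact congrArg ψ ((g.addGenIncl_gen n hn z hz hdz i).trans
      ((g.addGen n hn z hz hdz).toCE_inl (Sum.inl i)).symm)
  · exact (congrArg r (addGenLiftW_inr hn z hz hdz A hc)).trans <|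
      hrc.trans (congrArg ψ ((g.addGen n hn z hz hdz).toCE_inl (Sum.inr ())).symm)

end addGenLiftW

end LInfty

namespace FGC

variable {ι : Type} {deg : ι → ℕ}

theorem mon_mem_of_forall_gen_mem {S : Subalgebra ℝ (FGC deg)} {l : List ι}
    (h : ∀ i ∈ l, gen deg i ∈ S) : mon deg l ∈ S := by
  induction l with
  | nil => exact mon_nil (deg := deg) ▸ S.one_mem
  | cons i l ih =>
    rw [List.forall_mem_cons] at h
    exact mon_cons (deg := deg) i l ▸ S.mul_mem h.1 (ih h.2)

open scoped Classical in
/-- `E` is the Euler operator `a ∂/∂a` of the generator `a`, which counts the occurrences of `a`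
in a monomial. -/
structure IsEuler (a : ι) (E : Module.End ℝ (FGC deg)) : Prop where
  map_one : E 1 = 0
  map_gen_mul (i : ι) (y : FGC deg) :
    E (gen deg i * y) = (if i = a then gen deg i * y else 0) + gen deg i * E y

namespace IsEuler

variable {a : ι} {E : Module.End ℝ (FGC deg)}

open scoped Classical in
theorem map_mon (hE : IsEuler a E) (l : List ι) :
    E (mon deg l) = (l.count a : ℝ) • mon deg l := by
  induction l with
  | nil => rw [List.count_nil, Nat.cast_zero, zero_smul, mon_nil, hE.map_one]
  | cons i l ih =>
    rw [mon_cons, hE.map_gen_mul, ih, mul_smul_comm, List.count_cons]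
    by_cases hi : i = a
    · rw [if_pos hi, if_pos (beq_iff_eq.mpr hi), Nat.cast_add, Nat.cast_one, add_smul, one_smul,
        add_comm]
    · rw [if_neg hi, if_neg (mt beq_iff_eq.mp hi), zero_add, add_zero]

theorem mem_adjoin_of_eq_zero (hE : IsEuler a E) {P : FGC deg} (hP : E P = 0) :
    P ∈ Algebra.adjoin ℝ (gen deg '' {a}ᶜ) := by
  classical
  let S := Algebra.adjoin ℝ (gen deg '' {a}ᶜ)
  let S₀ := Subalgebra.toSubmodule S ⊓ E.eigenspace 0
  let M := ⨆ (k : ℝ) (_ : k ≠ 0), E.eigenspace k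
  have hmon (l : List ι) : mon deg l ∈ S₀ ⊔ M := by
    have heigen := Module.End.mem_eigenspace_iff.mpr (hE.map_mon l)
    by_cases hl : a ∈ l
    · have hcount : (l.count a : ℝ) ≠ 0 := Nat.cast_ne_zero.mpr (List.count_pos_iff.mpr hl).ne'
      exact Submodule.mem_sup_right <|
        Submodule.mem_iSup_of_mem _ (Submodule.mem_iSup_of_mem hcount heigen)
    · rw [List.count_eq_zero.mpr hl, Nat.cast_zero] at heigen
      refine Submodule.mem_sup_left ⟨mon_mem_of_forall_gen_mem (S := S) fun i hi => ?_, heigen⟩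
      exact Algebra.subset_adjoin ⟨i, fun h => hl (h ▸ hi), rfl⟩
  have hspan : ⊤ ≤ S₀ ⊔ M :=
    span_mon.ge.trans (Submodule.span_le.mpr (Set.range_subset_iff.mpr hmon))
  obtain ⟨p, hp, q, hq, rfl⟩ := Submodule.mem_sup.mp (hspan (Submodule.mem_top (x := P)))
  have hker : p + q ∈ E.eigenspace 0 := by rw [Module.End.mem_eigenspace_iff, hP, zero_smul]
  have hq₀ : q = 0 := Submodule.disjoint_def.mp (E.eigenspaces_iSupIndep 0) q
    ((Submodule.add_mem_iff_right _ hp.2).mp hker) hq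
  rw [hq₀, add_zero]
  exact hp.1

end IsEuler

theorem deriv_gen_mul (k : ℕ) {v : ι → FGC deg} (hv : IsDerivData deg k v) (i : ι) (y : FGC deg) :
    deriv k v hv (gen deg i * y) =
      v i * y + (-1 : ℝ) ^ (k * deg i) • (gen deg i * deriv k v hv y) := by
  rw [deriv_mul, deriv_gen, parity_pow_gen, smul_mul_assoc]

section

variable {a : ι} {v : ι → FGC deg} {hv : IsDerivData deg (deg a) v}

theorem isEuler_mulLeft_comp_deriv (ha : v a = 1) (hne : ∀ i, i ≠ a → v i = 0) :
    IsEuler a (LinearMap.mulLeft ℝ (gen deg a) ∘ₗ deriv (deg a) v hv) where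
  map_one := by rw [LinearMap.comp_apply, deriv_one, map_zero]
  map_gen_mul i y := by
    have hsign : ((-1 : ℝ) ^ (deg a * deg i)) * (-1) ^ (deg a * deg i) = 1 := by
      rw [← mul_pow, neg_one_mul, neg_neg, one_pow]
    simp only [LinearMap.comp_apply, LinearMap.mulLeft_apply]
    rw [deriv_gen_mul, mul_add, mul_smul_comm, ← mul_assoc _ (gen deg i) (deriv _ _ _ _),
      gen_comm a i, smul_mul_assoc, smul_smul, hsign, one_smul, mul_assoc]
    split_ifs with hi
    · rw [hi, ha, one_mul]
    · rw [hne i hi, zero_mul, mul_zero]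

theorem mem_adjoin_of_deriv_eq_zero (ha : v a = 1) (hne : ∀ i, i ≠ a → v i = 0) {P : FGC deg}
    (hP : deriv (deg a) v hv P = 0) : P ∈ Algebra.adjoin ℝ (gen deg '' {a}ᶜ) :=
  (isEuler_mulLeft_comp_deriv (hv := hv) ha hne).mem_adjoin_of_eq_zero <| by
    rw [LinearMap.comp_apply, hP, map_zero]

end

end FGC

namespace LInfty

variable {L : LInfty}

theorem contractionVal_self (x : L.ι) : L.contractionVal x (Sum.inl x) = 1 :=
  if_pos rfl

theorem contractionVal_of_ne {x : L.ι} {i : L.inn.ι} (h : i ≠ Sum.inl x) :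
    L.contractionVal x i = 0 := by
  rcases i with i | i
  · exact if_neg fun hi => h (congrArg Sum.inl hi)
  · rfl

theorem mem_adjoin_of_contraction_eq_zero {x : L.ι} {P : FGC L.inn.deg}
    (hP : L.contraction x P = 0) : P ∈ Algebra.adjoin ℝ (L.inn.gen '' {Sum.inl x}ᶜ) :=
  FGC.mem_adjoin_of_deriv_eq_zero (deg := L.inn.deg) (a := Sum.inl x) (contractionVal_self x)
    (fun _ => contractionVal_of_ne) hP

theorem line_invSubalgebra (k : ℕ) (hk : 0 < k) : (line k hk).invSubalgebra =
    Algebra.adjoin ℝ {(line k hk).inn.gen (Sum.inr ())} := by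
  refine le_antisymm (fun P hP => ?_)
    (Algebra.adjoin_le (Set.singleton_subset_iff.mpr (line_curv_inv k hk)))
  refine Algebra.adjoin_mono ?_ (mem_adjoin_of_contraction_eq_zero (hP ()).1)
  rintro _ ⟨_ | _, hi, rfl⟩
  · exact absurd rfl hi
  · rfl

end LInfty

namespace DGHom

/-- The restriction to invariant polynomials of a morphism of Weil algebras preserving them. -/
def restrictInv {g h : LInfty} (F : DGHom h.W g.W)
    (hF : ∀ Q ∈ h.invSubalgebra, F Q ∈ g.invSubalgebra) : DGHom h.inv g.inv where
  toFun Q := ⟨F Q.1, hF Q.1 Q.2⟩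
  map_one' := Subtype.ext (map_one F.toAlgHom)
  map_mul' _ _ := Subtype.ext (map_mul F.toAlgHom _ _)
  map_zero' := Subtype.ext (map_zero F.toAlgHom)
  map_add' _ _ := Subtype.ext (map_add F.toAlgHom _ _)
  commutes' r := Subtype.ext (F.toAlgHom.commutes r)
  map_gr p Q hQ := F.map_gr p Q.1 hQ
  map_d Q := Subtype.ext (F.map_d Q.1)

theorem mapCohomology_cls_congr {A : DGCA.{u}} {A' : DGCA.{v}} {B : DGCA.{w}} {φ : DGHom A B}
    {φ' : DGHom A' B} {x : A.carrier} (hx : A.d x = 0) {x' : A'.carrier} (hx' : A'.d x' = 0)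
    (h : φ x = φ' x') : φ.mapCohomology (A.cls x hx) = φ'.mapCohomology (A'.cls x' hx') := by
  have hcls {y : B.carrier} (hy : B.d y = 0) (hφ : φ x = y) :
      φ.mapCohomology (A.cls x hx) = B.cls y hy := by
    subst hφ
    rfl
  exact hcls ((φ'.apply_d x').symm.trans ((congrArg φ' hx').trans (map_zero φ'.toAlgHom))) h

end DGHom

theorem DGCA.exists_toImage_eq {A : DGCA.{u}} {B : DGCA.{v}} (f : DGHom A B) {p : ℕ}
    {b : (DGCA.image f).carrier} (hb : b ∈ (DGCA.image f).gr p) :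
    ∃ a ∈ A.gr p, DGCA.toImage f a = b :=
  hb

/-- The connection descent object obtained by precomposition with compatible morphisms of Weil and
Chevalley–Eilenberg algebras preserving invariant polynomials. -/
def ConnDescent.precomp {E : Type*} [NormedAddCommGroup E] [NormedSpace ℝ E] {H : Type*}
    [TopologicalSpace H] {I : ModelWithCorners ℝ E H} {E' : Type*} [NormedAddCommGroup E']
    [NormedSpace ℝ E'] {H' : Type*} [TopologicalSpace H'] {J : ModelWithCorners ℝ E' H'}
    {Y : Type u} [TopologicalSpace Y] [ChartedSpace H Y] {X : Type v} [TopologicalSpace X]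
    [ChartedSpace H' X] {π : Y → X} {hπ : ContMDiff I J ∞ π} {g h : LInfty}
    (D : ConnDescent I J g π hπ) (F : DGHom h.W g.W) (G : DGHom h.CE g.CE)
    (hF : ∀ Q ∈ h.invSubalgebra, F Q ∈ g.invSubalgebra)
    (hFG : g.toCEHom.comp F = G.comp h.toCEHom) : ConnDescent I J h π hπ where
  Avert := D.Avert.comp G
  A := D.A.comp F
  K := D.K.comp (F.restrictInv hF)
  top x := (D.top (F x)).trans (congrArg D.Avert (DGHom.congr_fun hFG x))
  bot P := D.bot (F.restrictInv hF P)

namespace Transgression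

variable {g : LInfty} {n : ℕ} (T : Transgression g n) (hn : 0 < n)

/-- The morphism `CE(b^n 𝔲(1)) → CE(𝔤)` classifying the cocycle `μ`, factored through the mapping
cone. -/
def obstruction : DGHom (LInfty.line (n + 1) n.succ_pos).CE g.CE :=
  (T.stringQuotient hn).ofCone.comp (T.lineToConeCE hn)

theorem obstruction_gen : T.obstruction hn ((LInfty.line (n + 1) n.succ_pos).gen ()) = T.μ :=
  (congrArg (T.stringQuotient hn).ofCone (T.lineToConeCE_gen hn)).trans
    (T.ofCone_stringQuotient_σb hn)

/-- The morphism `W(b^n 𝔲(1)) → W(𝔤)` classifying the Chern–Simons element `cs`, factored through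
the mapping cone. -/
def obstructionW : DGHom (LInfty.line (n + 1) n.succ_pos).W g.W :=
  (T.csQuotient hn).ofCone.comp (T.lineToConeW hn)

theorem obstructionW_inl :
    T.obstructionW hn ((LInfty.line (n + 1) n.succ_pos).inn.gen (Sum.inl ())) = T.cs :=
  (congrArg (T.csQuotient hn).ofCone (T.lineToConeW_inl hn)).trans (T.ofCone_csQuotient_σb hn)

theorem obstructionW_inr :
    T.obstructionW hn ((LInfty.line (n + 1) n.succ_pos).inn.gen (Sum.inr ())) = T.P := by
  refine (congrArg (T.csQuotient hn).ofCone (T.lineToConeW_inr hn)).trans ?_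
  refine (map_neg (T.csQuotient hn).ofCone.toAlgHom _).trans ?_
  exact (congrArg Neg.neg (T.ofCone_csQuotient_σc hn)).trans (neg_neg _)

theorem toCEHom_comp_obstructionW : g.toCEHom.comp (T.obstructionW hn) =
    (T.obstruction hn).comp (LInfty.line (n + 1) n.succ_pos).toCEHom := by
  refine LInfty.W_hom_ext fun _ => ?_
  refine (congrArg g.toCE (T.obstructionW_inl hn)).trans (T.toCE_cs.trans ?_)
  exact ((congrArg (T.obstruction hn) ((LInfty.line (n + 1) n.succ_pos).toCE_inl ())).trans
    (T.obstruction_gen hn)).symm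

theorem obstructionW_mem_invSubalgebra :
    ∀ Q ∈ (LInfty.line (n + 1) n.succ_pos).invSubalgebra,
      T.obstructionW hn Q ∈ g.invSubalgebra := by
  suffices h : (LInfty.line (n + 1) n.succ_pos).invSubalgebra ≤
      g.invSubalgebra.comap (T.obstructionW hn).toAlgHom from h
  rw [LInfty.line_invSubalgebra]
  refine Algebra.adjoin_le (Set.singleton_subset_iff.mpr ?_)
  exact (congrArg (· ∈ g.invSubalgebra) (T.obstructionW_inr hn)).mpr T.P_inv

section Lift

variable {B : DGCA.{u}} {C : DGCA.{v}}

theorem exists_stringExt_lift_iff (φ : DGHom g.CE B) :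
    (∃ ψ : DGHom (T.stringExt hn).CE B, ∀ x, ψ (T.stringIncl hn x) = φ x) ↔
      IsTrivial (φ.comp (T.obstruction hn)) := by
  have hμ : φ.comp (T.obstruction hn) ((LInfty.line (n + 1) n.succ_pos).gen ()) = φ T.μ :=
    congrArg φ (T.obstruction_gen hn)
  refine (LInfty.exists_addGen_lift_iff hn (-T.μ) _ _ φ).trans ?_
  rw [LInfty.isTrivial_line_iff, hμ]
  have hneg : φ (-T.μ) = -φ T.μ := map_neg φ.toAlgHom _
  constructor
  · rintro ⟨β, hβ, hd⟩
    exact ⟨-β, Submodule.neg_mem _ hβ, by rw [map_neg, hd, hneg, neg_neg]⟩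
  · rintro ⟨β, hβ, hd⟩
    exact ⟨-β, Submodule.neg_mem _ hβ, by rw [map_neg, hd, hneg]⟩

theorem exists_stringExt_lift_pair_iff (r : DGHom C B)
    (hr : ∀ b ∈ B.gr n, ∃ c ∈ C.gr n, r c = b) {φ : DGHom g.CE B} {A : DGHom g.W C}
    (hA : ∀ x, r (A x) = φ (g.toCEHom x)) :
    (∃ (ψ : DGHom (T.stringExt hn).CE B) (F : DGHom (T.stringExt hn).W C),
      (∀ x, ψ (T.stringIncl hn x) = φ x) ∧ (∀ x, F (T.stringInclW hn x) = A x) ∧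
      ∀ x, r (F x) = ψ ((T.stringExt hn).toCEHom x)) ↔
    IsTrivial (φ.comp (T.obstruction hn)) := by
  rw [← exists_stringExt_lift_iff]
  refine ⟨fun ⟨ψ, _, hψ, _⟩ => ⟨ψ, hψ⟩, fun ⟨ψ, hψ⟩ => ?_⟩
  obtain ⟨F, hFA, hFψ⟩ := LInfty.exists_W_lift_of_surjective hn _ _ _ r hr hA hψ
  exact ⟨ψ, F, hψ, hFA, hFψ⟩

end Lift

section Descent

variable {E : Type*} [NormedAddCommGroup E] [NormedSpace ℝ E] {H : Type*} [TopologicalSpace H]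
  {I : ModelWithCorners ℝ E H} {E' : Type*} [NormedAddCommGroup E'] [NormedSpace ℝ E']
  {H' : Type*} [TopologicalSpace H'] {J : ModelWithCorners ℝ E' H'}
  {Y : Type u} [TopologicalSpace Y] [ChartedSpace H Y]
  {X : Type v} [TopologicalSpace X] [ChartedSpace H' X]
  {π : Y → X} {hπ : ContMDiff I J ∞ π} (D : ConnDescent I J g π hπ)

/-- The `b^n 𝔲(1)`-connection descent object obstructing the lift of `D` to `𝔤_μ`: its connection
is the Chern–Simons form and its curvature the value of `P`. -/
def obstructionConn : ConnDescent I J (LInfty.line (n + 1) n.succ_pos) π hπ :=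
  D.precomp (T.obstructionW hn) (T.obstruction hn) (T.obstructionW_mem_invSubalgebra hn)
    (T.toCEHom_comp_obstructionW hn)

theorem obstructionConn_K_lineCurv :
    (T.obstructionConn hn D).K (LInfty.lineCurv (n + 1) n.succ_pos) = D.K T.Pinv :=
  congrArg D.K (Subtype.ext (T.obstructionW_inr hn))

theorem obstructionConn_charClass_lineCurv :
    (T.obstructionConn hn D).charClass (LInfty.lineCurv (n + 1) n.succ_pos)
      (LInfty.d_lineCurv _ _) = D.charClass T.Pinv T.d_Pinv :=
  DGHom.mapCohomology_cls_congr _ _ (T.obstructionConn_K_lineCurv hn D)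

end Descent

end Transgression

end LiftObstruction

end

theorem mainTheorem3_general
    {E : Type*} [NormedAddCommGroup E] [NormedSpace ℝ E]
    {H : Type*} [TopologicalSpace H] (I : ModelWithCorners ℝ E H)
    {E' : Type*} [NormedAddCommGroup E'] [NormedSpace ℝ E']
    {H' : Type*} [TopologicalSpace H'] (J : ModelWithCorners ℝ E' H')
    {Y : Type*} [TopologicalSpace Y] [ChartedSpace H Y]
    {X : Type*} [TopologicalSpace X] [ChartedSpace H' X]
    (π : Y → X) (hπ : ContMDiff I J ∞ π)
    (g : LInfty) (n : ℕ) (hn : 0 < n) (T : Transgression g n) :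
    ∃ (f : DGHom g.CE (T.coneCE hn).CE) (finv : DGHom (T.coneCE hn).CE g.CE)
      (j : DGHom (LInfty.line (n + 1) n.succ_pos).CE (T.coneCE hn).CE)
      (fW : DGHom g.W (T.coneW hn).CE) (finvW : DGHom (T.coneW hn).CE g.W)
      (jW : DGHom (LInfty.line (n + 1) n.succ_pos).W (T.coneW hn).CE),
      ((∀ i, f (g.gen i) = T.coneCE_g hn i) ∧
        (∀ i, finv (T.coneCE_g hn i) = g.gen i) ∧
        finv (T.coneCE_b hn) = 0 ∧
        finv (T.coneCE_σb hn) = T.μ ∧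
        j ((LInfty.line (n + 1) n.succ_pos).gen ()) = T.coneCE_σb hn) ∧
      ((∀ i, fW (g.inn.gen i) = T.coneW_g hn i) ∧
        (∀ i, finvW (T.coneW_g hn i) = g.inn.gen i) ∧
        finvW (T.coneW_b hn) = 0 ∧
        finvW (T.coneW_c hn) = 0 ∧
        finvW (T.coneW_σb hn) = T.cs ∧
        finvW (T.coneW_σc hn) = -T.P ∧
        jW ((LInfty.line (n + 1) n.succ_pos).inn.gen (Sum.inl ())) = T.coneW_σb hn ∧
        jW ((LInfty.line (n + 1) n.succ_pos).inn.gen (Sum.inr ())) = -T.coneW_σc hn) ∧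
      (∀ x, finv (f x) = x) ∧ IsWeakInverse f finv ∧
      (∀ x, finvW (fW x) = x) ∧ IsWeakInverse fW finvW ∧
      (∀ Avert : Descent I g π,
        Avert.comp (finv.comp j) ((LInfty.line (n + 1) n.succ_pos).gen ()) = Avert T.μ ∧
        ((∃ Alift : Descent I (T.stringExt hn) π, ∀ x, Alift (T.stringIncl hn x) = Avert x) ↔
          IsTrivial (Avert.comp (finv.comp j)))) ∧
      (∀ D : ConnDescent I J g π hπ,
        ∃ D' : ConnDescent I J (LInfty.line (n + 1) n.succ_pos) π hπ,
          D'.Avert = D.Avert.comp (finv.comp j) ∧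
          D'.A = D.A.comp (finvW.comp jW) ∧
          (∀ Q : (LInfty.line (n + 1) n.succ_pos).inv.carrier,
            ∃ hQ : finvW (jW Q.1) ∈ g.invSubalgebra, D'.K Q = D.K ⟨finvW (jW Q.1), hQ⟩) ∧
          D'.A ((LInfty.line (n + 1) n.succ_pos).inn.gen (Sum.inl ())) = D.A T.cs ∧
          D'.A ((LInfty.line (n + 1) n.succ_pos).inn.gen (Sum.inr ())) = D.A T.P ∧
          D'.K (LInfty.lineCurv (n + 1) n.succ_pos) = D.K T.Pinv ∧
          D'.charClass (LInfty.lineCurv (n + 1) n.succ_pos) (LInfty.d_lineCurv _ _) =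
            D.charClass T.Pinv T.d_Pinv ∧
          ((∃ (Alift : Descent I (T.stringExt hn) π)
              (AWlift : DGHom (T.stringExt hn).W (Omega I Y)),
              (∀ x, Alift (T.stringIncl hn x) = D.Avert x) ∧
              (∀ x, AWlift (T.stringInclW hn x) = D.A x) ∧
              ∀ x, toVert I π (AWlift x) = Alift ((T.stringExt hn).toCEHom x)) ↔
            IsTrivial D'.Avert) ∧
          ((∃ Dlift : ConnDescent I J (T.stringExt hn) π hπ,
              (∀ x, Dlift.Avert (T.stringIncl hn x) = D.Avert x) ∧
              ∀ x, Dlift.A (T.stringInclW hn x) = D.A x) →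
            IsTrivial D'.Avert)) ∧
      (LInfty.line (n + 1) n.succ_pos).invSubalgebra =
        Algebra.adjoin ℝ {(LInfty.line (n + 1) n.succ_pos).inn.gen (Sum.inr ())} := by
  refine ⟨(T.stringQuotient hn).toCone, (T.stringQuotient hn).ofCone, T.lineToConeCE hn,
    (T.csQuotient hn).toCone, (T.csQuotient hn).ofCone, T.lineToConeW hn,
    ⟨T.toCone_stringQuotient_gen hn, T.ofCone_stringQuotient_g hn, T.ofCone_stringQuotient_b hn,
      T.ofCone_stringQuotient_σb hn, T.lineToConeCE_gen hn⟩,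
    ⟨T.toCone_csQuotient_gen hn, T.ofCone_csQuotient_g hn, T.ofCone_csQuotient_b hn,
      T.ofCone_csQuotient_c hn, T.ofCone_csQuotient_σb hn, T.ofCone_csQuotient_σc hn,
      T.lineToConeW_inl hn, T.lineToConeW_inr hn⟩,
    DGHom.congr_fun (T.stringQuotient hn).ofCone_comp_toCone, (T.stringQuotient hn).isWeakInverse,
    DGHom.congr_fun (T.csQuotient hn).ofCone_comp_toCone, (T.csQuotient hn).isWeakInverse,
    fun Avert => ?_, fun D => ?_, LInfty.line_invSubalgebra _ _⟩
  · exact ⟨congrArg Avert (T.obstruction_gen hn), T.exists_stringExt_lift_iff hn Avert⟩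
  · exact ⟨T.obstructionConn hn D, rfl, rfl,
      fun Q => ⟨T.obstructionW_mem_invSubalgebra hn Q.1 Q.2, rfl⟩,
      congrArg D.A (T.obstructionW_inl hn), congrArg D.A (T.obstructionW_inr hn),
      T.obstructionConn_K_lineCurv hn D, T.obstructionConn_charClass_lineCurv hn D,
      T.exists_stringExt_lift_pair_iff hn (toVert I π) (fun _ => DGCA.exists_toImage_eq _) D.top,
      fun ⟨Dlift, hlift, _⟩ => (T.exists_stringExt_lift_iff hn D.Avert).mp ⟨Dlift.Avert, hlift⟩⟩

theorem mainTheorem3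
    {E : Type*} [NormedAddCommGroup E] [NormedSpace ℝ E] [FiniteDimensional ℝ E]
    {H : Type*} [TopologicalSpace H] (I : ModelWithCorners ℝ E H) [I.Boundaryless]
    {E' : Type*} [NormedAddCommGroup E'] [NormedSpace ℝ E'] [FiniteDimensional ℝ E']
    {H' : Type*} [TopologicalSpace H'] (J : ModelWithCorners ℝ E' H') [J.Boundaryless]
    {Y : Type*} [TopologicalSpace Y] [ChartedSpace H Y] [IsManifold I ∞ Y]
    {X : Type*} [TopologicalSpace X] [ChartedSpace H' X] [IsManifold J ∞ X]
    (π : Y → X) (hπ : ContMDiff I J ∞ π) (hsurj : Function.Surjective π)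
    (hsub : Manifold.IsSubmersion I J ∞ π)
    (g : LInfty) (n : ℕ) (hn : 0 < n) (T : Transgression g n) :
    -- the map to the mapping cone, its weak inverse, and the injection of `b^n 𝔲(1)`,
    -- first for Chevalley–Eilenberg algebras, then for Weil algebras
    ∃ (f : DGHom g.CE (T.coneCE hn).CE) (finv : DGHom (T.coneCE hn).CE g.CE)
      (j : DGHom (LInfty.line (n + 1) n.succ_pos).CE (T.coneCE hn).CE)
      (fW : DGHom g.W (T.coneW hn).CE) (finvW : DGHom (T.coneW hn).CE g.W)
      (jW : DGHom (LInfty.line (n + 1) n.succ_pos).W (T.coneW hn).CE),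
      -- their values on generators
      ((∀ i, f (g.gen i) = T.coneCE_g hn i) ∧
        (∀ i, finv (T.coneCE_g hn i) = g.gen i) ∧
        finv (T.coneCE_b hn) = 0 ∧
        finv (T.coneCE_σb hn) = T.μ ∧
        j ((LInfty.line (n + 1) n.succ_pos).gen ()) = T.coneCE_σb hn) ∧
      ((∀ i, fW (g.inn.gen i) = T.coneW_g hn i) ∧
        (∀ i, finvW (T.coneW_g hn i) = g.inn.gen i) ∧
        finvW (T.coneW_b hn) = 0 ∧
        finvW (T.coneW_c hn) = 0 ∧
        finvW (T.coneW_σb hn) = T.cs ∧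
        finvW (T.coneW_σc hn) = -T.P ∧
        jW ((LInfty.line (n + 1) n.succ_pos).inn.gen (Sum.inl ())) = T.coneW_σb hn ∧
        jW ((LInfty.line (n + 1) n.succ_pos).inn.gen (Sum.inr ())) = -T.coneW_σc hn) ∧
      -- `finv` is a weak inverse, on both levels
      (∀ x, finv (f x) = x) ∧ IsWeakInverse f finv ∧
      (∀ x, finvW (fW x) = x) ∧ IsWeakInverse fW finvW ∧
      -- the obstruction to lifting a `𝔤`-descent object to a `𝔤_μ`-descent object
      (∀ Avert : Descent I g π,
        Avert.comp (finv.comp j) ((LInfty.line (n + 1) n.succ_pos).gen ()) = Avert T.μ ∧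
        ((∃ Alift : Descent I (T.stringExt hn) π, ∀ x, Alift (T.stringIncl hn x) = Avert x) ↔
          IsTrivial (Avert.comp (finv.comp j)))) ∧
      -- the obstruction for `𝔤`-connection descent objects
      (∀ D : ConnDescent I J g π hπ,
        ∃ D' : ConnDescent I J (LInfty.line (n + 1) n.succ_pos) π hπ,
          D'.Avert = D.Avert.comp (finv.comp j) ∧
          D'.A = D.A.comp (finvW.comp jW) ∧
          (∀ Q : (LInfty.line (n + 1) n.succ_pos).inv.carrier,
            ∃ hQ : finvW (jW Q.1) ∈ g.invSubalgebra, D'.K Q = D.K ⟨finvW (jW Q.1), hQ⟩) ∧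
          -- the connection form is the Chern–Simons form
          D'.A ((LInfty.line (n + 1) n.succ_pos).inn.gen (Sum.inl ())) = D.A T.cs ∧
          -- the curvature is `P(F_A)`, upstairs and on the base
          D'.A ((LInfty.line (n + 1) n.succ_pos).inn.gen (Sum.inr ())) = D.A T.P ∧
          D'.K (LInfty.lineCurv (n + 1) n.succ_pos) = D.K T.Pinv ∧
          -- the single characteristic class is the class of `P`
          D'.charClass (LInfty.lineCurv (n + 1) n.succ_pos) (LInfty.d_lineCurv _ _) =
            D.charClass T.Pinv T.d_Pinv ∧
          -- the cocycle and connection data lift precisely if the obstruction is trivial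
          ((∃ (Alift : Descent I (T.stringExt hn) π)
              (AWlift : DGHom (T.stringExt hn).W (Omega I Y)),
              (∀ x, Alift (T.stringIncl hn x) = D.Avert x) ∧
              (∀ x, AWlift (T.stringInclW hn x) = D.A x) ∧
              ∀ x, toVert I π (AWlift x) = Alift ((T.stringExt hn).toCEHom x)) ↔
            IsTrivial D'.Avert) ∧
          -- in particular, a lift of the whole object needs a trivial obstruction
          ((∃ Dlift : ConnDescent I J (T.stringExt hn) π hπ,
              (∀ x, Dlift.Avert (T.stringIncl hn x) = D.Avert x) ∧
              ∀ x, Dlift.A (T.stringInclW hn x) = D.A x) →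
            IsTrivial D'.Avert)) ∧
      -- `inv(b^n 𝔲(1))` is generated by the curvature
      (LInfty.line (n + 1) n.succ_pos).invSubalgebra =
        Algebra.adjoin ℝ {(LInfty.line (n + 1) n.succ_pos).inn.gen (Sum.inr ())} :=
  mainTheorem3_general I J π hπ g n hn T
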